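/- **Setting.** Let $\mathcal A_Q(\mathbb R^m)$ be the space of unordered $Q$-tuples $T=\sum_{i=1}^Q[\![P_i]\!]$ of points of $\mathbb R^m$, with $|T|^2=\sum_i|P_i|^2$ and distance $\mathcal G(T,S)=\min_\sigma\big(\sum_i|P_i-S_{\sigma(i)}|^2\big)^{1/2}$, the minimum being over permutations $\sigma$. For open $\Omega\subset\mathbb R^n$, a map $f=\sum_i[\![f_i]\!]$ belongs to $W^{1,2}(\Omega;\mathcal A_Q(\mathbb R^m))$ if there are nonnegative $\varphi_1,\dots,\varphi_n\in L^2(\Omega)$ such that for every $T\in\mathcal A_Q(\mathbb R^m)$ the function $x\mapsto\mathcal G(f(x),T)$ is in $W^{1,2}(\Omega)$ and $|\partial_j\mathcal G(f,T)|\le\varphi_j$ a.e. for all $j$. Let $Df_i$ denote the approximate differentials of such an $f$, which exist a.e.: $Df_i(x)=Df_k(x)$ whenever $f_i(x)=f_k(x)$, and $\mathcal G\big(f(y),\sum_i[\![f_i(x)+Df_i(x)(y-x)]\!]\big)=o(|y-x|)$ as $y\to x$ within a measurable set containing $x$ and having density $1$ at $x$. Write $\langle A:B\rangle$ for the Hilbert–Schmidt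 product and $|Df|^2=\sum_i\langle Df_i:Df_i\rangle$. The map $f\in W^{1,2}(\Omega;\mathcal A_Q(\mathbb R^m))$ is *Dir-stationary* if $$\int_\Omega\sum_{i=1}^Q\Big[\langle Df_i:D_x\psi(x,f_i)\rangle+\langle Df_i:D_u\psi(x,f_i)\cdot Df_i\rangle\Big]dx=0$$ for all $\psi\in C^\infty(\Omega\times\mathbb R^m;\mathbb R^m)$ with compact support in $x$ satisfying, for some constant $C'$, $|D_u\psi|\le C'$ and $|\psi|+|D_x\psi|\le C'(1+|u|)$, and $$2\int_\Omega\sum_{i=1}^Q\langle Df_i:Df_i\cdot D\phi\rangle\,dx-\int_\Omega|Df|^2\,\mathrm{div}\,\phi\,dx=0\qquad\text{for all }\phi\in C_c^\infty(\Omega;\mathbb R^n).$$ **Corollary (Three sphere inequality).** For every dimension $n$ there is a constant $C>0$, depending only on $n$, with the following property. Let $B_1\subset\mathbb R^n$ be the open unit ball centred at the origin, let $Q,m$ be arbitrary, let $\tau>0$, let $f\in W^{1,2}(B_1;\mathcal A_Q(\mathbb R^m))$ be Dir-stationary, let $x\in B_1$, and let $0<r_1<r_2<r_3<\frac{1-|x|}{2}$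 satisfy $\min\left(\frac{r_3}{r_2},\frac{r_2}{r_1}\right)>2$. Then $$\left[\frac1{1+(\log(r_3/r_2))^2}+\frac1{1+(\log(r_2/r_1))^2}\right]\frac{\|f\|^2_{L^2(B_{2r_2}(x)\setminus B_{r_2}(x))}}{r_2^{2\tau}}\le C\,\frac{\|f\|^2_{L^2(B_{2r_1}(x)\setminus B_{r_1}(x))}}{r_1^{2\tau}}+C\,\frac{\|f\|^2_{L^2(B_{2r_3}(x)\setminus B_{r_3}(x))}}{r_3^{2\tau}},$$ where $\|f\|^2_{L^2(A)}=\int_A|f|^2=\int_A\sum_{i=1}^Q|f_i|^2$. -/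

import Mathlib

open MeasureTheory Filter Topology Asymptotics
open scoped ContDiff

namespace QValued

/-- The Euclidean space `ℝ^d`. -/
abbrev Eu (d : ℕ) : Type := EuclideanSpace ℝ (Fin d)

/-- The space `𝒜_Q(ℝ^m)` of unordered `Q`-tuples of points of `ℝ^m` (with multiplicity),
i.e. of the sums `∑ᵢ ⟦Pᵢ⟧` of `Q` Dirac masses. -/
abbrev AQ (Q m : ℕ) : Type := Sym (Eu m) Q

/-- The unordered tuple `∑ᵢ ⟦pᵢ⟧` with the enumeration `p`. -/
def ofPoints {Q m : ℕ} (p : Fin Q → Eu m) : AQ Q m :=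
  ⟨Finset.univ.val.map p, by simp⟩

/-- The distance of `𝒜_Q(ℝ^m)`: `𝒢(T, S)` is the least value of `(∑ᵢ |pᵢ - qᵢ|²)^{1/2}` over all
enumerations `p` of `T` and `q` of `S` (equivalently, for fixed enumerations, over all
permutations of one of them). -/
noncomputable def dG {Q m : ℕ} (T S : AQ Q m) : ℝ :=
  sInf {d : ℝ | ∃ p q : Fin Q → Eu m, ofPoints p = T ∧ ofPoints q = S ∧
    d = Real.sqrt (∑ i, ‖p i - q i‖ ^ 2)}

/-- `|T|² = ∑ᵢ |Pᵢ|²` for `T = ∑ᵢ ⟦Pᵢ⟧`. -/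
noncomputable def normSq {Q m : ℕ} (T : AQ Q m) : ℝ :=
  ((T : Multiset (Eu m)).map fun v => ‖v‖ ^ 2).sum

/-- The `j`-th standard basis vector of `ℝ^n`. -/
noncomputable def stdVec {n : ℕ} (j : Fin n) : Eu n := EuclideanSpace.single j 1

/-- `v` is the weak partial derivative `∂_j u` of `u` on the open set `Ω ⊆ ℝ^n`. -/
def HasWeakPartialDeriv {n : ℕ} (Ω : Set (Eu n)) (j : Fin n) (u v : Eu n → ℝ) : Prop :=
  ∀ η : Eu n → ℝ, ContDiff ℝ ∞ η → HasCompactSupport η → tsupport η ⊆ Ω →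
    ∫ x in Ω, u x * fderiv ℝ η x (stdVec j) = - ∫ x in Ω, v x * η x

/-- `f ∈ W^{1,2}(Ω; 𝒜_Q(ℝ^m))`: there are nonnegative `φ_j ∈ L²(Ω)`, `j = 1, …, n`, such that for
every `T ∈ 𝒜_Q(ℝ^m)` the real function `x ↦ 𝒢(f(x), T)` lies in `W^{1,2}(Ω)` and satisfies
`|∂_j 𝒢(f, T)| ≤ φ_j` almost everywhere in `Ω` for every `j`. (Measurability of `f` on `Ω` is
contained in the measurability of all the functions `𝒢(f, T)`, as `𝒜_Q(ℝ^m)` is separable.) -/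
def MemW12 {n Q m : ℕ} (Ω : Set (Eu n)) (f : Eu n → AQ Q m) : Prop :=
  ∃ φ : Fin n → Eu n → ℝ,
    (∀ j, MemLp (φ j) 2 (volume.restrict Ω) ∧ ∀ x, 0 ≤ φ j x) ∧
    ∀ T : AQ Q m,
      MemLp (fun x => dG (f x) T) 2 (volume.restrict Ω) ∧
      ∃ g : Fin n → Eu n → ℝ, ∀ j,
        MemLp (g j) 2 (volume.restrict Ω) ∧
        HasWeakPartialDeriv Ω j (fun x => dG (f x) T) (g j) ∧
        ∀ᵐ x ∂(volume.restrict Ω), |g j x| ≤ φ j x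

/-- The set `S` has Lebesgue density one at `x`. -/
def HasDensityOne {n : ℕ} (S : Set (Eu n)) (x : Eu n) : Prop :=
  Tendsto (fun r : ℝ => volume (S ∩ Metric.ball x r) / volume (Metric.ball x r))
    (𝓝[>] (0 : ℝ)) (𝓝 1)

/-- `f` is approximately differentiable at `x`, and `i ↦ (fᵢ(x), Dfᵢ(x)) = J i` is an enumeration
of its first order jet: `f(x) = ∑ᵢ ⟦fᵢ(x)⟧`, one has `Dfᵢ(x) = Dfⱼ(x)` whenever
`fᵢ(x) = fⱼ(x)`, and `𝒢(f(y), ∑ᵢ ⟦fᵢ(x) + Dfᵢ(x)(y - x)⟧) = o(|y - x|)` as `y → x` within some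
measurable set which contains `x` and has density one there. Up to the order of the `Q` pairs,
there is at most one such `J`. -/
structure IsApproxJet {n Q m : ℕ} (f : Eu n → AQ Q m) (x : Eu n)
    (J : Fin Q → Eu m × (Eu n →L[ℝ] Eu m)) : Prop where
  value : ofPoints (fun i => (J i).1) = f x
  compatible : ∀ i k, (J i).1 = (J k).1 → (J i).2 = (J k).2
  approx : ∃ S : Set (Eu n), MeasurableSet S ∧ x ∈ S ∧ HasDensityOne S x ∧
    (fun y => dG (f y) (ofPoints fun i => (J i).1 + (J i).2 (y - x)))
      =o[𝓝[S] x] (fun y => y - x)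

open Classical in
/-- An enumeration `i ↦ (fᵢ(x), Dfᵢ(x))` of the first order jet of `f` at `x` (and `0` at the points
where `f` is not approximately differentiable, a null set for Sobolev maps). Only expressions which
are symmetric in `i` are formed from it, so the choice of the enumeration does not matter. -/
noncomputable def jet {n Q m : ℕ} (f : Eu n → AQ Q m) (x : Eu n) :
    Fin Q → Eu m × (Eu n →L[ℝ] Eu m) :=
  if h : ∃ J, IsApproxJet f x J then h.choose else 0

/-- The value `fᵢ(x)`. -/
noncomputable def val {n Q m : ℕ} (f : Eu n → AQ Q m) (x : Eu n) (i : Fin Q) : Eu m :=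
  (jet f x i).1

/-- The differential `Dfᵢ(x)`. -/
noncomputable def D {n Q m : ℕ} (f : Eu n → AQ Q m) (x : Eu n) (i : Fin Q) :
    Eu n →L[ℝ] Eu m :=
  (jet f x i).2

/-- The Hilbert–Schmidt scalar product `⟨A : B⟩`. -/
noncomputable def hs {n m : ℕ} (A B : Eu n →L[ℝ] Eu m) : ℝ :=
  ∑ j, inner ℝ (A (stdVec j)) (B (stdVec j))

/-- The divergence of a vector field on `ℝ^n`. -/
noncomputable def divergence {n : ℕ} (φ : Eu n → Eu n) (x : Eu n) : ℝ :=
  ∑ j, (fderiv ℝ φ x (stdVec j)) j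

/-- The admissible test maps of the outer variations on `Ω`: smooth `ψ(x, u)` with compact support
in `x ∈ Ω`, with `|D_u ψ| ≤ C` and `|ψ| + |D_x ψ| ≤ C (1 + |u|)` for some constant `C`. -/
structure IsOuterTest {n m : ℕ} (Ω : Set (Eu n)) (ψ : Eu n → Eu m → Eu m) : Prop where
  smooth : ContDiff ℝ ∞ (fun z : Eu n × Eu m => ψ z.1 z.2)
  support : ∃ K : Set (Eu n), IsCompact K ∧ K ⊆ Ω ∧ ∀ x, x ∉ K → ∀ u, ψ x u = 0
  growth : ∃ C : ℝ, ∀ x u, ‖fderiv ℝ (ψ x) u‖ ≤ C ∧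
    ‖ψ x u‖ + ‖fderiv ℝ (fun y => ψ y u) x‖ ≤ C * (1 + ‖u‖)

/-- The integrand `∑ᵢ ⟨Dfᵢ : D_x ψ(x, fᵢ)⟩ + ⟨Dfᵢ : D_u ψ(x, fᵢ) · Dfᵢ⟩` of the outer variation. -/
noncomputable def outerIntegrand {n Q m : ℕ} (f : Eu n → AQ Q m) (ψ : Eu n → Eu m → Eu m)
    (x : Eu n) : ℝ :=
  ∑ i, (hs (D f x i) (fderiv ℝ (fun y => ψ y (val f x i)) x) +
    hs (D f x i) ((fderiv ℝ (ψ x) (val f x i)).comp (D f x i)))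

/-- The integrand `2 ∑ᵢ ⟨Dfᵢ : Dfᵢ · Dφ⟩ - |Df|² div φ` of the inner variation. -/
noncomputable def innerIntegrand {n Q m : ℕ} (f : Eu n → AQ Q m) (φ : Eu n → Eu n)
    (x : Eu n) : ℝ :=
  2 * ∑ i, hs (D f x i) ((D f x i).comp (fderiv ℝ φ x)) -
    (∑ i, hs (D f x i) (D f x i)) * divergence φ x

/-- `f ∈ W^{1,2}(Ω; 𝒜_Q(ℝ^m))` is Dir-stationary: the outer and the inner variations of its
Dirichlet energy vanish. -/
structure DirStationary {n Q m : ℕ} (Ω : Set (Eu n)) (f : Eu n → AQ Q m) : Prop where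
  memW12 : MemW12 Ω f
  outer : ∀ ψ : Eu n → Eu m → Eu m, IsOuterTest Ω ψ →
    IntegrableOn (outerIntegrand f ψ) Ω ∧ ∫ x in Ω, outerIntegrand f ψ x = 0
  inner : ∀ φ : Eu n → Eu n, ContDiff ℝ ∞ φ → HasCompactSupport φ → tsupport φ ⊆ Ω →
    IntegrableOn (innerIntegrand f φ) Ω ∧ ∫ x in Ω, innerIntegrand f φ x = 0

/-- `‖f‖²_{L²(B_{2r}(x) ∖ B_r(x))}`. -/
noncomputable def annulusL2Sq {n Q m : ℕ} (f : Eu n → AQ Q m) (x : Eu n) (r : ℝ) : ℝ :=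
  ∫ y in Metric.ball x (2 * r) \ Metric.ball x r, normSq (f y)

end QValued

/-! Let `H r` be `annulusL2Sq f x r / r ^ (2 * τ)`. Everything rests on a convexity property: up to
smoothing the indicator of the annulus, `H` is a convex function of `log r`. Hence `H r₂ ≤ max (H
r₁) (H r₃)`. The logarithmic bracket is at most `2`, so `C = 2` suffices.

Convexity comes from stationarity. Put t = |y - x|². Test the outer variation with χ(t)·u and the
inner variation with θ(t)·(y - x), choosing χ so that |Df|² has the same coefficient in both.
Subtracting removes |Df|² and leaves an identity between weighted integrals of ∑|Dfᵢ(y - x)|² and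
∑⟨fᵢ, Dfᵢ(y - x)⟩. The second sum is half the radial derivative of |f|², so integration by parts
turns it into |f|². Integrating the pointwise inequality ∑|Dfᵢ(y - x) - c fᵢ|² ≥ 0 against w(t),
where w = θ' ≥ 0, therefore gives an inequality in |f|² alone: 0 ≤ ∫ |f|² (c + L/2)² w with L = n +
2t d/dt (`DirStationary.integral_normSq_radial_nonneg`). For w = t^(-τ) v(log t) and c = τ - n/2 the
operator (c + L/2)² only differentiates v twice, so ∫ |f|² t^(-τ) v''(log t) ≥ 0. Translating v
makes this a nonnegative second derivative (`DirStationary.convexOn_logIntegral`), and cutoffs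
approximating the annulus give the bound for `H` (`DirStationary.annulus_le_add`).

The analytic work lies in the integration by parts. The Sobolev condition concerns weak derivatives
of the functions 𝒢(f, T), while the variations involve approximate differentials.
`MemW12.exists_weakDeriv_normSq` connects them. A maximal function argument cuts Ω, up to a null
set, into pieces on which f is Lipschitz. On smaller pieces f splits into ordered Lipschitz
functions, to which Rademacher's theorem applies. Weak derivatives vanish a.e. on zero sets, so they
agree there with the classical derivatives of Lipschitz extensions. -/

namespace QValued

/-! ### The metric space of unordered tuples. -/

section Tuples

variable {Q m : ℕ}

theorem exists_ofPoints (T : AQ Q m) : ∃ p : Fin Q → Eu m, ofPoints p = T := by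
  obtain ⟨s, hs⟩ := T
  obtain ⟨l, rfl⟩ := Quotient.exists_rep s
  change l.length = Q at hs
  subst hs
  refine ⟨l.get, Subtype.ext ?_⟩
  change Finset.univ.val.map l.get = (l : Multiset (Eu m))
  rw [Fin.univ_val_map, List.ofFn_get]

/-- Equal multisets have fibres of equal size over every value; bijections between the fibres glue
to a permutation. -/
theorem ofPoints_eq_iff {p q : Fin Q → Eu m} :
    ofPoints p = ofPoints q ↔ ∃ σ : Equiv.Perm (Fin Q), ∀ i, p i = q (σ i) := by
  classical
  constructor
  · intro h
    have h' : Finset.univ.val.map p = Finset.univ.val.map q := congrArg Subtype.val h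
    have key : ∀ c, Nonempty ({a // p a = c} ≃ {b // q b = c}) := by
      intro c
      rw [← Fintype.card_eq, Fintype.card_subtype, Fintype.card_subtype]
      have h2 := congrArg (Multiset.count c) h'
      rw [Multiset.count_map, Multiset.count_map] at h2
      simp only [Finset.card_def, Finset.filter_val]
      simpa [eq_comm] using h2
    exact ⟨Equiv.ofFiberEquiv fun c => (key c).some, fun i =>
      (Equiv.ofFiberEquiv_map (fun c => (key c).some) i).symm⟩
  · rintro ⟨σ, hσ⟩
    apply Subtype.ext
    change Finset.univ.val.map p = Finset.univ.val.map q
    have : p = q ∘ σ := funext hσ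
    rw [this, ← Multiset.map_map, Multiset.map_univ_val_equiv]

/-- The Euclidean distance of two enumerated tuples. -/
noncomputable def tupleDist (p q : Fin Q → Eu m) : ℝ := Real.sqrt (∑ i, ‖p i - q i‖ ^ 2)

theorem tupleDist_eq_norm (p q : Fin Q → Eu m) :
    tupleDist p q = ‖WithLp.toLp 2 p - WithLp.toLp 2 q‖ := by
  rw [PiLp.norm_eq_of_L2]; rfl

theorem tupleDist_nonneg (p q : Fin Q → Eu m) : 0 ≤ tupleDist p q := Real.sqrt_nonneg _

theorem tupleDist_triangle (p q r : Fin Q → Eu m) :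
    tupleDist p r ≤ tupleDist p q + tupleDist q r := by
  simp only [tupleDist_eq_norm]
  exact norm_sub_le_norm_sub_add_norm_sub _ _ _

theorem tupleDist_comp (σ : Equiv.Perm (Fin Q)) (p q : Fin Q → Eu m) :
    tupleDist (p ∘ σ) (q ∘ σ) = tupleDist p q := by
  simp only [tupleDist, Function.comp]
  rw [Equiv.sum_comp σ fun i => ‖p i - q i‖ ^ 2]

theorem norm_sub_le_tupleDist (p q : Fin Q → Eu m) (i : Fin Q) :
    ‖p i - q i‖ ≤ tupleDist p q := by
  rw [tupleDist_eq_norm]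
  exact PiLp.norm_apply_le (WithLp.toLp 2 p - WithLp.toLp 2 q) i

theorem tupleDist_le_of_forall_le {p q : Fin Q → Eu m} {p' q' : Fin Q → Eu m}
    (h : ∀ i, ‖p i - q i‖ ≤ ‖p' i - q' i‖) : tupleDist p q ≤ tupleDist p' q' :=
  Real.sqrt_le_sqrt (Finset.sum_le_sum fun i _ => pow_le_pow_left₀ (norm_nonneg _) (h i) 2)

theorem tupleDist_le_sum (p q : Fin Q → Eu m) : tupleDist p q ≤ ∑ i, ‖p i - q i‖ := by
  apply Real.sqrt_le_iff.2
  refine ⟨Finset.sum_nonneg fun i _ => norm_nonneg _, ?_⟩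
  exact Finset.sum_sq_le_sq_sum_of_nonneg fun i _ => norm_nonneg _

/-- Permuting both enumerations simultaneously does not change `tupleDist`, so one permutation is
enough. The infimum then runs over a finite set and is attained. -/
theorem dG_ofPoints_set (p q : Fin Q → Eu m) :
    {d : ℝ | ∃ p' q' : Fin Q → Eu m, ofPoints p' = ofPoints p ∧ ofPoints q' = ofPoints q ∧
      d = Real.sqrt (∑ i, ‖p' i - q' i‖ ^ 2)} =
      Set.range fun σ : Equiv.Perm (Fin Q) => tupleDist p (q ∘ σ) := by
  ext d
  constructor
  · rintro ⟨p', q', hp, hq, rfl⟩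
    obtain ⟨σ, hσ⟩ := ofPoints_eq_iff.1 hp
    obtain ⟨π, hπ⟩ := ofPoints_eq_iff.1 hq
    refine ⟨σ.symm.trans π, ?_⟩
    change _ = tupleDist p' q'
    rw [show p' = p ∘ σ from funext hσ, show q' = q ∘ π from funext hπ]
    refine (tupleDist_comp σ p _).symm.trans (congrArg _ ?_)
    funext i
    simp
  · rintro ⟨σ, rfl⟩
    exact ⟨p, q ∘ σ, rfl, ofPoints_eq_iff.2 ⟨σ, fun i => rfl⟩, rfl⟩

theorem exists_perm_dG_eq (p q : Fin Q → Eu m) :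
    ∃ σ : Equiv.Perm (Fin Q), dG (ofPoints p) (ofPoints q) = tupleDist p (q ∘ σ) := by
  have h : dG (ofPoints p) (ofPoints q) ∈
      Set.range fun σ : Equiv.Perm (Fin Q) => tupleDist p (q ∘ σ) := by
    rw [dG, dG_ofPoints_set]
    exact (Set.range_nonempty _).csInf_mem (Set.finite_range _)
  obtain ⟨σ, hσ⟩ := h
  exact ⟨σ, hσ.symm⟩

theorem dG_ofPoints_le (p q : Fin Q → Eu m) : dG (ofPoints p) (ofPoints q) ≤ tupleDist p q := by
  rw [dG, dG_ofPoints_set]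
  exact csInf_le (Set.finite_range _).bddBelow ⟨Equiv.refl _, rfl⟩

theorem dG_nonneg (T S : AQ Q m) : 0 ≤ dG T S := by
  obtain ⟨p, rfl⟩ := exists_ofPoints T
  obtain ⟨q, rfl⟩ := exists_ofPoints S
  obtain ⟨σ, hσ⟩ := exists_perm_dG_eq p q
  rw [hσ]
  exact tupleDist_nonneg _ _

theorem dG_comm (T S : AQ Q m) : dG T S = dG S T := by
  unfold dG
  congr 1
  ext d
  constructor <;>
  · rintro ⟨p, q, hp, hq, rfl⟩
    exact ⟨q, p, hq, hp, by simp only [norm_sub_rev]⟩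

theorem dG_triangle (T U S : AQ Q m) : dG T S ≤ dG T U + dG U S := by
  obtain ⟨p, rfl⟩ := exists_ofPoints T
  obtain ⟨q, rfl⟩ := exists_ofPoints U
  obtain ⟨r, rfl⟩ := exists_ofPoints S
  obtain ⟨σ, hσ⟩ := exists_perm_dG_eq p q
  obtain ⟨π, hπ⟩ := exists_perm_dG_eq q r
  rw [hσ, hπ, ← tupleDist_comp σ q]
  have : ofPoints r = ofPoints ((r ∘ π) ∘ σ) :=
    ofPoints_eq_iff.2 ⟨(σ.trans π).symm, fun i => by simp⟩
  rw [this]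
  exact (dG_ofPoints_le _ _).trans (tupleDist_triangle _ _ _)

theorem abs_dG_sub_le (T S U : AQ Q m) : |dG T U - dG S U| ≤ dG T S := by
  rw [abs_sub_le_iff]
  constructor
  · linarith [dG_triangle T S U]
  · linarith [dG_triangle S T U, dG_comm T S]

theorem eq_of_dG_eq_zero {T S : AQ Q m} (h : dG T S = 0) : T = S := by
  obtain ⟨p, rfl⟩ := exists_ofPoints T
  obtain ⟨q, rfl⟩ := exists_ofPoints S
  obtain ⟨σ, hσ⟩ := exists_perm_dG_eq p q
  refine ofPoints_eq_iff.2 ⟨σ, fun i => ?_⟩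
  have := norm_sub_le_tupleDist p (q ∘ σ) i
  rw [← hσ, h] at this
  exact sub_eq_zero.1 (norm_le_zero_iff.1 this)

/-- The tuple `Q⟦0⟧`. -/
noncomputable def zeroTuple (Q m : ℕ) : AQ Q m := ofPoints 0

theorem normSq_ofPoints (p : Fin Q → Eu m) : normSq (ofPoints p) = ∑ i, ‖p i‖ ^ 2 := by
  change ((Finset.univ.val.map p).map fun v => ‖v‖ ^ 2).sum = _
  rw [Multiset.map_map]
  rfl

theorem dG_zeroTuple_sq (T : AQ Q m) : dG T (zeroTuple Q m) ^ 2 = normSq T := by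
  obtain ⟨p, rfl⟩ := exists_ofPoints T
  obtain ⟨σ, hσ⟩ := exists_perm_dG_eq p 0
  rw [zeroTuple, hσ, tupleDist, Real.sq_sqrt (Finset.sum_nonneg fun i _ => by positivity),
    normSq_ofPoints]
  simp

theorem normSq_nonneg (T : AQ Q m) : 0 ≤ normSq T := by
  rw [← dG_zeroTuple_sq]; positivity

/-- A dense sequence in the space of tuples. -/
noncomputable def denseTuple (Q m : ℕ) (k : ℕ) : AQ Q m :=
  ofPoints (TopologicalSpace.denseSeq (Fin Q → Eu m) k)

theorem exists_denseTuple_dG_lt (T : AQ Q m) {ε : ℝ} (hε : 0 < ε) :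
    ∃ k, dG T (denseTuple Q m k) < ε := by
  obtain ⟨p, rfl⟩ := exists_ofPoints T
  have hc : Continuous fun q : Fin Q → Eu m => tupleDist p q := by
    unfold tupleDist; fun_prop
  have ho : IsOpen {q : Fin Q → Eu m | tupleDist p q < ε} := isOpen_lt hc continuous_const
  obtain ⟨k, hk⟩ := (TopologicalSpace.denseRange_denseSeq (Fin Q → Eu m)).exists_mem_open ho
    ⟨p, by simpa [tupleDist] using hε⟩
  exact ⟨k, (dG_ofPoints_le _ _).trans_lt hk⟩

/-- The distances to a dense sequence embed the tuples isometrically in a sup-norm space. This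
reduces Lipschitz bounds for `f` to countably many scalar Sobolev functions. -/
theorem dG_le_of_forall_denseTuple {T S : AQ Q m} {c : ℝ}
    (h : ∀ k, |dG T (denseTuple Q m k) - dG S (denseTuple Q m k)| ≤ c) : dG T S ≤ c := by
  apply le_of_forall_pos_le_add
  intro ε hε
  obtain ⟨k, hk⟩ := exists_denseTuple_dG_lt T (half_pos hε)
  have h1 := (abs_sub_le_iff.1 (h k)).2
  have h2 := dG_triangle T (denseTuple Q m k) S
  rw [dG_comm (denseTuple Q m k) S] at h2
  linarith

end Tuples

/-! ### Sets of density one. -/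

section Density

variable {n : ℕ}

theorem volume_ball_ne_zero' (x : Eu n) {r : ℝ} (hr : 0 < r) : volume (Metric.ball x r) ≠ 0 :=
  (Metric.measure_ball_pos volume x hr).ne'

theorem measure_inter_closedBall_eq (S : Set (Eu n)) (x : Eu n) {r : ℝ} (hr : 0 < r) :
    volume (S ∩ Metric.closedBall x r) = volume (S ∩ Metric.ball x r) := by
  refine le_antisymm ?_ (measure_mono (Set.inter_subset_inter_right _ Metric.ball_subset_closedBall))
  have h : S ∩ Metric.closedBall x r ⊆ (S ∩ Metric.ball x r) ∪ Metric.sphere x r := by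
    intro y hy
    rcases (Metric.mem_closedBall.1 hy.2).lt_or_eq with h | h
    · exact Or.inl ⟨hy.1, h⟩
    · exact Or.inr h
  refine (measure_mono h).trans ((measure_union_le _ _).trans ?_)
  rw [Measure.addHaar_sphere_of_ne_zero _ _ hr.ne', add_zero]

theorem hasDensityOne_iff_closedBall {S : Set (Eu n)} {x : Eu n} :
    HasDensityOne S x ↔ Tendsto (fun r : ℝ =>
      volume (S ∩ Metric.closedBall x r) / volume (Metric.closedBall x r)) (𝓝[>] 0) (𝓝 1) := by
  refine tendsto_congr' ?_
  filter_upwards [self_mem_nhdsWithin] with r hr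
  have h1 := measure_inter_closedBall_eq S x hr
  have h2 := measure_inter_closedBall_eq Set.univ x hr
  simp only [Set.univ_inter] at h2
  rw [h1, h2]

theorem ae_hasDensityOne (S : Set (Eu n)) : ∀ᵐ x ∂(volume.restrict S), HasDensityOne S x := by
  simp only [hasDensityOne_iff_closedBall]
  exact Besicovitch.ae_tendsto_measure_inter_div volume S

/-- Inside a ball B, |S ∩ B| + |T ∩ B| - |B| ≤ |S ∩ T ∩ B|; after division by |B| the left side
tends to 1. -/
theorem HasDensityOne.inter {S T : Set (Eu n)} {x : Eu n} (hS : HasDensityOne S x)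
    (hT : HasDensityOne T x) (hm : MeasurableSet S) : HasDensityOne (S ∩ T) x := by
  unfold HasDensityOne at *
  have h := ENNReal.Tendsto.sub (hS.add hT) (tendsto_const_nhds (x := (1 : ENNReal)))
    (Or.inr ENNReal.one_ne_top)
  have h1 : (1 : ENNReal) + 1 - 1 = 1 := by simp
  rw [h1] at h
  refine tendsto_of_tendsto_of_tendsto_of_le_of_le' h tendsto_const_nhds ?_ ?_
  · filter_upwards [self_mem_nhdsWithin] with r hr
    rw [tsub_le_iff_right, ← ENNReal.add_div,
      ← ENNReal.div_self (volume_ball_ne_zero' x hr) Metric.isBounded_ball.measure_lt_top.ne,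
      ← ENNReal.add_div]
    refine ENNReal.div_le_div_right ?_ _
    have h2 := measure_inter_add_sdiff (μ := volume) (T ∩ Metric.ball x r) hm
    have h3 : volume (S ∩ Metric.ball x r) + volume ((T ∩ Metric.ball x r) \ S) ≤
        volume (Metric.ball x r) := by
      have h4 := measure_inter_add_sdiff (μ := volume) (Metric.ball x r) hm
      rw [← h4, Set.inter_comm]
      gcongr
      exact Set.inter_subset_right
    rw [← h2]
    have h5 : T ∩ Metric.ball x r ∩ S = S ∩ T ∩ Metric.ball x r := by
      ext; simp only [Set.mem_inter_iff]; tauto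
    rw [h5]
    calc volume (S ∩ Metric.ball x r) + (volume (S ∩ T ∩ Metric.ball x r) +
          volume ((T ∩ Metric.ball x r) \ S)) = volume (S ∩ T ∩ Metric.ball x r) +
          (volume (S ∩ Metric.ball x r) + volume ((T ∩ Metric.ball x r) \ S)) := by ring
      _ ≤ _ := by gcongr
  · filter_upwards [self_mem_nhdsWithin] with r hr
    apply ENNReal.div_le_of_le_mul
    rw [one_mul]
    exact measure_mono Set.inter_subset_right

/-- A set of density one meets, at every small scale, any prescribed neighbourhood of any direction.
This is why first order expansions along such sets are unique. -/
theorem HasDensityOne.eventually_nonempty {S : Set (Eu n)} {x : Eu n} (hS : HasDensityOne S x)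
    (v : Eu n) {ε : ℝ} (hε : 0 < ε) :
    ∀ᶠ r in 𝓝[>] (0 : ℝ), ∃ z ∈ Metric.ball v ε, x + r • z ∈ S := by
  filter_upwards [Measure.eventually_nonempty_inter_smul_of_density_one volume S x
    (hasDensityOne_iff_closedBall.1 hS) (Metric.ball v ε) measurableSet_ball
    (volume_ball_ne_zero' v hε)] with r hr
  obtain ⟨y, hyS, hy⟩ := hr
  rw [Set.singleton_add, Set.mem_image] at hy
  obtain ⟨w, hw, rfl⟩ := hy
  obtain ⟨z, hz, rfl⟩ := hw
  exact ⟨z, hz, hyS⟩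

/-- A linear map which is `o(|y - x|)` along a set of density one at `x` vanishes. -/
theorem HasDensityOne.eq_zero_of_isLittleO {F : Type*} [NormedAddCommGroup F] [NormedSpace ℝ F]
    {S : Set (Eu n)} {x : Eu n} (hS : HasDensityOne S x) (L : Eu n →L[ℝ] F)
    (hL : (fun y => L (y - x)) =o[𝓝[S] x] fun y => y - x) : L = 0 := by
  refine ContinuousLinearMap.ext fun v => ?_
  change L v = 0
  rw [← norm_le_zero_iff]
  -- With `z` near `v` and `x + r • z ∈ S`, the little-o hypothesis gives ‖L z‖ ≤ ε‖z‖, and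
  -- replacing `z` by `v` costs ‖L‖ε. The condition ε < 1 only serves to bound ‖z‖ by ‖v‖ + 1.
  have key : ∀ ε : ℝ, 0 < ε → ε < 1 → ‖L v‖ ≤ ε * (‖L‖ + ‖v‖ + 1) := by
    intro ε hε hε1
    have h1 := hL.def hε
    rw [eventually_nhdsWithin_iff, Metric.eventually_nhds_iff] at h1
    obtain ⟨δ, hδ, h1⟩ := h1
    have h2 : ∀ᶠ r in 𝓝[>] (0 : ℝ), r * (‖v‖ + 1) < δ := by
      have : Tendsto (fun r : ℝ => r * (‖v‖ + 1)) (𝓝[>] 0) (𝓝 (0 * (‖v‖ + 1))) :=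
        (tendsto_nhdsWithin_of_tendsto_nhds tendsto_id).mul_const _
      rw [zero_mul] at this
      exact this.eventually (gt_mem_nhds hδ)
    obtain ⟨r, ⟨⟨z, hz, hzS⟩, hr2⟩, hr⟩ :=
      (((hS.eventually_nonempty v hε).and h2).and self_mem_nhdsWithin).exists
    have hr : 0 < r := hr
    have hzv : ‖z - v‖ < ε := by simpa [dist_eq_norm] using hz
    have hzn : ‖z‖ ≤ ‖v‖ + 1 := by
      have := norm_le_norm_add_norm_sub' z v
      rw [norm_sub_rev] at this
      have h3 := norm_sub_rev z v
      linarith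
    have h4 := h1 (y := x + r • z) (by
      rw [dist_eq_norm, add_sub_cancel_left, norm_smul, Real.norm_of_nonneg hr.le]
      exact lt_of_le_of_lt (by gcongr) hr2) hzS
    rw [add_sub_cancel_left, map_smul, norm_smul, norm_smul, Real.norm_of_nonneg hr.le] at h4
    have h5 : ‖L z‖ ≤ ε * ‖z‖ := by
      have : r * ‖L z‖ ≤ r * (ε * ‖z‖) := by linarith
      exact le_of_mul_le_mul_left this hr
    have h6 : ‖L v‖ ≤ ‖L z‖ + ‖L (z - v)‖ := by
      rw [map_sub]
      have := norm_sub_le (L z) (L z - L v)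
      simpa using this
    have h7 := L.le_opNorm (z - v)
    have h8 : ‖L‖ * ‖z - v‖ ≤ ‖L‖ * ε := by gcongr
    have h9 : ε * ‖z‖ ≤ ε * (‖v‖ + 1) := by gcongr
    linarith
  have hlim : Tendsto (fun ε : ℝ => ε * (‖L‖ + ‖v‖ + 1)) (𝓝[>] 0) (𝓝 (0 * (‖L‖ + ‖v‖ + 1))) :=
    (tendsto_nhdsWithin_of_tendsto_nhds tendsto_id).mul_const _
  rw [zero_mul] at hlim
  refine ge_of_tendsto hlim ?_
  filter_upwards [Ioo_mem_nhdsGT one_pos] with ε hε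
  exact key ε hε.1 hε.2

end Density

/-! ### Weak derivatives and dilated kernels. -/

section Dilation

variable {n : ℕ}

theorem sum_smul_stdVec (z : Eu n) : ∑ j, z j • stdVec j = z := by
  ext i
  simp [stdVec, Finset.sum_apply, Pi.single_apply]

theorem abs_coord_le_norm (z : Eu n) (j : Fin n) : |z j| ≤ ‖z‖ := PiLp.norm_apply_le z j

/-- The `j`-th component `t⁻ⁿ z_j η(z)`, `z = (y - x) / t`, of the field which transports the
dilated kernel `t⁻ⁿ η(z)`. -/
noncomputable def dilationField (η : Eu n → ℝ) (x : Eu n) (t : ℝ) (j : Fin n) (y : Eu n) : ℝ :=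
  (t ^ n)⁻¹ * ((t⁻¹ • (y - x)) j * η (t⁻¹ • (y - x)))

theorem contDiff_dilationField {η : Eu n → ℝ} (hη : ContDiff ℝ ∞ η) (x : Eu n) (t : ℝ)
    (j : Fin n) : ContDiff ℝ ∞ (dilationField η x t j) := by
  unfold dilationField
  have h1 : ContDiff ℝ ∞ fun y : Eu n => t⁻¹ • (y - x) := by fun_prop
  have h2 : ContDiff ℝ ∞ fun y : Eu n => (t⁻¹ • (y - x)) j :=
    (EuclideanSpace.proj (𝕜 := ℝ) j).contDiff.comp h1
  exact contDiff_const.mul (h2.mul (hη.comp h1))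

theorem norm_smul_sub_le_iff {x y : Eu n} {t ρ : ℝ} (ht : 0 < t) :
    ‖t⁻¹ • (y - x)‖ ≤ ρ ↔ y ∈ Metric.closedBall x (t * ρ) := by
  rw [norm_smul, norm_inv, Real.norm_of_nonneg ht.le, inv_mul_le_iff₀ ht, Metric.mem_closedBall,
    dist_eq_norm]

theorem tsupport_dilate_subset {η : Eu n → ℝ} {ρ : ℝ} (hsupp : ∀ z, ρ < ‖z‖ → η z = 0)
    (x : Eu n) {t : ℝ} (ht : 0 < t) {h : Eu n → ℝ}
    (hh : ∀ y, η (t⁻¹ • (y - x)) = 0 → h y = 0) :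
    tsupport h ⊆ Metric.closedBall x (t * ρ) := by
  refine closure_minimal (fun y hy => ?_) Metric.isClosed_closedBall
  by_contra hc
  rw [← norm_smul_sub_le_iff ht, not_le] at hc
  exact hy (hh y (hsupp _ hc))

theorem fderiv_dilationField {η : Eu n → ℝ} (hη : ContDiff ℝ ∞ η) (x : Eu n) (t : ℝ)
    (j : Fin n) (y : Eu n) :
    fderiv ℝ (dilationField η x t j) y (stdVec j) =
      (t ^ n)⁻¹ * (t⁻¹ * (η (t⁻¹ • (y - x)) +
        (t⁻¹ • (y - x)) j * fderiv ℝ η (t⁻¹ • (y - x)) (stdVec j))) := by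
  have h1 : HasFDerivAt (fun y : Eu n => t⁻¹ • (y - x)) (t⁻¹ • ContinuousLinearMap.id ℝ (Eu n)) y :=
    ((hasFDerivAt_id y).sub_const x).const_smul t⁻¹
  have h2 : HasFDerivAt (fun y : Eu n => (t⁻¹ • (y - x)) j)
      ((EuclideanSpace.proj (𝕜 := ℝ) j : Eu n →L[ℝ] ℝ).comp
        (t⁻¹ • ContinuousLinearMap.id ℝ (Eu n))) y :=
    (EuclideanSpace.proj (𝕜 := ℝ) j : Eu n →L[ℝ] ℝ).hasFDerivAt.comp y h1
  have h3 : HasFDerivAt (fun y : Eu n => η (t⁻¹ • (y - x)))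
      ((fderiv ℝ η (t⁻¹ • (y - x))).comp (t⁻¹ • ContinuousLinearMap.id ℝ (Eu n))) y :=
    ((hη.differentiable (by simp)) _).hasFDerivAt.comp y h1
  have h4 := (h2.mul h3).const_mul (t ^ n)⁻¹
  have h5 : fderiv ℝ (dilationField η x t j) y = _ := h4.fderiv
  rw [h5]
  simp [stdVec]
  ring

theorem sum_fderiv_dilationField {η : Eu n → ℝ} (hη : ContDiff ℝ ∞ η) (x : Eu n) (t : ℝ)
    (y : Eu n) :
    ∑ j, fderiv ℝ (dilationField η x t j) y (stdVec j) =
      (t ^ (n + 1))⁻¹ * (n * η (t⁻¹ • (y - x)) +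
        fderiv ℝ η (t⁻¹ • (y - x)) (t⁻¹ • (y - x))) := by
  simp only [fderiv_dilationField hη]
  set z := t⁻¹ • (y - x)
  have h : fderiv ℝ η z z = ∑ j, z j * fderiv ℝ η z (stdVec j) := by
    conv_lhs => rw [← sum_smul_stdVec z, map_sum]
    simp only [map_smul, smul_eq_mul]
    rw [sum_smul_stdVec]
  rw [← Finset.mul_sum, ← Finset.mul_sum, Finset.sum_add_distrib, h, pow_succ, mul_inv]
  simp
  ring

/-- With `sum_fderiv_dilationField` this is the continuity equation ∂ₜK = -div(K z) for the dilated
kernel K. It turns the t-derivative of a weighted average of `u` into an integral of the weak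
gradient. -/
theorem hasDerivAt_dilate {η : Eu n → ℝ} (hη : ContDiff ℝ ∞ η) (x y : Eu n) {t : ℝ} (ht : t ≠ 0) :
    HasDerivAt (fun t : ℝ => (t ^ n)⁻¹ * η (t⁻¹ • (y - x)))
      (-((t ^ (n + 1))⁻¹ * (n * η (t⁻¹ • (y - x)) +
        fderiv ℝ η (t⁻¹ • (y - x)) (t⁻¹ • (y - x))))) t := by
  have h1 : HasDerivAt (fun t : ℝ => t⁻¹ • (y - x)) (-(t ^ 2)⁻¹ • (y - x)) t :=
    (hasDerivAt_inv ht).smul_const (y - x)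
  have h2 : HasDerivAt (fun t : ℝ => η (t⁻¹ • (y - x)))
      (fderiv ℝ η (t⁻¹ • (y - x)) (-(t ^ 2)⁻¹ • (y - x))) t :=
    ((hη.differentiable (by simp)) _).hasFDerivAt.comp_hasDerivAt t h1
  have h3 : HasDerivAt (fun t : ℝ => (t ^ n)⁻¹) (-(n * (t ^ (n + 1))⁻¹)) t := by
    refine ((hasDerivAt_pow n t).fun_inv (pow_ne_zero n ht)).congr_deriv ?_
    rcases n with _ | n
    · simp
    · simp only [Nat.add_sub_cancel]
      field_simp
      ring
  refine (h3.mul h2).congr_deriv ?_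
  have h4 : -(t ^ 2)⁻¹ • (y - x) = -(t⁻¹) • (t⁻¹ • (y - x)) := by
    rw [smul_smul]; congr 1; field_simp
  rw [h4, map_smul, smul_eq_mul, pow_succ, mul_inv]
  ring

variable {Ω : Set (Eu n)} {u : Eu n → ℝ} {g : Fin n → Eu n → ℝ}

theorem integral_mul_dilate_deriv (hu : IntegrableOn u Ω)
    (hw : ∀ j, HasWeakPartialDeriv Ω j u (g j)) {η : Eu n → ℝ} (hη : ContDiff ℝ ∞ η) {ρ : ℝ}
    (hsupp : ∀ z, ρ < ‖z‖ → η z = 0) (x : Eu n) {t : ℝ} (ht : 0 < t)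
    (hball : Metric.closedBall x (t * ρ) ⊆ Ω) :
    ∫ y in Ω, u y * (-((t ^ (n + 1))⁻¹ * (n * η (t⁻¹ • (y - x)) +
        fderiv ℝ η (t⁻¹ • (y - x)) (t⁻¹ • (y - x))))) =
      ∑ j, ∫ y in Ω, g j y * dilationField η x t j y := by
  have hts : ∀ j, tsupport (dilationField η x t j) ⊆ Metric.closedBall x (t * ρ) := fun j =>
    tsupport_dilate_subset hsupp x ht fun y hy => by simp [dilationField, hy]
  have hcs : ∀ j, HasCompactSupport (dilationField η x t j) := fun j =>
    (isCompact_closedBall x (t * ρ)).of_isClosed_subset (isClosed_tsupport _) (hts j)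
  have h1 : ∀ j, ∫ y in Ω, g j y * dilationField η x t j y =
      ∫ y in Ω, u y * (-fderiv ℝ (dilationField η x t j) y (stdVec j)) := by
    intro j
    have := hw j (dilationField η x t j) (contDiff_dilationField hη x t j) (hcs j)
      ((hts j).trans hball)
    simp only [mul_neg, integral_neg]
    linarith
  simp only [h1]
  rw [← integral_finsetSum]
  · congr 1
    funext y
    rw [← Finset.mul_sum, Finset.sum_neg_distrib, sum_fderiv_dilationField hη]
  · intro j _
    have hc : Continuous fun y => fderiv ℝ (dilationField η x t j) y (stdVec j) :=
      ((contDiff_dilationField hη x t j).continuous_fderiv (by simp)).clm_apply continuous_const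
    obtain ⟨C, hC⟩ := hc.bounded_above_of_compact_support
      ((hcs j).fderiv (𝕜 := ℝ) |>.comp_left (g := fun L : Eu n →L[ℝ] ℝ => L (stdVec j)) rfl)
    exact hu.mul_bdd (c := C) (hc.neg.aestronglyMeasurable)
      (Eventually.of_forall fun y => by simpa using hC y)

end Dilation

/-! ### Lebesgue points. -/

section LebesguePoints

variable {n : ℕ}

/-- `x` is a Lebesgue point of `u`. -/
def IsLebesguePoint (u : Eu n → ℝ) (x : Eu n) : Prop :=
  Tendsto (fun r : ℝ => (∫ y in Metric.closedBall x r, ‖u y - u x‖) / r ^ n) (𝓝[>] 0) (𝓝 0)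

theorem ae_isLebesguePoint_of_locallyIntegrable {u : Eu n → ℝ} (hu : LocallyIntegrable u) :
    ∀ᵐ x, IsLebesguePoint u x := by
  filter_upwards [(Besicovitch.vitaliFamily (volume : Measure (Eu n))).ae_tendsto_average_norm_sub
    hu] with x hx
  have h1 := hx.comp (Besicovitch.tendsto_filterAt volume x)
  have h2 := h1.const_mul ((volume : Measure (Eu n)).real (Metric.ball 0 1))
  rw [mul_zero] at h2
  refine h2.congr' ?_
  filter_upwards [self_mem_nhdsWithin] with r hr
  have hr : 0 < r := hr
  have hv : 0 < (volume : Measure (Eu n)).real (Metric.ball 0 1) :=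
    ENNReal.toReal_pos (volume_ball_ne_zero' _ one_pos) Metric.isBounded_ball.measure_lt_top.ne
  rw [Function.comp_apply, setAverage_eq, Measure.addHaar_real_closedBall _ _ hr.le,
    finrank_euclideanSpace_fin, smul_eq_mul]
  field_simp

theorem closedBall_subset_eventually {Ω : Set (Eu n)} (hΩ : IsOpen Ω) {x : Eu n} (hx : x ∈ Ω)
    (c : ℝ) : ∀ᶠ r in 𝓝[>] (0 : ℝ), Metric.closedBall x (r * c) ⊆ Ω := by
  obtain ⟨ε, hε, h⟩ := Metric.isOpen_iff.1 hΩ x hx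
  have h1 : Tendsto (fun r : ℝ => r * c) (𝓝[>] 0) (𝓝 (0 * c)) :=
    (tendsto_nhdsWithin_of_tendsto_nhds tendsto_id).mul_const _
  rw [zero_mul] at h1
  filter_upwards [h1.eventually (gt_mem_nhds hε)] with r hr
  exact (Metric.closedBall_subset_ball hr).trans h

theorem ae_isLebesguePoint {Ω : Set (Eu n)} (hΩ : IsOpen Ω) {u : Eu n → ℝ}
    (hu : IntegrableOn u Ω) : ∀ᵐ x ∂(volume.restrict Ω), IsLebesguePoint u x := by
  have h := ae_isLebesguePoint_of_locallyIntegrable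
    ((integrable_indicator_iff hΩ.measurableSet).2 hu).locallyIntegrable
  rw [ae_restrict_iff' hΩ.measurableSet]
  filter_upwards [h] with x hx hxΩ
  refine hx.congr' ?_
  filter_upwards [closedBall_subset_eventually hΩ hxΩ 1] with r hr
  rw [mul_one] at hr
  congr 1
  refine setIntegral_congr_fun Metric.isClosed_closedBall.measurableSet fun y hy => ?_
  simp only [Set.indicator_of_mem (hr hy), Set.indicator_of_mem hxΩ]

/-- Near a Lebesgue point of an integrable `Φ` the integrals over balls are `O(rⁿ)`. -/
theorem IsLebesguePoint.exists_integral_ball_le {Ω : Set (Eu n)} (hΩ : IsOpen Ω) {Φ : Eu n → ℝ}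
    (hΦ : IntegrableOn Φ Ω) {x : Eu n} (hx : x ∈ Ω) (h : IsLebesguePoint Φ x) :
    ∃ c : ℝ, ∀ᶠ r in 𝓝[>] (0 : ℝ), ∫ y in Metric.ball x r, Φ y ≤ c * r ^ n := by
  set V := (volume : Measure (Eu n)).real (Metric.ball 0 1)
  refine ⟨1 + |Φ x| * V, ?_⟩
  filter_upwards [self_mem_nhdsWithin, h.eventually (gt_mem_nhds one_pos),
    closedBall_subset_eventually hΩ hx 1] with r hr h1 hsub
  have hr : 0 < r := hr
  rw [mul_one] at hsub
  rw [div_lt_one (pow_pos hr n)] at h1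
  have hi : IntegrableOn Φ (Metric.closedBall x r) := hΦ.mono_set hsub
  have hfin : volume (Metric.closedBall x r) ≠ ⊤ := Metric.isBounded_closedBall.measure_lt_top.ne
  have hi2 : IntegrableOn (fun y => ‖Φ y - Φ x‖) (Metric.closedBall x r) :=
    (hi.sub (integrableOn_const hfin)).norm
  have hi3 : IntegrableOn (fun _ => |Φ x|) (Metric.closedBall x r) := integrableOn_const hfin
  calc ∫ y in Metric.ball x r, Φ y ≤ ∫ y in Metric.ball x r, (‖Φ y - Φ x‖ + |Φ x|) := by
        refine setIntegral_mono (hi.mono_set Metric.ball_subset_closedBall)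
          ((hi2.add hi3).mono_set Metric.ball_subset_closedBall) fun y => ?_
        have := abs_sub_abs_le_abs_sub (Φ y) (Φ x)
        have := le_abs_self (Φ y)
        change Φ y ≤ |Φ y - Φ x| + |Φ x|
        linarith
    _ ≤ ∫ y in Metric.closedBall x r, (‖Φ y - Φ x‖ + |Φ x|) := by
        refine setIntegral_mono_set (hi2.add hi3) (Eventually.of_forall fun y => ?_)
          Metric.ball_subset_closedBall.eventuallyLE
        change 0 ≤ ‖Φ y - Φ x‖ + |Φ x|
        positivity
    _ = (∫ y in Metric.closedBall x r, ‖Φ y - Φ x‖) + r ^ n * V * |Φ x| := by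
        rw [integral_add hi2 hi3, setIntegral_const, Measure.addHaar_real_closedBall _ _ hr.le,
          finrank_euclideanSpace_fin, smul_eq_mul]
    _ ≤ (1 + |Φ x| * V) * r ^ n := by nlinarith

end LebesguePoints

/-! ### Comparing averages of a Sobolev function with its value at a Lebesgue point. -/

section Estimate

variable {n : ℕ} {Ω : Set (Eu n)} {u : Eu n → ℝ} {g : Fin n → Eu n → ℝ}

theorem integrableOn_mul_of_bounded {u h : Eu n → ℝ} (hu : IntegrableOn u Ω) (hh : Continuous h)
    {C : ℝ} (hC : ∀ y, |h y| ≤ C) : IntegrableOn (fun y => u y * h y) Ω :=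
  hu.mul_bdd (c := C) hh.aestronglyMeasurable (Eventually.of_forall hC)

theorem hasDerivAt_integral_dilate (hu : IntegrableOn u Ω)
    (hw : ∀ j, HasWeakPartialDeriv Ω j u (g j)) {η : Eu n → ℝ} (hη : ContDiff ℝ ∞ η) {ρ : ℝ}
    (hsupp : ∀ z, ρ < ‖z‖ → η z = 0) (x : Eu n) {t : ℝ} (ht : 0 < t)
    (hball : Metric.closedBall x (t * ρ) ⊆ Ω) :
    HasDerivAt (fun t : ℝ => ∫ y in Ω, u y * ((t ^ n)⁻¹ * η (t⁻¹ • (y - x))))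
      (∑ j, ∫ y in Ω, g j y * dilationField η x t j y) t := by
  rw [← integral_mul_dilate_deriv hu hw hη hsupp x ht hball]
  have hcs : HasCompactSupport η := HasCompactSupport.of_support_subset_isCompact
    (isCompact_closedBall (0 : Eu n) ρ) fun z hz => by
      by_contra hc
      exact hz (hsupp z (by simpa using hc))
  set H : Eu n → ℝ := fun z => n * η z + fderiv ℝ η z z with hH
  have hHc : Continuous H := by
    have := hη.continuous_fderiv (n := ∞) (by simp)
    have := hη.continuous
    fun_prop
  obtain ⟨C₁, hC₁⟩ := hη.continuous.bounded_above_of_compact_support hcs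
  have hHs : HasCompactSupport H := HasCompactSupport.of_support_subset_isCompact
    hcs fun z hz => by
      by_contra hc
      apply hz
      have h1 : η z = 0 := image_eq_zero_of_notMem_tsupport hc
      have h2 : fderiv ℝ η z = 0 := by
        by_contra h3
        exact hc (support_fderiv_subset ℝ h3)
      simp [hH, h1, h2]
  obtain ⟨C₂, hC₂⟩ := hHc.bounded_above_of_compact_support hHs
  have hC₂0 : 0 ≤ C₂ := (norm_nonneg _).trans (hC₂ 0)
  have hbd : ∀ᵐ y ∂(volume.restrict Ω), ∀ s ∈ Metric.ball t (t / 2),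
      ‖u y * (-((s ^ (n + 1))⁻¹ * H (s⁻¹ • (y - x))))‖ ≤ ‖u y‖ * (((t / 2) ^ (n + 1))⁻¹ * C₂) := by
    refine Eventually.of_forall fun y s hs => ?_
    rw [Metric.mem_ball, Real.dist_eq, abs_lt] at hs
    have hs0 : t / 2 < s := by linarith [hs.1]
    have hs1 : 0 < s := by linarith
    rw [norm_mul, norm_neg, norm_mul, norm_inv, norm_pow, Real.norm_of_nonneg hs1.le]
    gcongr
    exact hC₂ _
  refine (hasDerivAt_integral_of_dominated_loc_of_deriv_le (Metric.ball_mem_nhds t (half_pos ht))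
    (F' := fun s y => u y * (-((s ^ (n + 1))⁻¹ * H (s⁻¹ • (y - x)))))
    (bound := fun y => ‖u y‖ * (((t / 2) ^ (n + 1))⁻¹ * C₂)) ?_ ?_ ?_ hbd ?_ ?_).2
  · refine Eventually.of_forall fun s => hu.aestronglyMeasurable.mul ?_
    have := hη.continuous
    exact Continuous.aestronglyMeasurable (by fun_prop)
  · refine integrableOn_mul_of_bounded hu (C := (t ^ n)⁻¹ * C₁) ?_ fun y => ?_
    · have := hη.continuous
      fun_prop
    · rw [abs_mul, abs_of_pos (inv_pos.2 (pow_pos ht n))]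
      gcongr
      exact hC₁ _
  · refine hu.aestronglyMeasurable.mul ?_
    exact Continuous.aestronglyMeasurable (by fun_prop)
  · exact hu.norm.mul_const _
  · refine Eventually.of_forall fun y s hs => ?_
    rw [Metric.mem_ball, Real.dist_eq, abs_lt] at hs
    have hs1 : s ≠ 0 := by linarith [hs.1]
    exact (hasDerivAt_dilate hη x y hs1).const_mul (u y)

/-- The bound is uniform in `t`: the kernel has size t⁻ⁿ and lives on a ball of radius O(t), over
which Φ has integral O(tⁿ). The radius 2ρt instead of ρt makes room for an open ball. -/
theorem abs_sum_integral_dilationField_le {Φ : Eu n → ℝ}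
    (hg : ∀ j, IntegrableOn (g j) Ω) (hΦ : IntegrableOn Φ Ω)
    (hgΦ : ∀ᵐ y ∂(volume.restrict Ω), ∑ j, |g j y| ≤ Φ y)
    {η : Eu n → ℝ} (hη : ContDiff ℝ ∞ η) {ρ C k : ℝ} (hρ : 0 < ρ)
    (hsupp : ∀ z, ρ < ‖z‖ → η z = 0) (hC : ∀ z, |η z| ≤ C) {x : Eu n}
    (hball : Metric.ball x (2 * ρ) ⊆ Ω)
    (hk : ∀ r, 0 < r → r ≤ 2 * ρ → ∫ y in Metric.ball x r, Φ y ≤ k * r ^ n)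
    {t : ℝ} (ht : 0 < t) (ht1 : t ≤ 1) :
    |∑ j, ∫ y in Ω, g j y * dilationField η x t j y| ≤ C * ρ * k * (2 * ρ) ^ n := by
  have hC0 : 0 ≤ C := (abs_nonneg _).trans (hC 0)
  have hz : ∀ y j, |dilationField η x t j y| ≤
      (Metric.ball x (t * (2 * ρ))).indicator (fun _ => (t ^ n)⁻¹ * (ρ * C)) y := by
    intro y j
    by_cases hy : ρ < ‖t⁻¹ • (y - x)‖
    · simp only [dilationField, hsupp _ hy, mul_zero, abs_zero]
      exact Set.indicator_nonneg (fun _ _ => by positivity) _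
    · rw [not_lt] at hy
      rw [Set.indicator_of_mem]
      · rw [dilationField, abs_mul, abs_mul, abs_of_pos (inv_pos.2 (pow_pos ht n))]
        gcongr
        · exact (abs_coord_le_norm _ j).trans hy
        · exact hC _
      · rw [norm_smul_sub_le_iff ht] at hy
        exact Metric.closedBall_subset_ball (by nlinarith) hy
  have hcont : ∀ j, Continuous (dilationField η x t j) := fun j =>
    (contDiff_dilationField hη x t j).continuous
  have hint : ∀ j, IntegrableOn (fun y => g j y * dilationField η x t j y) Ω := fun j =>
    integrableOn_mul_of_bounded (hg j) (hcont j) (C := (t ^ n)⁻¹ * (ρ * C)) fun y =>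
      (hz y j).trans (Set.indicator_le_self' (fun _ _ => by positivity) y)
  rw [← integral_finsetSum _ fun j _ => hint j]
  have hsub : Metric.ball x (t * (2 * ρ)) ⊆ Ω :=
    (Metric.ball_subset_ball (by nlinarith)).trans hball
  calc |∫ y in Ω, ∑ j, g j y * dilationField η x t j y|
      ≤ ∫ y in Ω, (Metric.ball x (t * (2 * ρ))).indicator
          (fun y => Φ y * ((t ^ n)⁻¹ * (ρ * C))) y := by
        rw [← Real.norm_eq_abs]
        refine norm_integral_le_of_norm_le
          ((hΦ.mul_const _).indicator measurableSet_ball) ?_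
        filter_upwards [hgΦ] with y hy
        calc ‖∑ j, g j y * dilationField η x t j y‖
            ≤ ∑ j, |g j y| * (Metric.ball x (t * (2 * ρ))).indicator
              (fun _ => (t ^ n)⁻¹ * (ρ * C)) y := by
              refine (norm_sum_le _ _).trans (Finset.sum_le_sum fun j _ => ?_)
              rw [Real.norm_eq_abs, abs_mul]
              gcongr
              exact hz y j
          _ ≤ _ := by
              rw [← Finset.sum_mul]
              by_cases h : y ∈ Metric.ball x (t * (2 * ρ))
              · simp only [Set.indicator_of_mem h]
                gcongr
              · simp [Set.indicator_of_notMem h]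
    _ = (∫ y in Metric.ball x (t * (2 * ρ)), Φ y) * ((t ^ n)⁻¹ * (ρ * C)) := by
        rw [setIntegral_indicator measurableSet_ball, Set.inter_eq_self_of_subset_right hsub,
          integral_mul_const]
    _ ≤ (k * (t * (2 * ρ)) ^ n) * ((t ^ n)⁻¹ * (ρ * C)) := by
        gcongr
        exact hk _ (by positivity) (by nlinarith)
    _ = C * ρ * k * (2 * ρ) ^ n := by
        rw [mul_pow]
        field_simp

theorem tendsto_integral_dilate (hΩ : IsOpen Ω) (hu : IntegrableOn u Ω)
    {η : Eu n → ℝ} (hη : ContDiff ℝ ∞ η) {ρ C : ℝ} (hρ : 0 < ρ)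
    (hsupp : ∀ z, ρ < ‖z‖ → η z = 0) (hC : ∀ z, |η z| ≤ C) {x : Eu n} (hx : x ∈ Ω)
    (hleb : IsLebesguePoint u x) :
    Tendsto (fun t : ℝ => ∫ y in Ω, u y * ((t ^ n)⁻¹ * η (t⁻¹ • (y - x)))) (𝓝[>] 0)
      (𝓝 (u x * ∫ z, η z)) := by
  have hC0 : 0 ≤ C := (abs_nonneg _).trans (hC 0)
  rw [tendsto_iff_norm_sub_tendsto_zero]
  have h1 : Tendsto (fun t : ℝ => t * ρ) (𝓝[>] 0) (𝓝[>] 0) := by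
    refine tendsto_nhdsWithin_iff.2 ⟨?_, ?_⟩
    · have : Tendsto (fun t : ℝ => t * ρ) (𝓝[>] 0) (𝓝 (0 * ρ)) :=
        (tendsto_nhdsWithin_of_tendsto_nhds tendsto_id).mul_const _
      rwa [zero_mul] at this
    · filter_upwards [self_mem_nhdsWithin] with t ht
      exact mul_pos ht hρ
  have h2 := (hleb.comp h1).mul_const (ρ ^ n * C)
  rw [zero_mul] at h2
  refine squeeze_zero' (Eventually.of_forall fun t => norm_nonneg _) ?_ h2
  filter_upwards [self_mem_nhdsWithin, closedBall_subset_eventually hΩ hx ρ] with t ht hsub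
  have ht : 0 < t := ht
  set K : Eu n → ℝ := fun y => (t ^ n)⁻¹ * η (t⁻¹ • (y - x)) with hK
  have hKc : Continuous K := by
    have := hη.continuous
    fun_prop
  have hKC : ∀ y, |K y| ≤ (t ^ n)⁻¹ * C := fun y => by
    rw [hK, abs_mul, abs_of_pos (inv_pos.2 (pow_pos ht n))]
    gcongr
    exact hC _
  have hK0 : ∀ y, y ∉ Metric.closedBall x (t * ρ) → K y = 0 := fun y hy => by
    rw [← norm_smul_sub_le_iff ht, not_le] at hy
    simp [hK, hsupp _ hy]
  have hKint : ∫ z, η z = ∫ y in Metric.closedBall x (t * ρ), K y := by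
    rw [setIntegral_eq_integral_of_forall_compl_eq_zero fun y hy => hK0 y hy, hK,
      integral_const_mul, integral_sub_right_eq_self (fun y => η (t⁻¹ • y)) x,
      Measure.integral_comp_inv_smul_of_nonneg _ _ ht.le, finrank_euclideanSpace_fin, smul_eq_mul,
      inv_mul_cancel_left₀ (pow_pos ht n).ne']
  have hu' : IntegrableOn u (Metric.closedBall x (t * ρ)) := hu.mono_set hsub
  have hfin : volume (Metric.closedBall x (t * ρ)) ≠ ⊤ :=
    Metric.isBounded_closedBall.measure_lt_top.ne
  have hconst : IntegrableOn (fun _ => u x) (Metric.closedBall x (t * ρ)) := integrableOn_const hfin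
  have h3 : ∫ y in Ω, u y * K y = ∫ y in Metric.closedBall x (t * ρ), u y * K y := by
    refine setIntegral_eq_of_subset_of_forall_sdiff_eq_zero hΩ.measurableSet hsub fun y hy => ?_
    rw [hK0 y hy.2, mul_zero]
  rw [h3, hKint, ← integral_const_mul, ← integral_sub (integrableOn_mul_of_bounded hu' hKc hKC)
    (integrableOn_mul_of_bounded hconst hKc hKC)]
  calc ‖∫ y in Metric.closedBall x (t * ρ), (u y * K y - u x * K y)‖
      ≤ ∫ y in Metric.closedBall x (t * ρ), ‖u y - u x‖ * ((t ^ n)⁻¹ * C) := by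
        refine norm_integral_le_of_norm_le ((hu'.sub hconst).norm.mul_const _)
          (Eventually.of_forall fun y => ?_)
        rw [← sub_mul, norm_mul]
        gcongr
        exact hKC y
    _ = _ := by
        rw [integral_mul_const, Function.comp_apply, mul_pow]
        field_simp

/-- A mean value estimate for Sobolev functions at Lebesgue points. -/
theorem abs_integral_sub_le {Φ : Eu n → ℝ} (hΩ : IsOpen Ω) (hu : IntegrableOn u Ω)
    (hg : ∀ j, IntegrableOn (g j) Ω) (hw : ∀ j, HasWeakPartialDeriv Ω j u (g j))
    (hΦ : IntegrableOn Φ Ω) (hgΦ : ∀ᵐ y ∂(volume.restrict Ω), ∑ j, |g j y| ≤ Φ y)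
    {η : Eu n → ℝ} (hη : ContDiff ℝ ∞ η) {ρ C k : ℝ} (hρ : 0 < ρ)
    (hsupp : ∀ z, ρ < ‖z‖ → η z = 0) (hC : ∀ z, |η z| ≤ C) {x : Eu n}
    (hball : Metric.ball x (2 * ρ) ⊆ Ω)
    (hk : ∀ r, 0 < r → r ≤ 2 * ρ → ∫ y in Metric.ball x r, Φ y ≤ k * r ^ n)
    (hleb : IsLebesguePoint u x) :
    |(∫ y in Ω, u y * η (y - x)) - u x * ∫ z, η z| ≤ C * ρ * k * (2 * ρ) ^ n := by
  have hx : x ∈ Ω := hball (Metric.mem_ball_self (by positivity))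
  set F : ℝ → ℝ := fun t => ∫ y in Ω, u y * ((t ^ n)⁻¹ * η (t⁻¹ • (y - x))) with hF
  have hF1 : F 1 = ∫ y in Ω, u y * η (y - x) := by simp [hF]
  have hlim := tendsto_integral_dilate hΩ hu hη hρ hsupp hC hx hleb
  rw [← hF1]
  have h1 : Tendsto (fun t => |F 1 - F t|) (𝓝[>] 0) (𝓝 |F 1 - u x * ∫ z, η z|) :=
    (tendsto_const_nhds.sub hlim).abs
  refine le_of_tendsto h1 ?_
  filter_upwards [Ioc_mem_nhdsGT one_pos] with t ht
  -- `F` has bounded derivative on (0, 1], equals the average at 1 and tends to `u x * ∫ η` at 0, so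
  -- the mean value inequality on [t, 1] gives the claim as t → 0.
  have h2 := (convex_Ioc (0 : ℝ) 1).norm_image_sub_le_of_norm_hasDerivWithin_le
    (f := F) (C := C * ρ * k * (2 * ρ) ^ n) (fun s hs =>
      (hasDerivAt_integral_dilate hu hw hη hsupp x hs.1
        ((Metric.closedBall_subset_ball (by nlinarith [hs.1, hs.2])).trans hball)).hasDerivWithinAt)
    (fun s hs => abs_sum_integral_dilationField_le hg hΦ hgΦ hη hρ hsupp hC hball hk hs.1 hs.2)
    ht ⟨one_pos, le_refl _⟩
  refine h2.trans ?_
  have h3 : 0 ≤ C * ρ * k * (2 * ρ) ^ n := (abs_nonneg _).trans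
    (abs_sum_integral_dilationField_le hg hΦ hgΦ hη hρ hsupp hC hball hk one_pos le_rfl)
  refine mul_le_of_le_one_right h3 ?_
  rw [Real.norm_eq_abs, abs_le]
  constructor <;> linarith [ht.1, ht.2]

end Estimate

/-! ### Sublevel sets of the maximal function. -/

section GoodSets

variable {n : ℕ} {Ω : Set (Eu n)}

/-- The points at distance at least `1 / (k + 1)` from `Ωᶜ` at which the maximal function of `Φ` over
radii less than `1 / (k + 1)` is at most `k`. -/
def maximalSublevel (Ω : Set (Eu n)) (Φ : Eu n → ℝ) (k : ℕ) : Set (Eu n) :=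
  {x | Metric.ball x (1 / (k + 1 : ℝ)) ⊆ Ω ∧
    ∀ r : ℝ, 0 < r → r < 1 / (k + 1 : ℝ) → ∫ y in Metric.ball x r, Φ y ≤ k * r ^ n}

theorem maximalSublevel_subset (Φ : Eu n → ℝ) (k : ℕ) : maximalSublevel Ω Φ k ⊆ Ω := fun _ hx =>
  hx.1 (Metric.mem_ball_self (by positivity))

theorem isClosed_maximalSublevel {Φ : Eu n → ℝ} (hΦ : IntegrableOn Φ Ω)
    (hΦ0 : ∀ x, 0 ≤ Φ x) (k : ℕ) : IsClosed (maximalSublevel Ω Φ k) := by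
  refine isClosed_of_closure_subset fun x hx => ?_
  rw [Metric.mem_closure_iff] at hx
  refine ⟨fun y hy => ?_, fun r hr hrk => ?_⟩
  · rw [Metric.mem_ball] at hy
    obtain ⟨x', hx', hd⟩ := hx (1 / (k + 1 : ℝ) - dist y x) (by linarith)
    refine hx'.1 ?_
    rw [Metric.mem_ball]
    linarith [dist_triangle y x x']
  · have hlim : Tendsto (fun ε : ℝ => k * (r + ε) ^ n) (𝓝[>] 0) (𝓝 (k * (r + 0) ^ n)) := by
      refine tendsto_nhdsWithin_of_tendsto_nhds (Continuous.tendsto (by fun_prop) 0)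
    rw [add_zero] at hlim
    refine ge_of_tendsto hlim ?_
    filter_upwards [Ioo_mem_nhdsGT (show 0 < 1 / (k + 1 : ℝ) - r by linarith)] with ε hε
    obtain ⟨x', hx', hd⟩ := hx ε hε.1
    have hsub : Metric.ball x' (r + ε) ⊆ Ω :=
      (Metric.ball_subset_ball (by linarith [hε.2])).trans hx'.1
    refine le_trans ?_ (hx'.2 (r + ε) (by linarith [hε.1]) (by linarith [hε.2]))
    refine setIntegral_mono_set (hΦ.mono_set hsub) (Eventually.of_forall fun y => hΦ0 y) ?_
    refine (Metric.ball_subset_ball' ?_).eventuallyLE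
    linarith

theorem ae_exists_mem_maximalSublevel (hΩ : IsOpen Ω) {Φ : Eu n → ℝ} (hΦ : IntegrableOn Φ Ω) :
    ∀ᵐ x ∂(volume.restrict Ω), ∃ k, x ∈ maximalSublevel Ω Φ k := by
  filter_upwards [ae_isLebesguePoint hΩ hΦ, ae_restrict_mem hΩ.measurableSet] with x hx hxΩ
  obtain ⟨c, hc⟩ := hx.exists_integral_ball_le hΩ hΦ hxΩ
  obtain ⟨ε, hε, hsub⟩ := Metric.isOpen_iff.1 hΩ x hxΩ
  obtain ⟨δ, hδ, hc⟩ := (mem_nhdsGT_iff_exists_Ioo_subset).1 hc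
  have hδ : 0 < δ := hδ
  -- One large `k` serves three purposes: it dominates the growth constant, and 1/(k + 1) is below
  -- both the distance to the boundary and the range of admissible radii.
  obtain ⟨k, hk⟩ := exists_nat_gt (max c (max ε⁻¹ δ⁻¹))
  simp only [max_lt_iff] at hk
  refine ⟨k, (Metric.ball_subset_ball ?_).trans hsub, fun r hr hrk => ?_⟩
  · rw [one_div]
    exact inv_le_of_inv_le₀ hε (by linarith)
  · refine (hc ⟨hr, hrk.trans_le ?_⟩).trans ?_
    · rw [one_div]
      exact inv_le_of_inv_le₀ hδ (by linarith)
    · have := hk.1.le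
      gcongr

/-- Sobolev functions are Lipschitz on the sublevel sets of the maximal function of the gradient. -/
theorem exists_const_abs_sub_le (n : ℕ) : ∃ C : ℝ, 0 ≤ C ∧ ∀ (Ω : Set (Eu n)) (u : Eu n → ℝ)
    (g : Fin n → Eu n → ℝ) (Φ : Eu n → ℝ) (k : ℕ), IsOpen Ω → IntegrableOn u Ω →
    (∀ j, IntegrableOn (g j) Ω) → (∀ j, HasWeakPartialDeriv Ω j u (g j)) → IntegrableOn Φ Ω →
    (∀ᵐ y ∂(volume.restrict Ω), ∑ j, |g j y| ≤ Φ y) →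
    ∀ x ∈ maximalSublevel Ω Φ k, ∀ x' ∈ maximalSublevel Ω Φ k, IsLebesguePoint u x →
    IsLebesguePoint u x' → ‖x - x'‖ < 1 / (k + 1 : ℝ) / 4 → |u x - u x'| ≤ C * k * ‖x - x'‖ := by
  let κ : ContDiffBump (0 : Eu n) := ⟨1 / 2, 1, by norm_num, by norm_num⟩
  have hc : 0 < ∫ z, κ z := κ.integral_pos
  refine ⟨(2 ^ n + 2 * 4 ^ n) / ∫ z, κ z, by positivity, ?_⟩
  intro Ω u g Φ k hΩ hu hg hw hΦ hgΦ x hx x' hx' hlx hlx' hd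
  rcases eq_or_ne x x' with rfl | hne
  · simp
  set d := ‖x - x'‖ with hd_def
  have hd0 : 0 < d := norm_pos_iff.2 (sub_ne_zero.2 hne)
  have hsm : ContDiff ℝ ∞ κ := κ.contDiff
  have hb : ∀ z, |κ z| ≤ 1 := fun z => by rw [abs_of_nonneg κ.nonneg]; exact κ.le_one
  have hs : ∀ z, 1 < ‖z‖ → κ z = 0 := fun z hz => by
    refine κ.zero_of_le_dist ?_
    rw [dist_zero_right]
    exact hz.le
  have h1 := abs_integral_sub_le hΩ hu hg hw hΦ hgΦ (η := fun z => κ (d⁻¹ • z)) (ρ := d) (C := 1)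
    (k := k) (hsm.comp (by fun_prop)) hd0
    (fun z hz => hs _ (by
      rw [norm_smul, norm_inv, Real.norm_of_nonneg hd0.le, ← div_eq_inv_mul]
      exact (one_lt_div hd0).2 hz)) (fun z => hb _)
    ((Metric.ball_subset_ball (by linarith)).trans hx.1)
    (fun r hr hr2 => hx.2 r hr (by linarith)) hlx
  -- The same average of `u`, now seen from `x'`: the bump around `x` has radius `d`, hence lies
  -- within 2d of `x'`. The radii d and 2d produce the two terms 2ⁿ and 2·4ⁿ of the constant.
  have h2 := abs_integral_sub_le hΩ hu hg hw hΦ hgΦ (η := fun z => κ (d⁻¹ • (z + (x' - x))))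
    (ρ := 2 * d) (C := 1) (k := k) (hsm.comp (by fun_prop)) (by positivity)
    (fun z hz => hs _ (by
      rw [norm_smul, norm_inv, Real.norm_of_nonneg hd0.le, ← div_eq_inv_mul]
      refine (one_lt_div hd0).2 ?_
      have h3 := norm_sub_le (z + (x' - x)) (x' - x)
      rw [add_sub_cancel_right, norm_sub_rev x' x] at h3
      linarith)) (fun z => hb _)
    ((Metric.ball_subset_ball (by linarith)).trans hx'.1)
    (fun r hr hr2 => hx'.2 r hr (by linarith)) hlx'
  have h3 : ∫ z, κ (d⁻¹ • (z + (x' - x))) = ∫ z, κ (d⁻¹ • z) :=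
    integral_add_right_eq_self (fun z => κ (d⁻¹ • z)) (x' - x)
  have h4 : ∫ z, κ (d⁻¹ • z) = d ^ n * ∫ z, κ z := by
    rw [Measure.integral_comp_inv_smul_of_nonneg _ _ hd0.le, finrank_euclideanSpace_fin,
      smul_eq_mul]
  simp only [sub_add_sub_cancel] at h2
  rw [h3, h4] at h2
  rw [h4] at h1
  set A := ∫ y in Ω, u y * κ (d⁻¹ • (y - x))
  set c := ∫ z, κ z
  have h5 : |(u x - u x') * (d ^ n * c)| ≤
      1 * d * k * (2 * d) ^ n + 1 * (2 * d) * k * (2 * (2 * d)) ^ n := by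
    have h6 : (u x - u x') * (d ^ n * c) = (A - u x' * (d ^ n * c)) - (A - u x * (d ^ n * c)) := by
      ring
    rw [h6]
    refine (abs_sub _ _).trans ?_
    linarith
  rw [abs_mul, abs_of_pos (mul_pos (pow_pos hd0 n) hc)] at h5
  have h7 : 1 * d * k * (2 * d) ^ n + 1 * (2 * d) * k * (2 * (2 * d)) ^ n =
      ((2 ^ n + 2 * 4 ^ n) / c * k * d) * (d ^ n * c) := by
    have : (2 * (2 * d)) ^ n = 4 ^ n * d ^ n := by rw [← mul_pow]; ring_nf
    rw [this, mul_pow]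
    field_simp
  rw [h7] at h5
  exact le_of_mul_le_mul_right h5 (mul_pos (pow_pos hd0 n) hc)

end GoodSets

/-! ### Decomposition of the domain into sets where f is Lipschitz. -/

section LipschitzPieces

variable {n Q m : ℕ} {Ω : Set (Eu n)} {f : Eu n → AQ Q m}

/-- A set on which the tuple-valued map `f` is Lipschitz at a small scale. -/
def IsLocallyLipschitzOn (f : Eu n → AQ Q m) (E : Set (Eu n)) : Prop :=
  ∃ L δ : ℝ, 0 ≤ L ∧ 0 < δ ∧ ∀ x ∈ E, ∀ y ∈ E, ‖x - y‖ < δ → dG (f x) (f y) ≤ L * ‖x - y‖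

theorem MemW12.exists_lipschitz_pieces (hf : MemW12 Ω f) (hΩ : IsOpen Ω) (hfin : volume Ω < ⊤) :
    ∃ E : ℕ → Set (Eu n), (∀ k, MeasurableSet (E k)) ∧ (∀ k, E k ⊆ Ω) ∧
      (∀ᵐ x ∂(volume.restrict Ω), ∃ k, x ∈ E k) ∧ ∀ k, IsLocallyLipschitzOn f (E k) := by
  obtain ⟨φ, hφ, hT⟩ := hf
  have : IsFiniteMeasure (volume.restrict Ω) := ⟨by simpa using hfin⟩
  obtain ⟨C, hC, hlip⟩ := exists_const_abs_sub_le n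
  set Φ : Eu n → ℝ := fun x => ∑ j, φ j x with hΦ_def
  have hΦ : IntegrableOn Φ Ω := integrable_finsetSum _ fun j _ =>
    (hφ j).1.integrable one_le_two
  have hleb : ∀ᵐ x ∂(volume.restrict Ω), ∀ k,
      IsLebesguePoint (fun x => dG (f x) (denseTuple Q m k)) x :=
    ae_all_iff.2 fun k => ae_isLebesguePoint hΩ ((hT _).1.integrable one_le_two)
  rw [ae_restrict_iff' hΩ.measurableSet] at hleb
  -- The exceptional set is enlarged to a measurable null set so that the pieces stay measurable.
  set N : Set (Eu n) := toMeasurable volume {x | ¬(x ∈ Ω → ∀ k,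
      IsLebesguePoint (fun x => dG (f x) (denseTuple Q m k)) x)} with hN
  have hN0 : volume N = 0 := by rw [hN, measure_toMeasurable]; exact hleb
  refine ⟨fun k => maximalSublevel Ω Φ k \ N, fun k =>
    (isClosed_maximalSublevel hΦ (fun x => Finset.sum_nonneg fun j _ => (hφ j).2 x)
      k).measurableSet.diff (measurableSet_toMeasurable _ _), fun k =>
    Set.sdiff_subset.trans (maximalSublevel_subset Φ k), ?_, fun k => ?_⟩
  · have hN' : ∀ᵐ x ∂(volume.restrict Ω), x ∉ N := ae_restrict_of_ae (measure_eq_zero_iff_ae_notMem.1 hN0)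
    filter_upwards [ae_exists_mem_maximalSublevel hΩ hΦ, hN'] with x ⟨k, hk⟩ hx
    exact ⟨k, hk, hx⟩
  · refine ⟨C * k, 1 / (k + 1 : ℝ) / 4, by positivity, by positivity, fun x hx y hy hxy => ?_⟩
    refine dG_le_of_forall_denseTuple fun l => ?_
    obtain ⟨hm, g, hg⟩ := hT (denseTuple Q m l)
    have hmem : ∀ z ∈ maximalSublevel Ω Φ k \ N,
        IsLebesguePoint (fun x => dG (f x) (denseTuple Q m l)) z := by
      intro z hz
      by_contra hcon
      refine hz.2 (subset_toMeasurable _ _ fun h => hcon (h ?_ l))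
      exact maximalSublevel_subset Φ k hz.1
    refine hlip Ω _ g Φ k hΩ (hm.integrable one_le_two)
      (fun j => (hg j).1.integrable one_le_two) (fun j => (hg j).2.1) hΦ ?_ x hx.1 y hy.1
      (hmem x hx) (hmem y hy) hxy
    filter_upwards [ae_all_iff.2 fun j => (hg j).2.2] with z hz
    exact Finset.sum_le_sum fun j _ => hz j

end LipschitzPieces

/-! ### Ordered Lipschitz selections and approximate differentiability. -/

section Jets

variable {n Q m : ℕ} {f : Eu n → AQ Q m}

/-- The tuple `p` is `s`-close to the model tuple `c`, and its entries coincide wherever those of `c`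
do. -/
def FollowsModel (c : Fin Q → Eu m) (s : ℝ) (p : Fin Q → Eu m) : Prop :=
  (∀ i, ‖p i - c i‖ ≤ s) ∧ ∀ i k, c i = c k → p i = p k

/-- Distinct entries of `c` are at distance at least `5 s`. -/
def IsSeparated (c : Fin Q → Eu m) (s : ℝ) : Prop :=
  0 < s ∧ ∀ i k, c i ≠ c k → 5 * s ≤ ‖c i - c k‖

theorem FollowsModel.separated {c : Fin Q → Eu m} {s : ℝ} (hc : IsSeparated c s)
    {p q : Fin Q → Eu m} (hp : FollowsModel c s p) (hq : FollowsModel c s q) {i k : Fin Q}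
    (hik : c i ≠ c k) : 3 * s ≤ ‖p i - q k‖ := by
  have h1 := hc.2 i k hik
  have h2 : ‖c i - c k‖ ≤ ‖p i - c i‖ + ‖p i - q k‖ + ‖q k - c k‖ := by
    have : c i - c k = -(p i - c i) + (p i - q k) + (q k - c k) := by abel
    rw [this]
    refine (norm_add_le _ _).trans ?_
    gcongr
    refine (norm_add_le _ _).trans ?_
    rw [norm_neg]
  linarith [hp.1 i, hq.1 k]

/-- Pairing entries with different model values costs at least 3s, while the given order costs at
most 2s per entry, so no permutation does better. Unordered and ordered distances therefore agree
for tuples following one model. -/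
theorem FollowsModel.tupleDist_le_dG {c : Fin Q → Eu m} {s : ℝ} (hc : IsSeparated c s)
    {p q : Fin Q → Eu m} (hp : FollowsModel c s p) (hq : FollowsModel c s q) :
    tupleDist p q ≤ dG (ofPoints p) (ofPoints q) := by
  obtain ⟨σ, hσ⟩ := exists_perm_dG_eq p q
  rw [hσ]
  refine tupleDist_le_of_forall_le fun i => ?_
  by_cases h : c i = c (σ i)
  · rw [Function.comp_apply, hq.2 i (σ i) h]
  · have h1 := hp.separated hc hq h
    have h2 : ‖p i - q i‖ ≤ ‖p i - c i‖ + ‖q i - c i‖ := by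
      have : p i - q i = (p i - c i) - (q i - c i) := by abel
      rw [this]
      exact norm_sub_le _ _
    have := hp.1 i
    have := hq.1 i
    have := hc.1
    rw [Function.comp_apply]
    linarith

/-- The part of `E` on which `f` has an enumeration following the model `c`. -/
def modelPiece (f : Eu n → AQ Q m) (E : Set (Eu n)) (c : Fin Q → Eu m) (s : ℝ) : Set (Eu n) :=
  {x | x ∈ E ∧ ∃ p, ofPoints p = f x ∧ FollowsModel c s p}

/-- The model fixes the order of the entries, so a Lipschitz bound for `dG` passes to each entry;
the entries are then extended to the whole space so that Rademacher's theorem applies. -/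
theorem exists_lipschitz_enumeration {E : Set (Eu n)} {L : ℝ} (hL : 0 ≤ L)
    (hlip : ∀ x ∈ E, ∀ y ∈ E, dG (f x) (f y) ≤ L * ‖x - y‖) {c : Fin Q → Eu m} {s : ℝ}
    (hc : IsSeparated c s) :
    ∃ (P : Fin Q → Eu n → Eu m) (K : NNReal), (∀ i, LipschitzWith K (P i)) ∧
      ∀ x ∈ modelPiece f E c s,
        ofPoints (fun i => P i x) = f x ∧ FollowsModel c s fun i => P i x := by
  classical
  have hex : ∀ x, ∃ p : Fin Q → Eu m, x ∈ modelPiece f E c s →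
      ofPoints p = f x ∧ FollowsModel c s p := by
    intro x
    by_cases hx : x ∈ modelPiece f E c s
    · obtain ⟨-, p, hp⟩ := hx
      exact ⟨p, fun _ => hp⟩
    · exact ⟨0, fun h => absurd h hx⟩
  choose p hp using hex
  have h1 : ∀ i, LipschitzOnWith ⟨L, hL⟩ (fun x => p x i) (modelPiece f E c s) := by
    intro i
    refine LipschitzOnWith.of_dist_le_mul fun x hx y hy => ?_
    rw [dist_eq_norm, dist_eq_norm]
    refine (norm_sub_le_tupleDist _ _ i).trans ?_
    refine ((hp x hx).2.tupleDist_le_dG hc (hp y hy).2).trans ?_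
    rw [(hp x hx).1, (hp y hy).1]
    exact hlip x hx.1 y hy.1
  choose P hP hPeq using fun i => (h1 i).extend_finite_dimension
  refine ⟨P, _, hP, fun x hx => ?_⟩
  have h2 : (fun i => P i x) = p x := funext fun i => (hPeq i hx).symm
  rw [h2]
  exact hp x hx

/-- The piece is relatively closed in `E`: the Lipschitz extensions carry the model conditions to
limit points, and continuity of `f` on `E` shows that they still enumerate `f` there. -/
theorem measurableSet_modelPiece {E : Set (Eu n)} (hE : MeasurableSet E) {L : ℝ} (hL : 0 ≤ L)
    (hlip : ∀ x ∈ E, ∀ y ∈ E, dG (f x) (f y) ≤ L * ‖x - y‖) {c : Fin Q → Eu m} {s : ℝ}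
    (hc : IsSeparated c s) : MeasurableSet (modelPiece f E c s) := by
  obtain ⟨P, K, hP, hPA⟩ := exists_lipschitz_enumeration hL hlip hc
  set A := modelPiece f E c s with hA
  have hPc : ∀ i, Continuous (P i) := fun i => (hP i).continuous
  suffices h : A = E ∩ closure A by
    rw [h]
    exact hE.inter isClosed_closure.measurableSet
  refine Set.Subset.antisymm (fun x hx => ⟨hx.1, subset_closure hx⟩) fun x ⟨hxE, hx⟩ => ?_
  refine ⟨hxE, fun i => P i x, ?_, fun i => ?_, fun i k hik => ?_⟩
  · refine (eq_of_dG_eq_zero (le_antisymm ?_ (dG_nonneg _ _))).symm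
    have hne : (𝓝[A] x).NeBot := mem_closure_iff_nhdsWithin_neBot.1 hx
    have hlim : Tendsto (fun y => L * ‖x - y‖ + tupleDist (fun i => P i y) fun i => P i x)
        (𝓝[A] x) (𝓝 (L * ‖x - x‖ + tupleDist (fun i => P i x) fun i => P i x)) := by
      refine tendsto_nhdsWithin_of_tendsto_nhds (Continuous.tendsto ?_ x)
      unfold tupleDist
      fun_prop
    have h0 : L * ‖x - x‖ + tupleDist (fun i => P i x) (fun i => P i x) = 0 := by
      simp [tupleDist]
    rw [h0] at hlim
    refine ge_of_tendsto hlim ?_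
    filter_upwards [self_mem_nhdsWithin] with y hy
    refine (dG_triangle _ (f y) _).trans (add_le_add (hlip x hxE y hy.1) ?_)
    rw [← (hPA y hy).1]
    exact dG_ofPoints_le _ _
  · have hcl : IsClosed {y | ‖P i y - c i‖ ≤ s} :=
      isClosed_le ((hPc i).sub continuous_const).norm continuous_const
    exact closure_minimal (fun y hy => (hPA y hy).2.1 i) hcl hx
  · have hcl : IsClosed {y | P i y = P k y} := isClosed_eq (hPc i) (hPc k)
    exact closure_minimal (fun y hy => (hPA y hy).2.2 i k hik) hcl hx

theorem ae_exists_jet_modelPiece {E : Set (Eu n)} (hE : MeasurableSet E) {L : ℝ} (hL : 0 ≤ L)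
    (hlip : ∀ x ∈ E, ∀ y ∈ E, dG (f x) (f y) ≤ L * ‖x - y‖) {c : Fin Q → Eu m} {s : ℝ}
    (hc : IsSeparated c s) :
    ∀ᵐ x ∂(volume.restrict (modelPiece f E c s)), ∃ J, IsApproxJet f x J := by
  have hAm := measurableSet_modelPiece hE hL hlip hc
  obtain ⟨P, K, hP, hPA⟩ := exists_lipschitz_enumeration hL hlip hc
  set A := modelPiece f E c s
  have hd : ∀ᵐ x ∂(volume.restrict A), ∀ i, DifferentiableAt ℝ (P i) x :=
    ae_restrict_of_ae (ae_all_iff.2 fun i => (hP i).ae_differentiableAt)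
  filter_upwards [hd, ae_hasDensityOne A, ae_restrict_mem hAm] with x hx hden hxA
  have hlit : ∀ i, (fun y => P i y - P i x - fderiv ℝ (P i) x (y - x)) =o[𝓝[A] x]
      fun y => y - x := fun i => (hx i).hasFDerivAt.isLittleO.mono nhdsWithin_le_nhds
  refine ⟨fun i => (P i x, fderiv ℝ (P i) x), (hPA x hxA).1, fun i k hik => ?_,
    A, hAm, hxA, hden, ?_⟩
  -- Entries that are equal at `x` must have equal model values, by the 3s gap. They then coincide
  -- on the whole piece, and at a density point this forces equal differentials.
  · have hcik : c i = c k := by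
      by_contra hne
      have h1 := (hPA x hxA).2.separated hc (hPA x hxA).2 hne
      have h2 : P i x = P k x := hik
      have h3 := hc.1
      simp only [h2, sub_self, norm_zero] at h1
      linarith
    refine sub_eq_zero.1 (hden.eq_zero_of_isLittleO (fderiv ℝ (P i) x - fderiv ℝ (P k) x) ?_)
    refine ((hlit k).sub (hlit i)).congr' ?_ EventuallyEq.rfl
    filter_upwards [self_mem_nhdsWithin] with y hy
    have h1 : P i y = P k y := (hPA y hy).2.2 i k hcik
    have h2 : P i x = P k x := hik
    change P k y - P k x - _ - (P i y - P i x - _) = fderiv ℝ (P i) x _ - fderiv ℝ (P k) x _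
    rw [h1, h2]
    abel
  · have hsum : (fun y => ∑ i, ‖P i y - P i x - fderiv ℝ (P i) x (y - x)‖) =o[𝓝[A] x]
        fun y => y - x := IsLittleO.fun_sum fun i _ => (hlit i).norm_left
    refine IsBigO.trans_isLittleO (IsBigO.of_bound 1 ?_) hsum
    filter_upwards [self_mem_nhdsWithin] with y hy
    rw [one_mul, Real.norm_of_nonneg (dG_nonneg _ _),
      Real.norm_of_nonneg (Finset.sum_nonneg fun i _ => norm_nonneg _), ← (hPA y hy).1]
    refine (dG_ofPoints_le _ _).trans ((tupleDist_le_sum _ _).trans (le_of_eq ?_))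
    refine Finset.sum_congr rfl fun i _ => ?_
    rw [sub_add_eq_sub_sub]

theorem exists_model (p : Fin Q → Eu m) : ∃ (a : Fin Q → ℕ) (l : ℕ),
    IsSeparated (fun i => TopologicalSpace.denseSeq (Eu m) (a i)) (1 / (l + 1 : ℝ)) ∧
      FollowsModel (fun i => TopologicalSpace.denseSeq (Eu m) (a i)) (1 / (l + 1 : ℝ)) p := by
  -- Replacing entries by dense points within `s` changes mutual distances by at most 2s, so a gap
  -- 7s leaves the separation 5s required of the model.
  have hgap : ∃ l : ℕ, ∀ i k, p i ≠ p k → 7 * (1 / (l + 1 : ℝ)) < ‖p i - p k‖ := by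
    have hlim : Tendsto (fun l : ℕ => 7 * (1 / (l + 1 : ℝ))) atTop (𝓝 (7 * 0)) :=
      tendsto_one_div_add_atTop_nhds_zero_nat.const_mul 7
    rw [mul_zero] at hlim
    have h : ∀ᶠ l : ℕ in atTop, ∀ i k, p i ≠ p k → 7 * (1 / (l + 1 : ℝ)) < ‖p i - p k‖ := by
      refine eventually_all.2 fun i => eventually_all.2 fun k => ?_
      by_cases hik : p i = p k
      · exact Eventually.of_forall fun l h => absurd hik h
      · filter_upwards [hlim.eventually (gt_mem_nhds (norm_pos_iff.2 (sub_ne_zero.2 hik)))] with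
          l hl _ using hl
    exact h.exists
  obtain ⟨l, hl⟩ := hgap
  have hs : 0 < 1 / (l + 1 : ℝ) := by positivity
  set s := 1 / (l + 1 : ℝ)
  have hden : ∀ v : Eu m, ∃ a : ℕ, ‖v - TopologicalSpace.denseSeq (Eu m) a‖ < s := by
    intro v
    obtain ⟨a, ha⟩ := (TopologicalSpace.denseRange_denseSeq (Eu m)).exists_dist_lt v hs
    exact ⟨a, by rwa [← dist_eq_norm]⟩
  choose a ha using hden
  set c : Fin Q → Eu m := fun i => TopologicalSpace.denseSeq (Eu m) (a (p i))
  have hclose : ∀ i k, |‖p i - p k‖ - ‖c i - c k‖| ≤ 2 * s := by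
    intro i k
    refine (abs_norm_sub_norm_le _ _).trans ?_
    have : p i - p k - (c i - c k) = (p i - c i) - (p k - c k) := by abel
    rw [this]
    refine (norm_sub_le _ _).trans ?_
    linarith [ha (p i), ha (p k)]
  refine ⟨fun i => a (p i), l, ⟨hs, fun i k hik => ?_⟩, fun i => (ha (p i)).le, fun i k hik => ?_⟩
  · have hne : p i ≠ p k := fun h => hik (by simp only [h])
    have := hl i k hne
    have := (abs_le.1 (hclose i k)).2
    linarith
  · by_contra hne
    have h1 := hl i k hne
    have h2 := (abs_le.1 (hclose i k)).2
    have h3 : c i = c k := hik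
    rw [h3, sub_self, norm_zero] at h2
    linarith

/-- A Lipschitz tuple-valued map is approximately differentiable almost everywhere. -/
theorem ae_exists_jet_of_isLocallyLipschitzOn {E : Set (Eu n)} (hE : MeasurableSet E)
    (hlip : IsLocallyLipschitzOn f E) : ∀ᵐ x ∂(volume.restrict E), ∃ J, IsApproxJet f x J := by
  obtain ⟨L, δ, hL, hδ, hlip⟩ := hlip
  set b : ℕ → Eu n := TopologicalSpace.denseSeq (Eu n)
  -- The index records a ball centre, a model made of dense points and a scale 1/(l + 1). Balls of
  -- radius δ/2 turn the small-scale Lipschitz bound into one for all pairs of points.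
  set piece : ℕ × (Fin Q → ℕ) × ℕ → Set (Eu n) := fun τ =>
    {x | x ∈ modelPiece f (E ∩ Metric.ball (b τ.1) (δ / 2))
      (fun i => TopologicalSpace.denseSeq (Eu m) (τ.2.1 i)) (1 / (τ.2.2 + 1 : ℝ)) ∧
      IsSeparated (fun i => TopologicalSpace.denseSeq (Eu m) (τ.2.1 i)) (1 / (τ.2.2 + 1 : ℝ))}
    with hpiece
  have hcover : E ⊆ ⋃ τ, piece τ := by
    intro x hx
    obtain ⟨j, hj⟩ := (TopologicalSpace.denseRange_denseSeq (Eu n)).exists_dist_lt x (half_pos hδ)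
    obtain ⟨p, hp⟩ := exists_ofPoints (f x)
    obtain ⟨a, l, hsep, hfol⟩ := exists_model p
    exact Set.mem_iUnion.2 ⟨(j, a, l), ⟨⟨hx, hj⟩, p, hp, hfol⟩, hsep⟩
  refine ae_restrict_of_ae_restrict_of_subset hcover ?_
  rw [ae_restrict_iUnion_iff]
  intro τ
  by_cases hsep : IsSeparated (fun i => TopologicalSpace.denseSeq (Eu m) (τ.2.1 i))
    (1 / (τ.2.2 + 1 : ℝ))
  · refine ae_restrict_of_ae_restrict_of_subset (fun x hx => hx.1)
      (ae_exists_jet_modelPiece (hE.inter measurableSet_ball) hL (fun x hx y hy => ?_) hsep)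
    refine hlip x hx.1 y hy.1 ?_
    rw [← dist_eq_norm]
    have h1 := hx.2
    have h2 := hy.2
    rw [Metric.mem_ball] at h1 h2
    linarith [dist_triangle_right x y (b τ.1)]
  · have : piece τ = ∅ := Set.eq_empty_of_forall_notMem fun x hx => hsep hx.2
    rw [this]
    simp

end Jets

/-! ### Mollification and its convergence in L¹. -/

section Mollification

variable {n : ℕ}

/-- A standard bump function of radius `1 / (k + 1)`. -/
noncomputable def stdBump (n k : ℕ) : ContDiffBump (0 : Eu n) where
  rIn := 1 / (k + 1 : ℝ) / 2
  rOut := 1 / (k + 1 : ℝ)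
  rIn_pos := by positivity
  rIn_lt_rOut := half_lt_self (by positivity)

/-- The mollification of `W` at scale `1 / (k + 1)`. -/
noncomputable def mollify (k : ℕ) (W : Eu n → ℝ) : Eu n → ℝ :=
  convolution ((stdBump n k).normed volume) W (ContinuousLinearMap.lsmul ℝ ℝ) volume

theorem tendsto_stdBump_rOut (n : ℕ) :
    Tendsto (fun k => (stdBump n k).rOut) atTop (𝓝 0) :=
  tendsto_one_div_add_atTop_nhds_zero_nat

theorem ae_tendsto_mollify {W : Eu n → ℝ} (hW : Integrable W) :
    ∀ᵐ x, Tendsto (fun k => mollify k W x) atTop (𝓝 (W x)) :=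
  ContDiffBump.ae_convolution_tendsto_right_of_locallyIntegrable (K := 2) (tendsto_stdBump_rOut n)
    (Eventually.of_forall fun k => by simp only [stdBump]; linarith) hW.locallyIntegrable

theorem contDiff_mollify (k : ℕ) {W : Eu n → ℝ} (hW : Integrable W) :
    ContDiff ℝ ∞ (mollify k W) :=
  (stdBump n k).hasCompactSupport_normed.contDiff_convolution_left _
    (stdBump n k).contDiff_normed hW.locallyIntegrable

theorem integrable_normed_stdBump (k : ℕ) : Integrable ((stdBump n k).normed volume) :=
  (stdBump n k).integrable_normed

theorem integrable_mollify (k : ℕ) {W : Eu n → ℝ} (hW : Integrable W) :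
    Integrable (mollify k W) :=
  (integrable_normed_stdBump k).integrable_convolution _ hW

theorem integral_mollify (k : ℕ) {W : Eu n → ℝ} (hW : Integrable W) :
    ∫ x, mollify k W x = ∫ x, W x := by
  refine (integral_convolution _ (integrable_normed_stdBump k) hW).trans ?_
  rw [ContDiffBump.integral_normed]
  simp

theorem mollify_nonneg (k : ℕ) {W : Eu n → ℝ} (hW : ∀ x, 0 ≤ W x) (x : Eu n) :
    0 ≤ mollify k W x := by
  refine integral_nonneg fun t => ?_
  exact mul_nonneg ((stdBump n k).nonneg_normed t) (hW _)

theorem mollify_sub (k : ℕ) {V W : Eu n → ℝ} (hV : Integrable V) (hW : Integrable W) :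
    mollify k (V - W) = mollify k V - mollify k W := by
  funext x
  have hex : ∀ {U : Eu n → ℝ}, Integrable U → ConvolutionExistsAt ((stdBump n k).normed volume) U x
      (ContinuousLinearMap.lsmul ℝ ℝ) volume := fun hU =>
    (stdBump n k).hasCompactSupport_normed.convolutionExists_left _
      (stdBump n k).continuous_normed hU.locallyIntegrable x
  simp only [mollify, convolution_def, Pi.sub_apply, map_sub]
  exact integral_sub (hex hV) (hex hW)

/-- Scheffé's argument: mollification preserves the integral, so the L¹ distance is twice the
integral of the positive part of `W - mollify k W`. That part is dominated by `W`, because the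
mollification is nonnegative. -/
theorem tendsto_integral_abs_mollify_sub_of_nonneg {W : Eu n → ℝ} (hW : Integrable W)
    (hW0 : ∀ x, 0 ≤ W x) :
    Tendsto (fun k => ∫ x, |mollify k W x - W x|) atTop (𝓝 0) := by
  have hpos : ∀ k, Integrable fun x => max (W x - mollify k W x) 0 := fun k =>
    (hW.sub (integrable_mollify k hW)).pos_part
  have h1 : ∀ k, ∫ x, |mollify k W x - W x| = 2 * ∫ x, max (W x - mollify k W x) 0 := by
    intro k
    have h2 : ∀ x, |mollify k W x - W x| =
        (mollify k W x - W x) + 2 * max (W x - mollify k W x) 0 := by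
      intro x
      rcases le_total (W x) (mollify k W x) with h | h
      · rw [abs_of_nonneg (sub_nonneg.2 h), max_eq_right (sub_nonpos.2 h)]; ring
      · rw [abs_of_nonpos (sub_nonpos.2 h), max_eq_left (sub_nonneg.2 h)]; ring
    simp only [h2]
    have hd : Integrable fun x => mollify k W x - W x := (integrable_mollify k hW).sub hW
    rw [integral_add hd ((hpos k).const_mul 2),
      integral_sub (integrable_mollify k hW) hW, integral_mollify k hW, sub_self, zero_add,
      integral_const_mul]
  simp only [h1]
  have h3 : Tendsto (fun k => ∫ x, max (W x - mollify k W x) 0) atTop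
      (𝓝 (∫ _ : Eu n, (0 : ℝ))) := by
    refine tendsto_integral_of_dominated_convergence W (fun k => (hpos k).aestronglyMeasurable) hW
      (fun k => Eventually.of_forall fun x => ?_) ?_
    · rw [Real.norm_of_nonneg (le_max_right _ _)]
      exact max_le (by linarith [mollify_nonneg k hW0 x]) (hW0 x)
    · filter_upwards [ae_tendsto_mollify hW] with x hx
      have := (tendsto_const_nhds (x := W x)).sub hx
      rw [sub_self] at this
      simpa using this.max (tendsto_const_nhds (x := (0 : ℝ)))
  rw [integral_zero] at h3
  simpa using h3.const_mul 2

theorem tendsto_integral_abs_mollify_sub {W : Eu n → ℝ} (hW : Integrable W) :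
    Tendsto (fun k => ∫ x, |mollify k W x - W x|) atTop (𝓝 0) := by
  set P : Eu n → ℝ := fun x => max (W x) 0
  set N : Eu n → ℝ := fun x => max (-W x) 0
  have hP : Integrable P := hW.pos_part
  have hN : Integrable N := hW.neg_part
  have hWPN : W = P - N := by
    funext x
    change W x = max (W x) 0 - max (-W x) 0
    rcases le_total 0 (W x) with h | h
    · rw [max_eq_left h, max_eq_right (by linarith)]; ring
    · rw [max_eq_right h, max_eq_left (by linarith)]; ring
  have h1 := (tendsto_integral_abs_mollify_sub_of_nonneg hP fun x => le_max_right _ _).add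
    (tendsto_integral_abs_mollify_sub_of_nonneg hN fun x => le_max_right _ _)
  rw [add_zero] at h1
  refine squeeze_zero (fun k => integral_nonneg fun x => abs_nonneg _) (fun k => ?_) h1
  have hPk := ((integrable_mollify k hP).sub hP).abs
  have hNk := ((integrable_mollify k hN).sub hN).abs
  refine le_trans ?_ (le_of_eq (integral_add hPk hNk))
  refine integral_mono ((integrable_mollify k hW).sub hW).abs (hPk.add hNk) fun x => ?_
  change |mollify k W x - W x| ≤ |mollify k P x - P x| + |mollify k N x - N x|
  rw [hWPN, mollify_sub k hP hN]
  change |mollify k P x - mollify k N x - (P x - N x)| ≤ _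
  rw [sub_sub_sub_comm]
  exact abs_sub _ _

variable {Ω : Set (Eu n)}

/-- When the ball lies in Ω, the reflected kernel centred at `x` is an admissible test function, so
the derivative can be moved from the kernel to `w`. -/
theorem fderiv_mollify (hΩ : IsOpen Ω) {j : Fin n} {w h : Eu n → ℝ} (hw : IntegrableOn w Ω)
    (hwh : HasWeakPartialDeriv Ω j w h) (k : ℕ) {x : Eu n}
    (hx : Metric.closedBall x (1 / (k + 1 : ℝ)) ⊆ Ω) :
    fderiv ℝ (mollify k (Ω.indicator w)) x (stdVec j) = mollify k (Ω.indicator h) x := by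
  set κ := (stdBump n k).normed volume with hκ
  have hκs : ContDiff ℝ ∞ κ := (stdBump n k).contDiff_normed
  have hκc : HasCompactSupport κ := (stdBump n k).hasCompactSupport_normed
  have hW : Integrable (Ω.indicator w) := (integrable_indicator_iff hΩ.measurableSet).2 hw
  have h1 := hκc.hasFDerivAt_convolution_left (ContinuousLinearMap.lsmul ℝ ℝ)
    (hκs.of_le (by norm_cast)) hW.locallyIntegrable x
  have hex : ConvolutionExistsAt (fderiv ℝ κ) (Ω.indicator w) x
      ((ContinuousLinearMap.lsmul ℝ ℝ).precompL (Eu n)) volume :=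
    (hκc.fderiv ℝ).convolutionExists_left _ (hκs.continuous_fderiv (by simp))
      hW.locallyIntegrable x
  have h2 : fderiv ℝ (mollify k (Ω.indicator w)) x (stdVec j) =
      ∫ t, fderiv ℝ κ t (stdVec j) * Ω.indicator w (x - t) := by
    rw [mollify, h1.fderiv, convolution_def, ContinuousLinearMap.integral_apply hex]
    rfl
  have h3 : ∫ t, fderiv ℝ κ t (stdVec j) * Ω.indicator w (x - t) =
      ∫ y in Ω, w y * fderiv ℝ κ (x - y) (stdVec j) := by
    rw [← integral_indicator hΩ.measurableSet, ← integral_sub_left_eq_self _ volume x]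
    congr 1
    funext y
    rw [sub_sub_cancel]
    by_cases hy : y ∈ Ω
    · simp only [Set.indicator_of_mem hy]; ring
    · simp [Set.indicator_of_notMem hy]
  have h4 : mollify k (Ω.indicator h) x = ∫ y in Ω, h y * κ (x - y) := by
    rw [mollify, convolution_lsmul_swap, ← integral_indicator hΩ.measurableSet]
    congr 1
    funext y
    by_cases hy : y ∈ Ω
    · simp only [Set.indicator_of_mem hy, smul_eq_mul, hκ]; ring
    · simp [Set.indicator_of_notMem hy]
  have hη : ContDiff ℝ ∞ fun y => κ (x - y) := hκs.comp (by fun_prop)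
  have hηs : tsupport (fun y => κ (x - y)) ⊆ Metric.closedBall x (1 / (k + 1 : ℝ)) := by
    refine closure_minimal (fun y hy => ?_) Metric.isClosed_closedBall
    have h5 : x - y ∈ Function.support κ := hy
    rw [hκ, ContDiffBump.support_normed_eq] at h5
    rw [Metric.mem_closedBall, dist_eq_norm, norm_sub_rev]
    have := Metric.mem_ball.1 h5
    rw [dist_zero_right] at this
    exact this.le
  have h6 := hwh (fun y => κ (x - y)) hη
    ((isCompact_closedBall x _).of_isClosed_subset (isClosed_tsupport _) hηs) (hηs.trans hx)
  have h7 : ∀ y, fderiv ℝ (fun y => κ (x - y)) y (stdVec j) = -fderiv ℝ κ (x - y) (stdVec j) := by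
    intro y
    have h8 : HasFDerivAt (fun y => κ (x - y))
        ((fderiv ℝ κ (x - y)).comp (-ContinuousLinearMap.id ℝ (Eu n))) y :=
      ((hκs.differentiable (by simp)) _).hasFDerivAt.comp y ((hasFDerivAt_id y).const_sub x)
    rw [h8.fderiv]
    simp
  simp only [h7, mul_neg, integral_neg] at h6
  rw [h2, h3, h4]
  linarith

end Mollification

/-! ### The chain rule for weak derivatives. -/

section ChainRule

variable {n : ℕ} {Ω : Set (Eu n)}

theorem setIntegral_eq_integral_of_tsupport {η a : Eu n → ℝ} (hη : tsupport η ⊆ Ω)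
    (ha : ∀ x, η x = 0 → a x = 0) : ∫ x in Ω, a x = ∫ x, a x :=
  setIntegral_eq_integral_of_forall_compl_eq_zero fun x hx =>
    ha x (image_eq_zero_of_notMem_tsupport fun h => hx (hη h))

/-- Weak derivatives, tested by functions on the whole space. -/
theorem hasWeakPartialDeriv_iff_indicator {j : Fin n} {w h : Eu n → ℝ} :
    HasWeakPartialDeriv Ω j w h ↔ ∀ η : Eu n → ℝ, ContDiff ℝ ∞ η → HasCompactSupport η →
      tsupport η ⊆ Ω → ∫ x, w x * fderiv ℝ η x (stdVec j) = - ∫ x, h x * η x := by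
  refine forall_congr' fun η => forall_congr' fun hη => forall_congr' fun _ =>
    forall_congr' fun hs => ?_
  rw [setIntegral_eq_integral_of_forall_compl_eq_zero (fun x hx => ?_),
    setIntegral_eq_integral_of_tsupport hs fun x hx => by simp [hx]]
  have h1 : fderiv ℝ η x = 0 := by
    by_contra h3
    exact hx (hs (support_fderiv_subset ℝ h3))
  simp [h1]

theorem continuous_fderiv_stdVec {η : Eu n → ℝ} (hη : ContDiff ℝ ∞ η) (j : Fin n) :
    Continuous fun x => fderiv ℝ η x (stdVec j) :=
  (hη.continuous_fderiv (by simp)).clm_apply continuous_const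

theorem hasCompactSupport_fderiv_stdVec {η : Eu n → ℝ} (hη : HasCompactSupport η) (j : Fin n) :
    HasCompactSupport fun x => fderiv ℝ η x (stdVec j) :=
  (hη.fderiv ℝ).comp_left (g := fun L : Eu n →L[ℝ] ℝ => L (stdVec j)) rfl

/-- The chain rule for weak derivatives. -/
theorem HasWeakPartialDeriv.comp (hΩ : IsOpen Ω) {j : Fin n} {w h : Eu n → ℝ}
    (hwi : IntegrableOn w Ω) (hhi : IntegrableOn h Ω) (hwh : HasWeakPartialDeriv Ω j w h)
    {F F' : ℝ → ℝ} (hF : ∀ s, HasDerivAt F (F' s) s) (hF'c : Continuous F') {C : ℝ}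
    (hC : ∀ s, |F s| ≤ C) (hC' : ∀ s, |F' s| ≤ C) :
    HasWeakPartialDeriv Ω j (fun x => F (w x)) fun x => F' (w x) * h x := by
  rw [hasWeakPartialDeriv_iff_indicator]
  intro η hη hηc hηs
  have hC0 : 0 ≤ C := (abs_nonneg _).trans (hC 0)
  have hFc : Continuous F := continuous_iff_continuousAt.2 fun s => (hF s).continuousAt
  set W := Ω.indicator w with hWdef
  set H := Ω.indicator h with hHdef
  have hW : Integrable W := (integrable_indicator_iff hΩ.measurableSet).2 hwi
  have hH : Integrable H := (integrable_indicator_iff hΩ.measurableSet).2 hhi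
  obtain ⟨M, hM⟩ := hη.continuous.bounded_above_of_compact_support hηc
  have hM0 : 0 ≤ M := (norm_nonneg _).trans (hM 0)
  have hη'c := continuous_fderiv_stdVec hη j
  have hη's := hasCompactSupport_fderiv_stdVec hηc j
  have hη'0 : ∀ x, x ∉ Ω → fderiv ℝ η x (stdVec j) = 0 := fun x hx => by
    have h1 : fderiv ℝ η x = 0 := by
      by_contra h3
      exact hx (hηs (support_fderiv_subset ℝ h3))
    simp [h1]
  have hη0 : ∀ x, x ∉ Ω → η x = 0 := fun x hx =>
    image_eq_zero_of_notMem_tsupport fun h => hx (hηs h)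
  have hWc : ∀ k, Continuous (mollify k W) := fun k => (contDiff_mollify k hW).continuous
  have hWd : ∀ k, Differentiable ℝ (mollify k W) := fun k =>
    (contDiff_mollify k hW).differentiable (by simp)
  have hHc : ∀ k, Continuous (mollify k H) := fun k => (contDiff_mollify k hH).continuous
  obtain ⟨δ, hδ, hδΩ⟩ := IsCompact.exists_cthickening_subset_open hηc hΩ hηs
  have hibp : ∀ᶠ k : ℕ in atTop, ∫ x, F (mollify k W x) * fderiv ℝ η x (stdVec j) =
      - ∫ x, F' (mollify k W x) * mollify k H x * η x := by
    filter_upwards [tendsto_one_div_add_atTop_nhds_zero_nat.eventually (gt_mem_nhds hδ)] with k hk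
    have hGd : ∀ x, HasFDerivAt (fun x => F (mollify k W x))
        (F' (mollify k W x) • fderiv ℝ (mollify k W) x) x := fun x =>
      (hF _).comp_hasFDerivAt x (hWd k x).hasFDerivAt
    have hGf : ∀ x, fderiv ℝ (fun x => F (mollify k W x)) x (stdVec j) * η x =
        F' (mollify k W x) * mollify k H x * η x := by
      intro x
      by_cases hx : x ∈ tsupport η
      · have hsub : Metric.closedBall x (1 / (k + 1 : ℝ)) ⊆ Ω :=
          (Metric.closedBall_subset_closedBall hk.le).trans
            ((Metric.closedBall_subset_cthickening hx δ).trans hδΩ)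
        rw [(hGd x).fderiv]
        change F' _ * fderiv ℝ (mollify k W) x (stdVec j) * η x = _
        rw [fderiv_mollify hΩ hwi hwh k hsub]
      · rw [image_eq_zero_of_notMem_tsupport hx, mul_zero, mul_zero]
    rw [integral_mul_fderiv_eq_neg_fderiv_mul_of_integrable]
    · simp only [hGf]
    · simp only [hGf]
      exact (((hF'c.comp (hWc k)).mul (hHc k)).mul hη.continuous).integrable_of_hasCompactSupport
        hηc.mul_left
    · exact ((hFc.comp (hWc k)).mul hη'c).integrable_of_hasCompactSupport hη's.mul_left
    · exact ((hFc.comp (hWc k)).mul hη.continuous).integrable_of_hasCompactSupport hηc.mul_left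
    · exact fun x _ => (hGd x).differentiableAt
    · exact fun x _ => hη.differentiable (by simp) x
  have hlim1 : Tendsto (fun k => ∫ x, F (mollify k W x) * fderiv ℝ η x (stdVec j)) atTop
      (𝓝 (∫ x, F (W x) * fderiv ℝ η x (stdVec j))) := by
    refine tendsto_integral_of_dominated_convergence
      (fun x => C * |fderiv ℝ η x (stdVec j)|)
      (fun k => ((hFc.comp (hWc k)).mul hη'c).aestronglyMeasurable)
      ((hη'c.integrable_of_hasCompactSupport hη's).abs.const_mul C)
      (fun k => Eventually.of_forall fun x => ?_) ?_
    · rw [norm_mul]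
      gcongr
      exacts [hC _, le_rfl]
    · filter_upwards [ae_tendsto_mollify hW] with x hx
      exact ((hFc.tendsto _).comp hx).mul_const _
  -- No common integrable majorant is at hand for `mollify k H`, so its deviation from `H` is
  -- separated and controlled in L¹; the remaining term is handled by dominated convergence.
  have hlim2 : Tendsto (fun k => ∫ x, F' (mollify k W x) * (mollify k H x - H x) * η x) atTop
      (𝓝 0) := by
    have h1 := (tendsto_integral_abs_mollify_sub hH).const_mul (C * M)
    rw [mul_zero] at h1
    refine squeeze_zero_norm (fun k => ?_) h1
    rw [← integral_const_mul]
    refine norm_integral_le_of_norm_le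
      (((integrable_mollify k hH).sub hH).abs.const_mul (C * M))
      (Eventually.of_forall fun x => ?_)
    rw [norm_mul, norm_mul]
    calc ‖F' (mollify k W x)‖ * ‖mollify k H x - H x‖ * ‖η x‖
        ≤ C * ‖mollify k H x - H x‖ * M := by
          gcongr
          exacts [hC' _, hM x]
      _ = C * M * |(mollify k H - H) x| := by
          rw [Real.norm_eq_abs, Pi.sub_apply]; ring
  have hmeas : ∀ k, AEStronglyMeasurable (fun x => F' (mollify k W x) * H x * η x) volume :=
    fun k => ((hF'c.comp (hWc k)).aestronglyMeasurable.mul hH.aestronglyMeasurable).mul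
      hη.continuous.aestronglyMeasurable
  have hbound : ∀ k x, ‖F' (mollify k W x) * H x * η x‖ ≤ C * M * |H x| := fun k x => by
    rw [norm_mul, norm_mul]
    calc ‖F' (mollify k W x)‖ * ‖H x‖ * ‖η x‖ ≤ C * ‖H x‖ * M := by
          gcongr
          exacts [hC' _, hM x]
      _ = C * M * |H x| := by rw [Real.norm_eq_abs]; ring
  have hlim3 : Tendsto (fun k => ∫ x, F' (mollify k W x) * H x * η x) atTop
      (𝓝 (∫ x, F' (W x) * H x * η x)) := by
    refine tendsto_integral_of_dominated_convergence (fun x => C * M * |H x|) hmeas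
      (hH.abs.const_mul _) (fun k => Eventually.of_forall (hbound k)) ?_
    filter_upwards [ae_tendsto_mollify hW] with x hx
    exact (((hF'c.tendsto _).comp hx).mul_const _).mul_const _
  have hsplit : ∀ k, ∫ x, F' (mollify k W x) * mollify k H x * η x =
      (∫ x, F' (mollify k W x) * (mollify k H x - H x) * η x) +
        ∫ x, F' (mollify k W x) * H x * η x := by
    intro k
    have hi : Integrable fun x => F' (mollify k W x) * H x * η x :=
      (hH.abs.const_mul (C * M)).mono' (hmeas k) (Eventually.of_forall (hbound k))
    have hi2 : Integrable fun x => F' (mollify k W x) * mollify k H x * η x :=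
      (((hF'c.comp (hWc k)).mul (hHc k)).mul hη.continuous).integrable_of_hasCompactSupport
        hηc.mul_left
    have h1 : ∀ x, F' (mollify k W x) * (mollify k H x - H x) * η x =
        F' (mollify k W x) * mollify k H x * η x - F' (mollify k W x) * H x * η x := fun x => by
      ring
    simp only [h1]
    rw [integral_sub hi2 hi]
    ring
  have hlim4 := (hlim2.add hlim3).neg
  rw [zero_add] at hlim4
  have hfin := tendsto_nhds_unique (hlim1.congr' (hibp.mono fun k hk => by rw [hk, hsplit k])) hlim4
  have e1 : ∀ x, F (w x) * fderiv ℝ η x (stdVec j) = F (W x) * fderiv ℝ η x (stdVec j) := by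
    intro x
    by_cases hx : x ∈ Ω
    · rw [hWdef, Set.indicator_of_mem hx]
    · rw [hη'0 x hx, mul_zero, mul_zero]
  have e2 : ∀ x, F' (w x) * h x * η x = F' (W x) * H x * η x := by
    intro x
    by_cases hx : x ∈ Ω
    · rw [hWdef, hHdef, Set.indicator_of_mem hx, Set.indicator_of_mem hx]
    · rw [hη0 x hx, mul_zero, mul_zero]
  simp only [e1, e2]
  exact hfin

end ChainRule

/-! ### Consequences: zero sets, squares, Lipschitz functions. -/

section ChainRuleConsequences

variable {n : ℕ} {Ω : Set (Eu n)} {j : Fin n}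

theorem tendsto_inv_one_add_sq (s : ℝ) :
    Tendsto (fun k : ℕ => (1 + (s * (k + 1 : ℝ)) ^ 2)⁻¹) atTop (𝓝 (if s = 0 then 1 else 0)) := by
  by_cases hs : s = 0
  · simp [hs]
  · rw [if_neg hs]
    refine tendsto_inv_atTop_zero.comp (tendsto_atTop_add_const_left _ _ ?_)
    have h1 : Tendsto (fun k : ℕ => (k : ℝ) + 1) atTop atTop :=
      tendsto_atTop_add_const_right _ _ tendsto_natCast_atTop_atTop
    have h2 := (tendsto_pow_atTop (two_ne_zero)).comp h1
    have h3 : Tendsto (fun k : ℕ => s ^ 2 * ((k : ℝ) + 1) ^ 2) atTop atTop :=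
      h2.const_mul_atTop (by positivity)
    simpa only [mul_pow] using h3

/-- The weak derivative of a function vanishes almost everywhere on its zero set. -/
theorem HasWeakPartialDeriv.ae_eq_zero (hΩ : IsOpen Ω) {w h : Eu n → ℝ}
    (hwi : IntegrableOn w Ω) (hhi : IntegrableOn h Ω) (hwh : HasWeakPartialDeriv Ω j w h) :
    ∀ᵐ x ∂(volume.restrict Ω), w x = 0 → h x = 0 := by
  set z : Eu n → ℝ := fun x => (if w x = 0 then 1 else 0) * h x with hz
  -- These are the derivatives of arctan((k + 1)s)/(k + 1). The functions tend uniformly to 0 while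
  -- the derivatives tend to the indicator of {0}, so `z` is a weak derivative of 0.
  set F' : ℕ → ℝ → ℝ := fun k s => (1 + (s * (k + 1 : ℝ)) ^ 2)⁻¹ with hF'
  have hF'c : ∀ k, Continuous (F' k) := fun k =>
    Continuous.inv₀ (by fun_prop) fun s => by positivity
  have hF'1 : ∀ k s, |F' k s| ≤ 1 := fun k s => by
    rw [hF', abs_of_pos (by positivity)]
    exact inv_le_one_of_one_le₀ (by nlinarith [sq_nonneg (s * (k + 1 : ℝ))])
  have hmeas : ∀ k, AEStronglyMeasurable (fun x => F' k (w x) * h x) (volume.restrict Ω) := fun k =>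
    ((hF'c k).comp_aestronglyMeasurable hwi.aestronglyMeasurable).mul hhi.aestronglyMeasurable
  have hzlim : ∀ x, Tendsto (fun k => F' k (w x) * h x) atTop (𝓝 (z x)) := fun x =>
    (tendsto_inv_one_add_sq (w x)).mul_const _
  have hzm : AEStronglyMeasurable z (volume.restrict Ω) :=
    aestronglyMeasurable_of_tendsto_ae atTop hmeas (Eventually.of_forall hzlim)
  have hzi : IntegrableOn z Ω := Integrable.mono hhi hzm (Eventually.of_forall fun x => by
    simp only [hz]
    split_ifs <;> simp)
  have hkey : ∀ᵐ x, x ∈ Ω → z x = 0 := by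
    refine hΩ.ae_eq_zero_of_integral_contDiff_smul_eq_zero hzi.locallyIntegrableOn ?_
    intro η hη hηc hηs
    obtain ⟨M, hM⟩ := hη.continuous.bounded_above_of_compact_support hηc
    have hweak : ∀ k : ℕ, ∫ x in Ω, (1 / (k + 1 : ℝ) * Real.arctan (w x * (k + 1 : ℝ))) *
        fderiv ℝ η x (stdVec j) = - ∫ x in Ω, F' k (w x) * h x * η x := by
      intro k
      have hk : (0 : ℝ) < k + 1 := by positivity
      refine HasWeakPartialDeriv.comp hΩ hwi hhi hwh
        (F := fun s => 1 / (k + 1 : ℝ) * Real.arctan (s * (k + 1 : ℝ))) (F' := F' k)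
        (fun s => ?_) (hF'c k) (C := 2) (fun s => ?_) (fun s => (hF'1 k s).trans one_le_two)
        η hη hηc hηs
      · refine (((hasDerivAt_mul_const (k + 1 : ℝ)).arctan).const_mul (1 / (k + 1 : ℝ))).congr_deriv ?_
        simp only [hF']
        field_simp
      · rw [abs_mul, abs_of_pos (by positivity : 0 < 1 / (k + 1 : ℝ))]
        have h1 := Real.arctan_lt_pi_div_two (s * (k + 1 : ℝ))
        have h2 := Real.neg_pi_div_two_lt_arctan (s * (k + 1 : ℝ))
        have h3 := Real.pi_lt_four
        have h4 : |Real.arctan (s * (k + 1 : ℝ))| ≤ 2 := abs_le.2 ⟨by linarith, by linarith⟩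
        have h5 : 1 / (k + 1 : ℝ) ≤ 1 := by
          rw [div_le_one hk]
          linarith [Nat.cast_nonneg (α := ℝ) k]
        nlinarith [abs_nonneg (Real.arctan (s * (k + 1 : ℝ)))]
    have hη' : Integrable fun x => fderiv ℝ η x (stdVec j) :=
      (continuous_fderiv_stdVec hη j).integrable_of_hasCompactSupport
        (hasCompactSupport_fderiv_stdVec hηc j)
    have hlim1 : Tendsto (fun k : ℕ => ∫ x in Ω,
        (1 / (k + 1 : ℝ) * Real.arctan (w x * (k + 1 : ℝ))) * fderiv ℝ η x (stdVec j)) atTop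
        (𝓝 0) := by
      have h1 := (tendsto_one_div_add_atTop_nhds_zero_nat (𝕜 := ℝ)).mul_const
        (2 * ∫ x in Ω, |fderiv ℝ η x (stdVec j)|)
      rw [zero_mul] at h1
      refine squeeze_zero_norm (fun k => ?_) h1
      rw [← mul_assoc, ← integral_const_mul]
      refine norm_integral_le_of_norm_le (hη'.integrableOn.abs.const_mul _)
        (Eventually.of_forall fun x => ?_)
      rw [norm_mul, norm_mul, Real.norm_of_nonneg (by positivity : 0 ≤ 1 / (k + 1 : ℝ))]
      have h1 := Real.arctan_lt_pi_div_two (w x * (k + 1 : ℝ))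
      have h2 := Real.neg_pi_div_two_lt_arctan (w x * (k + 1 : ℝ))
      have h3 := Real.pi_lt_four
      have h4 : ‖Real.arctan (w x * (k + 1 : ℝ))‖ ≤ 2 := abs_le.2 ⟨by linarith, by linarith⟩
      gcongr
      exact le_rfl
    have hlim2 : Tendsto (fun k : ℕ => ∫ x in Ω, F' k (w x) * h x * η x) atTop
        (𝓝 (∫ x in Ω, z x * η x)) := by
      refine tendsto_integral_of_dominated_convergence (fun x => |h x| * M)
        (fun k => (hmeas k).mul hη.continuous.aestronglyMeasurable) (hhi.abs.mul_const M)
        (fun k => Eventually.of_forall fun x => ?_)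
        (Eventually.of_forall fun x => (hzlim x).mul_const _)
      rw [norm_mul, norm_mul]
      have h1 := hF'1 k (w x)
      have h2 := hM x
      calc ‖F' k (w x)‖ * ‖h x‖ * ‖η x‖ ≤ 1 * ‖h x‖ * M := by
            gcongr
            exact h1
        _ = |h x| * M := by rw [one_mul]; rfl
    have h0 : ∫ x in Ω, z x * η x = 0 := by
      have h1 := tendsto_nhds_unique (hlim1.congr hweak) hlim2.neg
      linarith
    rw [← h0, setIntegral_eq_integral_of_tsupport hηs fun x hx => by simp [hx]]
    simp only [smul_eq_mul, mul_comm]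
  rw [ae_restrict_iff' hΩ.measurableSet]
  filter_upwards [hkey] with x hx hxΩ hwx
  have := hx hxΩ
  simpa [hz, hwx] using this

/-- The weak derivative of the square of a Sobolev function. -/
theorem HasWeakPartialDeriv.sq (hΩ : IsOpen Ω) (hfin : volume Ω < ⊤) {u g : Eu n → ℝ}
    (hu : MemLp u 2 (volume.restrict Ω)) (hg : MemLp g 2 (volume.restrict Ω))
    (hug : HasWeakPartialDeriv Ω j u g) :
    HasWeakPartialDeriv Ω j (fun x => u x ^ 2) fun x => 2 * u x * g x := by
  have : IsFiniteMeasure (volume.restrict Ω) := ⟨by simpa using hfin⟩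
  intro η hη hηc hηs
  obtain ⟨M, hM⟩ := hη.continuous.bounded_above_of_compact_support hηc
  obtain ⟨M', hM'⟩ := (continuous_fderiv_stdVec hη j).bounded_above_of_compact_support
    (hasCompactSupport_fderiv_stdVec hηc j)
  set a : ℕ → ℝ := fun k => 1 / (k + 1 : ℝ) with ha
  have ha0 : ∀ k, 0 < a k := fun k => by simp only [ha]; positivity
  have halim : Tendsto a atTop (𝓝 0) := tendsto_one_div_add_atTop_nhds_zero_nat
  -- The square is replaced by s²/(1 + (as)²), which is bounded by 1/a² and whose derivative is
  -- bounded by 1/a, so that the chain rule applies. As a → 0 the integrands are dominated by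
  -- multiples of u² and |u g|.
  have hweak : ∀ k : ℕ, ∫ x in Ω, (u x ^ 2 / (1 + (a k * u x) ^ 2)) * fderiv ℝ η x (stdVec j) =
      - ∫ x in Ω, (2 * u x / (1 + (a k * u x) ^ 2) ^ 2) * g x * η x := by
    intro k
    refine HasWeakPartialDeriv.comp hΩ (hu.integrable one_le_two) (hg.integrable one_le_two) hug
      (F := fun s => s ^ 2 / (1 + (a k * s) ^ 2)) (F' := fun s => 2 * s / (1 + (a k * s) ^ 2) ^ 2)
      (fun s => ?_) ?_ (C := 1 / a k + 1 / a k ^ 2) (fun s => ?_) (fun s => ?_) η hη hηc hηs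
    · have h1 : HasDerivAt (fun s : ℝ => 1 + (a k * s) ^ 2) (2 * a k ^ 2 * s) s := by
        refine ((((hasDerivAt_id s).const_mul (a k)).pow 2).const_add 1).congr_deriv ?_
        simp
        ring
      refine ((hasDerivAt_pow 2 s).div h1 (by positivity)).congr_deriv ?_
      rw [div_left_inj' (by positivity)]
      simp
      ring
    · exact Continuous.div (by fun_prop) (by fun_prop) fun s => by positivity
    · have h1 : s ^ 2 / (1 + (a k * s) ^ 2) ≤ 1 / a k ^ 2 := by
        rw [div_le_div_iff₀ (by positivity) (pow_pos (ha0 k) 2)]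
        nlinarith
      rw [abs_of_nonneg (by positivity)]
      have := one_div_pos.2 (ha0 k)
      linarith
    · have h1 : |2 * s / (1 + (a k * s) ^ 2) ^ 2| ≤ 1 / a k := by
        rw [abs_div, abs_of_pos (by positivity : 0 < (1 + (a k * s) ^ 2) ^ 2),
          div_le_div_iff₀ (by positivity) (ha0 k), abs_mul, abs_two]
        have h2 : (a k * s) ^ 2 = (a k * |s|) ^ 2 := by rw [mul_pow, mul_pow, sq_abs]
        rw [h2]
        nlinarith [sq_nonneg (a k * |s| - 1), sq_nonneg (a k * |s|), sq_nonneg ((a k * |s|) ^ 2)]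
      have := one_div_pos.2 (pow_pos (ha0 k) 2)
      linarith
  have hc1 : ∀ s k, 1 ≤ 1 + (a k * s) ^ 2 := fun s k => by nlinarith [sq_nonneg (a k * s)]
  have hsc : ∀ s : ℝ, Tendsto (fun k => 1 + (a k * s) ^ 2) atTop (𝓝 1) := fun s => by
    have := (((halim.mul_const s).pow 2).const_add 1)
    simpa using this
  have hu2 : IntegrableOn (fun x => u x ^ 2) Ω := hu.integrable_sq
  have hug2 : IntegrableOn (fun x => u x * g x) Ω := hu.integrable_mul hg
  have hum := hu.aestronglyMeasurable
  have hlim1 : Tendsto (fun k => ∫ x in Ω, (u x ^ 2 / (1 + (a k * u x) ^ 2)) *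
      fderiv ℝ η x (stdVec j)) atTop (𝓝 (∫ x in Ω, u x ^ 2 * fderiv ℝ η x (stdVec j))) := by
    refine tendsto_integral_of_dominated_convergence (fun x => u x ^ 2 * M') (fun k => ?_)
      (hu2.mul_const _) (fun k => Eventually.of_forall fun x => ?_)
      (Eventually.of_forall fun x => ?_)
    · refine AEStronglyMeasurable.mul ?_ (continuous_fderiv_stdVec hη j).aestronglyMeasurable
      exact (Continuous.div (by fun_prop) (by fun_prop) fun s => by positivity :
        Continuous fun s : ℝ => s ^ 2 / (1 + (a k * s) ^ 2)).comp_aestronglyMeasurable hum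
    · rw [norm_mul, Real.norm_of_nonneg (by positivity)]
      gcongr
      · exact div_le_self (sq_nonneg _) (hc1 _ _)
      · exact hM' x
    · have := (tendsto_const_nhds (x := u x ^ 2)).div (hsc (u x)) one_ne_zero
      rw [div_one] at this
      exact this.mul_const _
  have hlim2 : Tendsto (fun k => ∫ x in Ω, (2 * u x / (1 + (a k * u x) ^ 2) ^ 2) * g x * η x) atTop
      (𝓝 (∫ x in Ω, 2 * u x * g x * η x)) := by
    refine tendsto_integral_of_dominated_convergence (fun x => 2 * |u x * g x| * M) (fun k => ?_)
      ((hug2.abs.const_mul 2).mul_const _) (fun k => Eventually.of_forall fun x => ?_)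
      (Eventually.of_forall fun x => ?_)
    · refine (AEStronglyMeasurable.mul ?_ hg.aestronglyMeasurable).mul
        hη.continuous.aestronglyMeasurable
      exact (Continuous.div (by fun_prop) (by fun_prop) fun s => by positivity :
        Continuous fun s : ℝ => 2 * s / (1 + (a k * s) ^ 2) ^ 2).comp_aestronglyMeasurable hum
    · rw [norm_mul, norm_mul, norm_div, norm_mul, Real.norm_ofNat, Real.norm_of_nonneg
        (by positivity : 0 ≤ (1 + (a k * u x) ^ 2) ^ 2), abs_mul, ← mul_assoc]
      gcongr
      · exact div_le_self (by positivity) (one_le_pow₀ (hc1 _ _))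
      · exact le_rfl
      · exact hM x
    · have := (tendsto_const_nhds (x := 2 * u x)).div ((hsc (u x)).pow 2) (by norm_num)
      rw [one_pow, div_one] at this
      exact (this.mul_const _).mul_const _
  exact tendsto_nhds_unique (hlim1.congr hweak) hlim2.neg

/-- The almost everywhere derivative of a Lipschitz function is its weak derivative. -/
theorem hasWeakPartialDeriv_of_lipschitzWith (Ω : Set (Eu n)) {v : Eu n → ℝ} {K : NNReal}
    (hv : LipschitzWith K v) (j : Fin n) :
    HasWeakPartialDeriv Ω j v fun x => lineDeriv ℝ v x (stdVec j) := by
  rw [hasWeakPartialDeriv_iff_indicator]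
  intro η hη hηc _
  obtain ⟨D, hD⟩ := ContDiff.lipschitzWith_of_hasCompactSupport hηc hη (by simp)
  rw [hv.integral_lineDeriv_mul_eq hD hηc, ← integral_neg]
  congr 1
  funext x
  rw [lineDeriv_neg, (hη.differentiable (by simp) x).lineDeriv_eq_fderiv]
  ring

theorem HasWeakPartialDeriv.sub {u v g h : Eu n → ℝ} (hu : HasWeakPartialDeriv Ω j u g)
    (hv : HasWeakPartialDeriv Ω j v h) (hui : IntegrableOn u Ω) (hvi : IntegrableOn v Ω)
    (hgi : IntegrableOn g Ω) (hhi : IntegrableOn h Ω) :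
    HasWeakPartialDeriv Ω j (fun x => u x - v x) fun x => g x - h x := by
  intro η hη hηc hηs
  obtain ⟨M, hM⟩ := hη.continuous.bounded_above_of_compact_support hηc
  obtain ⟨M', hM'⟩ := (continuous_fderiv_stdVec hη j).bounded_above_of_compact_support
    (hasCompactSupport_fderiv_stdVec hηc j)
  have hc := continuous_fderiv_stdVec hη j
  simp only [sub_mul]
  rw [integral_sub (integrableOn_mul_of_bounded hui hc hM')
      (integrableOn_mul_of_bounded hvi hc hM'),
    integral_sub (integrableOn_mul_of_bounded hgi hη.continuous hM)
      (integrableOn_mul_of_bounded hhi hη.continuous hM), hu η hη hηc hηs, hv η hη hηc hηs]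
  ring

end ChainRuleConsequences

/-! ### Weak derivatives of |f|² in terms of approximate differentials. -/

section Identification

variable {n Q m : ℕ} {Ω : Set (Eu n)}

/-- On a set where it is Lipschitz, a Sobolev function is approximately differentiable almost
everywhere, and the approximate differential is given by the weak derivatives. -/
theorem ae_hasFDerivWithinAt_of_lipschitzOnWith (hΩ : IsOpen Ω) (hb : Bornology.IsBounded Ω)
    {u : Eu n → ℝ} {g : Fin n → Eu n → ℝ} (hu : IntegrableOn u Ω)
    (hg : ∀ j, IntegrableOn (g j) Ω) (hug : ∀ j, HasWeakPartialDeriv Ω j u (g j))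
    {A : Set (Eu n)} (hA : MeasurableSet A) (hAΩ : A ⊆ Ω) {K : NNReal}
    (hlip : LipschitzOnWith K u A) :
    ∀ᵐ x ∂(volume.restrict A), x ∈ A ∧ HasDensityOne A x ∧
      ∃ ℓ : Eu n →L[ℝ] ℝ, HasFDerivWithinAt u ℓ A x ∧ ∀ j, g j x = ℓ (stdVec j) := by
  have hfin : IsFiniteMeasure (volume.restrict Ω) := ⟨by simpa using hb.measure_lt_top⟩
  obtain ⟨v, hv, huv⟩ := hlip.extend_real
  have hvi : IntegrableOn v Ω :=
    (hv.continuous.continuousOn.integrableOn_compact hb.isCompact_closure).mono_set subset_closure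
  have hvd : ∀ j, IntegrableOn (fun x => lineDeriv ℝ v x (stdVec j)) Ω := fun j =>
    ((hv.memLp_lineDeriv (stdVec j)).restrict Ω).integrable le_top
  -- The difference `u - v` vanishes on `A`, so its weak derivative does too almost everywhere
  -- there, and `g` inherits the classical derivative of the Lipschitz extension.
  have h1 : ∀ᵐ x ∂(volume.restrict Ω), ∀ j, u x - v x = 0 →
      g j x - lineDeriv ℝ v x (stdVec j) = 0 := ae_all_iff.2 fun j =>
    ((hug j).sub (hasWeakPartialDeriv_of_lipschitzWith Ω hv j) hu hvi (hg j) (hvd j)).ae_eq_zero hΩ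
      (hu.sub hvi) ((hg j).sub (hvd j))
  filter_upwards [ae_restrict_of_ae_restrict_of_subset hAΩ h1, ae_restrict_mem hA,
    ae_hasDensityOne A, ae_restrict_of_ae hv.ae_differentiableAt] with x hx hxA hden hdx
  refine ⟨hxA, hden, fderiv ℝ v x, ?_, fun j => ?_⟩
  · exact hdx.hasFDerivAt.hasFDerivWithinAt.congr (fun y hy => huv hy) (huv hxA)
  · rw [← hdx.lineDeriv_eq_fderiv]
    exact sub_eq_zero.1 (hx j (sub_eq_zero.2 (huv hxA)))

theorem abs_dG_zeroTuple_sub_le (T S : AQ Q m) :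
    |dG T (zeroTuple Q m) - dG S (zeroTuple Q m)| ≤ dG T S := abs_dG_sub_le T S _

/-- The derivative of `|f|²` in terms of the first order jet of `f`. -/
theorem IsApproxJet.two_mul_eq {f : Eu n → AQ Q m} {x : Eu n} {J : Fin Q → Eu m × (Eu n →L[ℝ] Eu m)}
    (hJ : IsApproxJet f x J) {A : Set (Eu n)} (hA : HasDensityOne A x) {ℓ : Eu n →L[ℝ] ℝ}
    (hℓ : HasFDerivWithinAt (fun y => dG (f y) (zeroTuple Q m)) ℓ A x) (v : Eu n) :
    2 * dG (f x) (zeroTuple Q m) * ℓ v = 2 * ∑ i, inner ℝ (J i).1 ((J i).2 v) := by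
  obtain ⟨S, hSm, hxS, hS, happrox⟩ := hJ.approx
  have hden : HasDensityOne (S ∩ A) x := hS.inter hA hSm
  set u : Eu n → ℝ := fun y => dG (f y) (zeroTuple Q m) with hu
  set T : Eu n → AQ Q m := fun y => ofPoints fun i => (J i).1 + (J i).2 (y - x) with hT
  set N : Eu n → ℝ := fun y => dG (T y) (zeroTuple Q m) with hN
  have hNsq : ∀ y, N y ^ 2 = ∑ i, ‖(J i).1 + (J i).2 (y - x)‖ ^ 2 := fun y => by
    rw [hN, dG_zeroTuple_sq, hT, normSq_ofPoints]
  have hTx : T x = f x := by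
    rw [← hJ.value, hT]
    simp
  -- Squares are used because `N ^ 2` is polynomial in `y`, whereas `N` may fail to be
  -- differentiable where it vanishes.
  have hP : HasFDerivAt (fun y => N y ^ 2)
      (∑ i, 2 • (innerSL ℝ (J i).1).comp (J i).2) x := by
    simp only [hNsq]
    refine HasFDerivAt.fun_sum fun i _ => ?_
    have h1 : HasFDerivAt (fun y => (J i).1 + (J i).2 (y - x)) (J i).2 x :=
      ((J i).2.hasFDerivAt.comp x ((hasFDerivAt_id x).sub_const x)).const_add _
    have h2 := h1.norm_sq
    simpa using h2
  have hNc : ContinuousAt N x := by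
    have h1 : N = fun y => Real.sqrt (N y ^ 2) := funext fun y => (Real.sqrt_sq (dG_nonneg _ _)).symm
    rw [h1]
    exact hP.continuousAt.sqrt
  have hu2 : HasFDerivWithinAt (fun y => u y ^ 2) ((2 * u x) • ℓ) (S ∩ A) x := by
    have := (hℓ.mono (Set.inter_subset_right (s := S))).pow 2
    simpa using this
  have hdiff : (fun y => u y - N y) =o[𝓝[S ∩ A] x] fun y => y - x := by
    refine IsBigO.trans_isLittleO (IsBigO.of_bound 1 (Eventually.of_forall fun y => ?_))
      (happrox.mono (nhdsWithin_mono x Set.inter_subset_left))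
    rw [one_mul, Real.norm_of_nonneg (dG_nonneg _ _)]
    exact abs_dG_zeroTuple_sub_le _ _
  have hsum : (fun y => u y + N y) =O[𝓝[S ∩ A] x] fun _ => (1 : ℝ) := by
    have h1 : ContinuousWithinAt u (S ∩ A) x :=
      (hℓ.mono (Set.inter_subset_right (s := S))).continuousWithinAt
    exact (h1.add hNc.continuousWithinAt).tendsto.isBigO_one ℝ
  -- The factor u - N is o(|y - x|) by the jet expansion and u + N is bounded. So u² and N² have the
  -- same first order expansion along a set of density one, which determines the linear part.
  have hprod : (fun y => u y ^ 2 - N y ^ 2) =o[𝓝[S ∩ A] x] fun y => y - x := by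
    have h2 : (fun y => u y ^ 2 - N y ^ 2) = fun y => (u y - N y) * (u y + N y) := by
      funext y; ring
    rw [h2]
    refine (hdiff.norm_right.mul_isBigO hsum).congr_right (fun y => mul_one _) |>.of_norm_right
  have hux : u x = N x := by simp only [hu, hN, hTx]
  have hlin := hu2.sub (hP.hasFDerivWithinAt (s := S ∩ A))
  rw [hasFDerivWithinAt_iff_isLittleO] at hlin
  have hzero := hden.eq_zero_of_isLittleO
    ((2 * u x) • ℓ - ∑ i, 2 • (innerSL ℝ (J i).1).comp (J i).2) (by
      refine (hprod.sub hlin).congr_left fun y => ?_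
      simp only [Pi.sub_apply, hux]
      ring)
  have h3 := congrArg (fun L : Eu n →L[ℝ] ℝ => L v) hzero
  have h4 : 2 * u x * ℓ v - ∑ i, 2 * inner ℝ (J i).1 ((J i).2 v) = 0 := by
    simpa using h3
  rw [← Finset.mul_sum] at h4
  linarith

/-- The radial weak derivatives of `|f|²` are given by the approximate differentials of `f`. -/
theorem MemW12.exists_weakDeriv_normSq {f : Eu n → AQ Q m} (hf : MemW12 Ω f) (hΩ : IsOpen Ω)
    (hb : Bornology.IsBounded Ω) :
    (∀ᵐ x ∂(volume.restrict Ω), IsApproxJet f x (jet f x)) ∧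
    IntegrableOn (fun x => normSq (f x)) Ω ∧ ∃ G : Fin n → Eu n → ℝ, ∀ j,
      IntegrableOn (G j) Ω ∧ HasWeakPartialDeriv Ω j (fun x => normSq (f x)) (G j) ∧
        ∀ᵐ x ∂(volume.restrict Ω),
          G j x = 2 * ∑ i, inner ℝ (val f x i) (D f x i (stdVec j)) := by
  have hfin : volume Ω < ⊤ := hb.measure_lt_top
  have : IsFiniteMeasure (volume.restrict Ω) := ⟨by simpa using hfin⟩
  obtain ⟨E, hEm, hEΩ, hEcov, hElip⟩ := hf.exists_lipschitz_pieces hΩ hfin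
  have hcover : ∀ {p : Eu n → Prop}, (∀ k, ∀ᵐ x ∂(volume.restrict (E k)), p x) →
      ∀ᵐ x ∂(volume.restrict Ω), p x := by
    intro p hp
    have h1 : ∀ k, ∀ᵐ x, x ∈ E k → p x := fun k => (ae_restrict_iff' (hEm k)).1 (hp k)
    filter_upwards [hEcov, ae_restrict_of_ae (ae_all_iff.2 h1)] with x ⟨k, hk⟩ hx
    exact hx k hk
  have hjet : ∀ᵐ x ∂(volume.restrict Ω), IsApproxJet f x (jet f x) := by
    have h1 := hcover fun k => ae_exists_jet_of_isLocallyLipschitzOn (hEm k) (hElip k)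
    filter_upwards [h1] with x hx
    rw [jet, dif_pos hx]
    exact hx.choose_spec
  obtain ⟨φ, hφ, hT⟩ := hf
  obtain ⟨hu, g, hg⟩ := hT (zeroTuple Q m)
  refine ⟨hjet, ?_, fun j x => 2 * dG (f x) (zeroTuple Q m) * g j x, fun j => ⟨?_, ?_, ?_⟩⟩
  · simp only [← dG_zeroTuple_sq]
    exact hu.integrable_sq
  · simp only [mul_assoc]
    exact (hu.integrable_mul (hg j).1).const_mul 2
  · simp only [← dG_zeroTuple_sq]
    exact (hg j).2.1.sq hΩ hfin hu (hg j).1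
  -- On each Lipschitz piece, cut further into balls of radius δ/2, the scalar function is honestly
  -- Lipschitz and its weak gradient is an approximate differential.
  · have hid : ∀ᵐ x ∂(volume.restrict Ω), ∃ A : Set (Eu n), HasDensityOne A x ∧
        ∃ ℓ : Eu n →L[ℝ] ℝ, HasFDerivWithinAt (fun y => dG (f y) (zeroTuple Q m)) ℓ A x ∧
          ∀ j, g j x = ℓ (stdVec j) := by
      refine hcover fun k => ?_
      obtain ⟨L, δ, hL, hδ, hlip⟩ := hElip k
      set b : ℕ → Eu n := TopologicalSpace.denseSeq (Eu n)
      have hcov : E k ⊆ ⋃ l, E k ∩ Metric.ball (b l) (δ / 2) := by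
        intro x hx
        obtain ⟨l, hl⟩ :=
          (TopologicalSpace.denseRange_denseSeq (Eu n)).exists_dist_lt x (half_pos hδ)
        exact Set.mem_iUnion.2 ⟨l, hx, hl⟩
      refine ae_restrict_of_ae_restrict_of_subset hcov ?_
      rw [ae_restrict_iUnion_iff]
      intro l
      have hlip' : LipschitzOnWith ⟨L, hL⟩ (fun y => dG (f y) (zeroTuple Q m))
          (E k ∩ Metric.ball (b l) (δ / 2)) := by
        refine LipschitzOnWith.of_dist_le_mul fun x hx y hy => ?_
        rw [dist_eq_norm, dist_eq_norm]
        refine (abs_dG_zeroTuple_sub_le _ _).trans (hlip x hx.1 y hy.1 ?_)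
        rw [← dist_eq_norm]
        have h1 := Metric.mem_ball.1 hx.2
        have h2 := Metric.mem_ball.1 hy.2
        linarith [dist_triangle_right x y (b l)]
      filter_upwards [ae_hasFDerivWithinAt_of_lipschitzOnWith hΩ hb (hu.integrable one_le_two)
        (fun j => (hg j).1.integrable one_le_two) (fun j => (hg j).2.1)
        ((hEm k).inter measurableSet_ball) (Set.inter_subset_left.trans (hEΩ k)) hlip'] with x hx
      exact ⟨_, hx.2⟩
    filter_upwards [hjet, hid] with x hx hid
    obtain ⟨A, hA, ℓ, hℓ, hgℓ⟩ := hid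
    rw [hgℓ j]
    exact hx.two_mul_eq hA hℓ (stdVec j)

end Identification

/-! ### Radial test functions. -/

section RadialProfiles

variable {n : ℕ}

/-- A smooth function of `|y - x₀|²` which vanishes near the boundary of the ball of radius `R`. -/
structure IsRadialProfile (R : ℝ) (θ : ℝ → ℝ) : Prop where
  smooth : ContDiff ℝ ∞ θ
  vanish : ∃ b : ℝ, 0 < b ∧ b < R ^ 2 ∧ ∀ t, b ≤ t → θ t = 0

theorem IsRadialProfile.derivative {R : ℝ} {θ : ℝ → ℝ} (h : IsRadialProfile R θ) :
    IsRadialProfile R (deriv θ) := by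
  obtain ⟨b, hb0, hbR, hb⟩ := h.vanish
  refine ⟨(contDiff_infty_iff_deriv.1 h.smooth).2, (b + R ^ 2) / 2, by nlinarith, by linarith,
    fun t ht => ?_⟩
  have h1 : θ =ᶠ[𝓝 t] fun _ => 0 := by
    filter_upwards [lt_mem_nhds (show b < t by linarith)] with s hs
    exact hb s hs.le
  rw [h1.deriv_eq, deriv_const]

theorem IsRadialProfile.linear {R : ℝ} {θ η : ℝ → ℝ} (h : IsRadialProfile R θ)
    (h' : IsRadialProfile R η) (a c : ℝ) : IsRadialProfile R fun t => a * θ t + c * (t * η t) := by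
  obtain ⟨b, hb0, hbR, hb⟩ := h.vanish
  obtain ⟨b', hb0', hbR', hb'⟩ := h'.vanish
  have h1 := h.smooth
  have h2 := h'.smooth
  refine ⟨by fun_prop, max b b', lt_max_of_lt_left hb0, max_lt hbR hbR', fun t ht => ?_⟩
  rw [hb t ((le_max_left _ _).trans ht), hb' t ((le_max_right _ _).trans ht)]
  ring

/-- Integrating from the point beyond which `w` vanishes keeps the antiderivative zero there. It
lets the weight in front of the radial energy be prescribed. -/
theorem IsRadialProfile.exists_antideriv {R : ℝ} {w : ℝ → ℝ} (h : IsRadialProfile R w) :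
    ∃ θ, IsRadialProfile R θ ∧ ∀ t, HasDerivAt θ (w t) t := by
  obtain ⟨b, hb0, hbR, hb⟩ := h.vanish
  have hd : ∀ t, HasDerivAt (fun t => ∫ s in b..t, w s) (w t) t := fun t =>
    intervalIntegral.integral_hasDerivAt_right (h.smooth.continuous.intervalIntegrable _ _)
      h.smooth.continuous.stronglyMeasurable.stronglyMeasurableAtFilter
      h.smooth.continuous.continuousAt
  refine ⟨_, ⟨contDiff_infty_iff_deriv.2 ⟨fun t => (hd t).differentiableAt, ?_⟩, b, hb0, hbR,
    fun t ht => ?_⟩, hd⟩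
  · rw [show deriv (fun t => ∫ s in b..t, w s) = w from funext fun t => (hd t).deriv]
    exact h.smooth
  · rw [intervalIntegral.integral_congr (g := fun _ => 0), intervalIntegral.integral_zero]
    intro s hs
    rw [Set.uIcc_of_le ht] at hs
    exact hb s hs.1

variable {R : ℝ} {θ : ℝ → ℝ} (x₀ : Eu n)

/-- The support of a radial test function. -/
theorem IsRadialProfile.exists_compact (h : IsRadialProfile R θ) (hR : 0 < R) :
    ∃ K : Set (Eu n), IsCompact K ∧ K ⊆ Metric.ball x₀ R ∧
      ∀ y, y ∉ K → θ (‖y - x₀‖ ^ 2) = 0 := by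
  obtain ⟨b, hb0, hbR, hb⟩ := h.vanish
  refine ⟨Metric.closedBall x₀ (Real.sqrt b), isCompact_closedBall _ _,
    Metric.closedBall_subset_ball ((Real.sqrt_lt' hR).2 hbR), fun y hy => hb _ ?_⟩
  rw [Metric.mem_closedBall, dist_eq_norm, not_le] at hy
  exact ((Real.sqrt_lt' ((Real.sqrt_nonneg _).trans_lt hy)).1 hy).le

theorem hasCompactSupport_and_tsupport_of_compact {F : Type*} [Zero F] {K U : Set (Eu n)}
    (hK : IsCompact K) (hKU : K ⊆ U) {η : Eu n → F} (h : ∀ y, y ∉ K → η y = 0) :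
    HasCompactSupport η ∧ tsupport η ⊆ U := by
  have h1 : tsupport η ⊆ K := closure_minimal (fun y hy => by
    by_contra hc
    exact hy (h y hc)) hK.isClosed
  exact ⟨hK.of_isClosed_subset (isClosed_tsupport _) h1, h1.trans hKU⟩

theorem IsRadialProfile.contDiff_radial (h : IsRadialProfile R θ) :
    ContDiff ℝ ∞ fun y : Eu n => θ (‖y - x₀‖ ^ 2) :=
  h.smooth.comp ((contDiff_id.sub contDiff_const).norm_sq ℝ)

theorem IsRadialProfile.hasFDerivAt_radial (h : IsRadialProfile R θ) (y : Eu n) :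
    HasFDerivAt (fun y : Eu n => θ (‖y - x₀‖ ^ 2))
      ((2 * deriv θ (‖y - x₀‖ ^ 2)) • innerSL ℝ (y - x₀)) y := by
  have h1 : HasFDerivAt (fun y : Eu n => ‖y - x₀‖ ^ 2) (2 • innerSL ℝ (y - x₀)) y := by
    have := ((hasFDerivAt_id y).sub_const x₀).norm_sq
    simpa using this
  have h2 := ((h.smooth.differentiable (by simp)) (‖y - x₀‖ ^ 2)).hasDerivAt.comp_hasFDerivAt y h1
  refine h2.congr_fderiv ?_
  ext v
  simp
  ring

theorem inner_stdVec (z : Eu n) (j : Fin n) : inner ℝ z (stdVec j) = z j := by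
  simp [stdVec, EuclideanSpace.inner_single_right]

theorem map_eq_sum_stdVec {F : Type*} [NormedAddCommGroup F] [NormedSpace ℝ F]
    (L : Eu n →L[ℝ] F) (z : Eu n) : L z = ∑ j, z j • L (stdVec j) := by
  conv_lhs => rw [← sum_smul_stdVec z, map_sum]
  simp only [map_smul]

theorem sum_coord_sq (z : Eu n) : ∑ j, z j * z j = ‖z‖ ^ 2 := by
  rw [EuclideanSpace.norm_sq_eq]
  simp [sq]

end RadialProfiles

/-! ### Outer and inner variations along radial fields. -/

section Variations

variable {n Q m : ℕ}

/-- `|Df|²`. -/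
noncomputable def energy (f : Eu n → AQ Q m) (y : Eu n) : ℝ := ∑ i, hs (D f y i) (D f y i)

/-- `∑ ⟨fᵢ, Dfᵢ (y - x₀)⟩`. -/
noncomputable def radialPairing (f : Eu n → AQ Q m) (x₀ y : Eu n) : ℝ :=
  ∑ i, inner ℝ (val f y i) (D f y i (y - x₀))

/-- `∑ |Dfᵢ (y - x₀)|²`. -/
noncomputable def radialEnergy (f : Eu n → AQ Q m) (x₀ y : Eu n) : ℝ :=
  ∑ i, ‖D f y i (y - x₀)‖ ^ 2

variable {Ω : Set (Eu n)} {f : Eu n → AQ Q m} {x₀ : Eu n} {R : ℝ} {θ : ℝ → ℝ}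

theorem fderiv_const_smul_id (c : ℝ) (v : Eu m) :
    fderiv ℝ (fun v : Eu m => c • v) v = c • ContinuousLinearMap.id ℝ (Eu m) :=
  ((hasFDerivAt_id (𝕜 := ℝ) v).const_smul c).fderiv

theorem outerIntegrand_radial (h : IsRadialProfile R θ) (y : Eu n) :
    outerIntegrand f (fun y v => θ (‖y - x₀‖ ^ 2) • v) y =
      θ (‖y - x₀‖ ^ 2) * energy f y +
        2 * deriv θ (‖y - x₀‖ ^ 2) * radialPairing f x₀ y := by
  have h1 : ∀ i, hs (D f y i) (fderiv ℝ (fun y' => θ (‖y' - x₀‖ ^ 2) • val f y i) y) =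
      2 * deriv θ (‖y - x₀‖ ^ 2) * inner ℝ (val f y i) (D f y i (y - x₀)) := by
    intro i
    rw [((h.hasFDerivAt_radial x₀ y).smul_const (val f y i)).fderiv, hs,
      map_eq_sum_stdVec (D f y i) (y - x₀), inner_sum, Finset.mul_sum]
    refine Finset.sum_congr rfl fun j _ => ?_
    simp only [ContinuousLinearMap.smulRight_apply, inner_smul_right]
    change (2 * deriv θ (‖y - x₀‖ ^ 2) * inner ℝ (y - x₀) (stdVec j)) * _ = _
    rw [inner_stdVec, real_inner_comm]
    ring
  have h2 : ∀ i, hs (D f y i) ((fderiv ℝ (fun v : Eu m => θ (‖y - x₀‖ ^ 2) • v)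
      (val f y i)).comp (D f y i)) = θ (‖y - x₀‖ ^ 2) * hs (D f y i) (D f y i) := by
    intro i
    rw [fderiv_const_smul_id, hs, hs, Finset.mul_sum]
    refine Finset.sum_congr rfl fun j _ => ?_
    exact inner_smul_right _ _ _
  simp only [outerIntegrand, h1, h2]
  rw [Finset.sum_add_distrib, ← Finset.mul_sum, ← Finset.mul_sum, add_comm]
  rfl

theorem isOuterTest_radial (h : IsRadialProfile R θ) (hR : 0 < R) (hsub : Metric.ball x₀ R ⊆ Ω) :
    IsOuterTest Ω (fun (y : Eu n) (v : Eu m) => θ (‖y - x₀‖ ^ 2) • v) := by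
  obtain ⟨K, hK, hKR, hK0⟩ := h.exists_compact x₀ hR
  have hφ := h.contDiff_radial x₀
  have hφc := (hasCompactSupport_and_tsupport_of_compact hK hKR hK0).1
  refine ⟨(hφ.comp contDiff_fst).smul contDiff_snd, ⟨K, hK, hKR.trans hsub, fun y hy v => ?_⟩, ?_⟩
  · rw [hK0 y hy, zero_smul]
  · obtain ⟨C₁, hC₁⟩ := hφ.continuous.bounded_above_of_compact_support hφc
    obtain ⟨C₂, hC₂⟩ := (hφ.continuous_fderiv (by simp)).bounded_above_of_compact_support
      (hφc.fderiv ℝ)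
    have hC₁0 : 0 ≤ C₁ := (norm_nonneg _).trans (hC₁ 0)
    have hC₂0 : 0 ≤ C₂ := (norm_nonneg _).trans (hC₂ 0)
    refine ⟨C₁ + C₂, fun y v => ⟨?_, ?_⟩⟩
    · rw [fderiv_const_smul_id, norm_smul]
      calc ‖θ (‖y - x₀‖ ^ 2)‖ * ‖ContinuousLinearMap.id ℝ (Eu m)‖ ≤ C₁ * 1 := by
            gcongr
            exacts [hC₁ y, ContinuousLinearMap.norm_id_le]
        _ ≤ C₁ + C₂ := by linarith
    · have h1 : HasFDerivAt (fun y : Eu n => θ (‖y - x₀‖ ^ 2) • v)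
          ((fderiv ℝ (fun y : Eu n => θ (‖y - x₀‖ ^ 2)) y).smulRight v) y :=
        ((hφ.differentiable (by simp)) y).hasFDerivAt.smul_const v
      rw [h1.fderiv, norm_smul, ContinuousLinearMap.norm_smulRight_apply]
      calc _ ≤ C₁ * ‖v‖ + C₂ * ‖v‖ := by
            gcongr
            exacts [hC₁ y, hC₂ y]
        _ ≤ (C₁ + C₂) * (1 + ‖v‖) := by nlinarith [norm_nonneg v]

/-- With z = y - x₀ the field has differential θ·Id + 2θ' z ⊗ z. The rank-one part produces the
radial energy, and the divergence is nθ + 2tθ'. -/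
theorem innerIntegrand_radial (h : IsRadialProfile R θ) (y : Eu n) :
    innerIntegrand f (fun y => θ (‖y - x₀‖ ^ 2) • (y - x₀)) y =
      ((2 - n) * θ (‖y - x₀‖ ^ 2) +
        (-2) * (‖y - x₀‖ ^ 2 * deriv θ (‖y - x₀‖ ^ 2))) * energy f y +
        4 * deriv θ (‖y - x₀‖ ^ 2) * radialEnergy f x₀ y := by
  set t := ‖y - x₀‖ ^ 2 with ht
  set z := y - x₀ with hz
  have hX : ∀ v, fderiv ℝ (fun y : Eu n => θ (‖y - x₀‖ ^ 2) • (y - x₀)) y v =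
      θ t • v + (2 * deriv θ t * inner ℝ z v) • z := by
    intro v
    have h1 := (h.hasFDerivAt_radial x₀ y).smul ((hasFDerivAt_id (𝕜 := ℝ) y).sub_const x₀)
    have h2 : fderiv ℝ (fun y : Eu n => θ (‖y - x₀‖ ^ 2) • (y - x₀)) y = _ := h1.fderiv
    rw [h2]
    rfl
  have hdiv : divergence (fun y : Eu n => θ (‖y - x₀‖ ^ 2) • (y - x₀)) y =
      n * θ t + 2 * (t * deriv θ t) := by
    have h1 : ∀ j, (fderiv ℝ (fun y : Eu n => θ (‖y - x₀‖ ^ 2) • (y - x₀)) y (stdVec j)) j =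
        θ t + 2 * deriv θ t * (z j * z j) := by
      intro j
      rw [hX, inner_stdVec]
      simp [stdVec]
      ring
    simp only [divergence, h1]
    rw [Finset.sum_add_distrib, ← Finset.mul_sum, sum_coord_sq, ← ht]
    simp
    ring
  have hterm : ∀ i, hs (D f y i) ((D f y i).comp
      (fderiv ℝ (fun y : Eu n => θ (‖y - x₀‖ ^ 2) • (y - x₀)) y)) =
      θ t * hs (D f y i) (D f y i) + 2 * deriv θ t * ‖D f y i z‖ ^ 2 := by
    intro i
    have h1 : ∀ j, inner ℝ (D f y i (stdVec j)) (((D f y i).comp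
        (fderiv ℝ (fun y : Eu n => θ (‖y - x₀‖ ^ 2) • (y - x₀)) y)) (stdVec j)) =
        θ t * inner ℝ (D f y i (stdVec j)) (D f y i (stdVec j)) +
          2 * deriv θ t * inner ℝ (z j • D f y i (stdVec j)) (D f y i z) := by
      intro j
      rw [ContinuousLinearMap.comp_apply, hX, map_add, map_smul, map_smul, inner_add_right,
        inner_smul_right, inner_smul_right, real_inner_smul_left, inner_stdVec]
      ring
    simp only [hs, h1]
    rw [Finset.sum_add_distrib, ← Finset.mul_sum, ← Finset.mul_sum, ← sum_inner,
      ← map_eq_sum_stdVec, real_inner_self_eq_norm_sq]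
  simp only [innerIntegrand, hterm, hdiv]
  rw [Finset.sum_add_distrib, ← Finset.mul_sum, ← Finset.mul_sum]
  change 2 * (θ t * energy f y + 2 * deriv θ t * radialEnergy f x₀ y) - energy f y * _ = _
  ring

/-- The first variation identities for radial test functions. -/
theorem DirStationary.outer_radial (hf : DirStationary Ω f) (hR : 0 < R)
    (hsub : Metric.ball x₀ R ⊆ Ω) (h : IsRadialProfile R θ) :
    IntegrableOn (fun y => θ (‖y - x₀‖ ^ 2) * energy f y +
      2 * deriv θ (‖y - x₀‖ ^ 2) * radialPairing f x₀ y) Ω ∧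
    ∫ y in Ω, (θ (‖y - x₀‖ ^ 2) * energy f y +
      2 * deriv θ (‖y - x₀‖ ^ 2) * radialPairing f x₀ y) = 0 := by
  have h1 := hf.outer _ (isOuterTest_radial h hR hsub)
  rwa [show outerIntegrand f (fun y v => θ (‖y - x₀‖ ^ 2) • v) = _ from
    funext fun y => outerIntegrand_radial h y] at h1

theorem DirStationary.inner_radial (hf : DirStationary Ω f) (hR : 0 < R)
    (hsub : Metric.ball x₀ R ⊆ Ω) (h : IsRadialProfile R θ) :
    IntegrableOn (fun y => ((2 - n) * θ (‖y - x₀‖ ^ 2) +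
        (-2) * (‖y - x₀‖ ^ 2 * deriv θ (‖y - x₀‖ ^ 2))) * energy f y +
        4 * deriv θ (‖y - x₀‖ ^ 2) * radialEnergy f x₀ y) Ω ∧
    ∫ y in Ω, (((2 - n) * θ (‖y - x₀‖ ^ 2) +
        (-2) * (‖y - x₀‖ ^ 2 * deriv θ (‖y - x₀‖ ^ 2))) * energy f y +
        4 * deriv θ (‖y - x₀‖ ^ 2) * radialEnergy f x₀ y) = 0 := by
  obtain ⟨K, hK, hKR, hK0⟩ := h.exists_compact x₀ hR
  obtain ⟨hc, hs⟩ := hasCompactSupport_and_tsupport_of_compact hK (hKR.trans hsub)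
    (η := fun y : Eu n => θ (‖y - x₀‖ ^ 2) • (y - x₀)) fun y hy => by rw [hK0 y hy, zero_smul]
  have h1 := hf.inner (fun y => θ (‖y - x₀‖ ^ 2) • (y - x₀)) ((h.contDiff_radial x₀).smul (contDiff_id.sub contDiff_const)) hc hs
  rwa [show innerIntegrand f (fun y => θ (‖y - x₀‖ ^ 2) • (y - x₀)) = _ from
    funext fun y => innerIntegrand_radial h y] at h1

/-- Integration by parts of `|f|²` against a radial field. -/
theorem MemW12.integral_radialPairing (hf : MemW12 Ω f) (hΩ : IsOpen Ω)
    (hb : Bornology.IsBounded Ω) (hR : 0 < R) (hsub : Metric.ball x₀ R ⊆ Ω)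
    (h : IsRadialProfile R θ) :
    IntegrableOn (fun y => θ (‖y - x₀‖ ^ 2) * radialPairing f x₀ y) Ω ∧
    2 * ∫ y in Ω, θ (‖y - x₀‖ ^ 2) * radialPairing f x₀ y =
      - ∫ y in Ω, normSq (f y) * (n * θ (‖y - x₀‖ ^ 2) +
        2 * (‖y - x₀‖ ^ 2 * deriv θ (‖y - x₀‖ ^ 2))) := by
  obtain ⟨-, hρ, G, hG⟩ := hf.exists_weakDeriv_normSq hΩ hb
  obtain ⟨K, hK, hKR, hK0⟩ := h.exists_compact x₀ hR
  set X : Fin n → Eu n → ℝ := fun j y => θ (‖y - x₀‖ ^ 2) * (y - x₀) j with hX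
  have hXs : ∀ j, ContDiff ℝ ∞ (X j) := fun j => by
    refine (h.contDiff_radial x₀).mul ?_
    exact (EuclideanSpace.proj (𝕜 := ℝ) j).contDiff.comp (contDiff_id.sub contDiff_const)
  have hXc : ∀ j, HasCompactSupport (X j) ∧ tsupport (X j) ⊆ Ω := fun j =>
    hasCompactSupport_and_tsupport_of_compact hK (hKR.trans hsub) fun y hy => by
      simp only [hX, hK0 y hy, zero_mul]
  have hXd : ∀ j y, fderiv ℝ (X j) y (stdVec j) =
      θ (‖y - x₀‖ ^ 2) + 2 * deriv θ (‖y - x₀‖ ^ 2) * ((y - x₀) j * (y - x₀) j) := by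
    intro j y
    have h1 : HasFDerivAt (fun y : Eu n => (y - x₀) j)
        (EuclideanSpace.proj (𝕜 := ℝ) j : Eu n →L[ℝ] ℝ) y :=
      (EuclideanSpace.proj (𝕜 := ℝ) j : Eu n →L[ℝ] ℝ).hasFDerivAt.comp y
        ((hasFDerivAt_id y).sub_const x₀)
    have h2 := (h.hasFDerivAt_radial x₀ y).mul h1
    have h3 : fderiv ℝ (X j) y = _ := h2.fderiv
    rw [h3]
    change θ (‖y - x₀‖ ^ 2) * (stdVec j) j +
      (y - x₀) j * (2 * deriv θ (‖y - x₀‖ ^ 2) * inner ℝ (y - x₀) (stdVec j)) = _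
    rw [inner_stdVec]
    simp [stdVec]
    ring
  have hbd : ∀ j, ∃ C, ∀ y, ‖X j y‖ ≤ C := fun j =>
    (hXs j).continuous.bounded_above_of_compact_support (hXc j).1
  have hbd' : ∀ j, ∃ C, ∀ y, ‖fderiv ℝ (X j) y (stdVec j)‖ ≤ C := fun j =>
    (continuous_fderiv_stdVec (hXs j) j).bounded_above_of_compact_support
      (hasCompactSupport_fderiv_stdVec (hXc j).1 j)
  have hi : ∀ j, IntegrableOn (fun y => G j y * X j y) Ω := fun j => by
    obtain ⟨C, hC⟩ := hbd j
    exact integrableOn_mul_of_bounded (hG j).1 (hXs j).continuous hC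
  have hi' : ∀ j, IntegrableOn (fun y => normSq (f y) * fderiv ℝ (X j) y (stdVec j)) Ω :=
    fun j => by
      obtain ⟨C, hC⟩ := hbd' j
      exact integrableOn_mul_of_bounded hρ (continuous_fderiv_stdVec (hXs j) j) hC
  have hae : (fun y => ∑ j, G j y * X j y) =ᵐ[volume.restrict Ω]
      fun y => 2 * (θ (‖y - x₀‖ ^ 2) * radialPairing f x₀ y) := by
    filter_upwards [ae_all_iff.2 fun j => (hG j).2.2] with y hy
    have h1 : radialPairing f x₀ y =
        ∑ j, (y - x₀) j * ∑ i, inner ℝ (val f y i) (D f y i (stdVec j)) := by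
      simp only [radialPairing, Finset.mul_sum]
      rw [Finset.sum_comm]
      refine Finset.sum_congr rfl fun i _ => ?_
      rw [map_eq_sum_stdVec (D f y i) (y - x₀), inner_sum]
      simp only [inner_smul_right]
    rw [h1, Finset.mul_sum, Finset.mul_sum]
    refine Finset.sum_congr rfl fun j _ => ?_
    rw [hy j]
    simp only [hX]
    ring
  have hsum : IntegrableOn (fun y => 2 * (θ (‖y - x₀‖ ^ 2) * radialPairing f x₀ y)) Ω :=
    (integrable_finsetSum _ fun j _ => hi j).congr hae
  refine ⟨?_, ?_⟩
  · have := hsum.const_mul (1 / 2)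
    refine this.congr (Eventually.of_forall fun y => ?_)
    simp only
    ring
  · rw [← integral_const_mul, ← integral_congr_ae hae, integral_finsetSum _ fun j _ => hi j]
    have h1 : ∀ j, ∫ y in Ω, G j y * X j y =
        - ∫ y in Ω, normSq (f y) * fderiv ℝ (X j) y (stdVec j) := fun j => by
      rw [(hG j).2.1 (X j) (hXs j) (hXc j).1 (hXc j).2, neg_neg]
    simp only [h1]
    rw [Finset.sum_neg_distrib, ← integral_finsetSum _ fun j _ => hi' j]
    congr 2
    funext y
    rw [← Finset.mul_sum]
    simp only [hXd]
    rw [Finset.sum_add_distrib, ← Finset.mul_sum, sum_coord_sq]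
    simp
    left
    ring

end Variations

/-! ### An integral inequality involving |f|² only. -/

section RadialInequality

variable {n Q m : ℕ} {Ω : Set (Eu n)} {f : Eu n → AQ Q m} {x₀ : Eu n} {R : ℝ}

theorem IsRadialProfile.integrableOn_mul {ρ : Eu n → ℝ} (hρ : IntegrableOn ρ Ω) (x₀ : Eu n)
    {θ : ℝ → ℝ} (h : IsRadialProfile R θ) (hR : 0 < R) :
    IntegrableOn (fun y => ρ y * θ (‖y - x₀‖ ^ 2)) Ω := by
  obtain ⟨K, hK, -, hK0⟩ := h.exists_compact x₀ hR
  obtain ⟨C, hC⟩ := (h.contDiff_radial x₀).continuous.bounded_above_of_compact_support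
    (hasCompactSupport_and_tsupport_of_compact hK (Set.subset_univ _) hK0).1
  exact integrableOn_mul_of_bounded hρ (h.contDiff_radial x₀).continuous hC

/-- The expression is ∑‖Dfᵢ(y - x₀) - c fᵢ‖², which measures the failure of homogeneity of degree
`c`. The jet hypothesis ensures that the `val f y i` enumerate `f y`. -/
theorem radialEnergy_sub_add_nonneg {y : Eu n} (hy : IsApproxJet f y (jet f y)) (c : ℝ) :
    0 ≤ radialEnergy f x₀ y - 2 * c * radialPairing f x₀ y + c ^ 2 * normSq (f y) := by
  have h1 : normSq (f y) = ∑ i, ‖val f y i‖ ^ 2 := by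
    rw [← hy.value, normSq_ofPoints]
    rfl
  have h2 : radialEnergy f x₀ y - 2 * c * radialPairing f x₀ y + c ^ 2 * normSq (f y) =
      ∑ i, ‖D f y i (y - x₀) - c • val f y i‖ ^ 2 := by
    rw [h1, radialEnergy, radialPairing, Finset.mul_sum, Finset.mul_sum, ← Finset.sum_sub_distrib,
      ← Finset.sum_add_distrib]
    refine Finset.sum_congr rfl fun i _ => ?_
    rw [norm_sub_sq_real, inner_smul_right, norm_smul, mul_pow, Real.norm_eq_abs, sq_abs,
      real_inner_comm]
    ring
  rw [h2]
  positivity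

/-- The convexity inequality satisfied by the radial distribution of `|f|²`. -/
theorem DirStationary.integral_normSq_radial_nonneg (hf : DirStationary Ω f) (hΩ : IsOpen Ω)
    (hb : Bornology.IsBounded Ω) (hR : 0 < R) (hsub : Metric.ball x₀ R ⊆ Ω) {w ξ : ℝ → ℝ}
    (hw : IsRadialProfile R w) (hw0 : ∀ t, 0 ≤ w t) (hξ : ∀ t, ξ t = n * w t + 2 * (t * deriv w t))
    (c : ℝ) :
    0 ≤ ∫ y in Ω, normSq (f y) * (c ^ 2 * w (‖y - x₀‖ ^ 2) + c * ξ (‖y - x₀‖ ^ 2) +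
      1 / 4 * (n * ξ (‖y - x₀‖ ^ 2) + 2 * (‖y - x₀‖ ^ 2 * deriv ξ (‖y - x₀‖ ^ 2)))) := by
  obtain ⟨θ, hθ, hθd⟩ := hw.exists_antideriv
  have hθ' : deriv θ = w := funext fun t => (hθd t).deriv
  have hξp : IsRadialProfile R ξ := by
    rw [show ξ = _ from funext hξ]
    exact hw.linear hw.derivative n 2
  have hξ2 : IsRadialProfile R fun t => n * ξ t + 2 * (t * deriv ξ t) :=
    hξp.linear hξp.derivative n 2
  -- This is the coefficient of |Df|² in the inner variation with profile θ. Used as the profile of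
  -- the outer variation, it makes the two energy terms cancel; its derivative is -ξ.
  have hχ : IsRadialProfile R fun t => (2 - n) * θ t + (-2) * (t * w t) := hθ.linear hw (2 - n) (-2)
  have hχ' : ∀ t, deriv (fun t => (2 - n) * θ t + (-2) * (t * w t)) t = -ξ t := by
    intro t
    have h1 : HasDerivAt w (deriv w t) t := (hw.smooth.differentiable (by simp) t).hasDerivAt
    have h2 := ((hθd t).const_mul (2 - n : ℝ)).add (((hasDerivAt_id t).mul h1).const_mul (-2))
    have h3 : deriv (fun t => (2 - n) * θ t + (-2) * (t * w t)) t = _ := h2.deriv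
    rw [h3, hξ]
    simp
    ring
  obtain ⟨hjet, hρ, -⟩ := hf.memW12.exists_weakDeriv_normSq hΩ hb
  have I1 := hf.inner_radial hR hsub hθ
  have I2 := hf.outer_radial hR hsub hχ
  simp only [hχ', hθ'] at I1 I2
  obtain ⟨J1, J2⟩ := hf.memW12.integral_radialPairing hΩ hb hR hsub hξp
  obtain ⟨K1, K2⟩ := hf.memW12.integral_radialPairing hΩ hb hR hsub hw
  simp only [← hξ] at K2
  set B := radialPairing f x₀
  set E := radialEnergy f x₀
  have hdiff : ∀ y, 4 * (w (‖y - x₀‖ ^ 2) * E y) =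
      (((2 - n) * θ (‖y - x₀‖ ^ 2) + (-2) * (‖y - x₀‖ ^ 2 * w (‖y - x₀‖ ^ 2))) * energy f y +
        4 * w (‖y - x₀‖ ^ 2) * E y) -
      (((2 - n) * θ (‖y - x₀‖ ^ 2) + (-2) * (‖y - x₀‖ ^ 2 * w (‖y - x₀‖ ^ 2))) * energy f y +
        2 * -ξ (‖y - x₀‖ ^ 2) * B y) - 2 * (ξ (‖y - x₀‖ ^ 2) * B y) := fun y => by ring
  have hE1 : IntegrableOn (fun y => 4 * (w (‖y - x₀‖ ^ 2) * E y)) Ω := by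
    simp only [hdiff]
    exact (I1.1.sub I2.1).sub (J1.const_mul 2)
  -- Inner variation minus outer variation: only the radial energy and the pairing weighted by ξ
  -- survive.
  have hE2 : ∫ y in Ω, 4 * (w (‖y - x₀‖ ^ 2) * E y) =
      - (2 * ∫ y in Ω, ξ (‖y - x₀‖ ^ 2) * B y) := by
    simp only [hdiff]
    rw [integral_sub (by exact I1.1.sub I2.1) (J1.const_mul 2), integral_sub I1.1 I2.1, I1.2, I2.2,
      integral_const_mul]
    ring
  rw [J2, neg_neg, integral_const_mul] at hE2
  have hE3 : IntegrableOn (fun y => w (‖y - x₀‖ ^ 2) * E y) Ω := by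
    refine (hE1.const_mul (1 / 4)).congr (Eventually.of_forall fun y => ?_)
    simp only
    ring
  have hpos : 0 ≤ ∫ y in Ω, (w (‖y - x₀‖ ^ 2) * E y - 2 * c * (w (‖y - x₀‖ ^ 2) * B y) +
      c ^ 2 * (normSq (f y) * w (‖y - x₀‖ ^ 2))) := by
    refine integral_nonneg_of_ae ?_
    filter_upwards [hjet] with y hy
    have h1 := mul_nonneg (hw0 (‖y - x₀‖ ^ 2)) (radialEnergy_sub_add_nonneg (x₀ := x₀) hy c)
    change 0 ≤ _
    refine h1.trans (le_of_eq ?_)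
    ring
  have hρw := hw.integrableOn_mul hρ x₀ hR
  have hρξ := hξp.integrableOn_mul hρ x₀ hR
  have hρξ2 := hξ2.integrableOn_mul hρ x₀ hR
  rw [integral_add (by exact hE3.sub (K1.const_mul _)) (hρw.const_mul _),
    integral_sub hE3 (K1.const_mul _), integral_const_mul, integral_const_mul] at hpos
  have hfin : ∀ y, normSq (f y) * (c ^ 2 * w (‖y - x₀‖ ^ 2) + c * ξ (‖y - x₀‖ ^ 2) +
      1 / 4 * (n * ξ (‖y - x₀‖ ^ 2) + 2 * (‖y - x₀‖ ^ 2 * deriv ξ (‖y - x₀‖ ^ 2)))) =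
      c ^ 2 * (normSq (f y) * w (‖y - x₀‖ ^ 2)) + c * (normSq (f y) * ξ (‖y - x₀‖ ^ 2)) +
      1 / 4 * (normSq (f y) * (n * ξ (‖y - x₀‖ ^ 2) +
        2 * (‖y - x₀‖ ^ 2 * deriv ξ (‖y - x₀‖ ^ 2)))) := fun y => by ring
  simp only [hfin]
  rw [integral_add (by exact (hρw.const_mul _).add (hρξ.const_mul _)) (hρξ2.const_mul _),
    integral_add (hρw.const_mul _) (hρξ.const_mul _), integral_const_mul, integral_const_mul,
    integral_const_mul]
  have h1 : c * (2 * ∫ y in Ω, w (‖y - x₀‖ ^ 2) * B y) =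
      c * -∫ y in Ω, normSq (f y) * ξ (‖y - x₀‖ ^ 2) := by rw [K2]
  linarith

end RadialInequality

/-! ### Power weights on the logarithmic scale. -/

section PowerProfiles

/-- The profile `t ↦ t^{-τ} v(log t)`. -/
noncomputable def powProfile (τ : ℝ) (v : ℝ → ℝ) (t : ℝ) : ℝ :=
  if 0 < t then t ^ (-τ) * v (Real.log t) else 0

variable {τ : ℝ} {v : ℝ → ℝ} {α β : ℝ}

theorem powProfile_of_pos {t : ℝ} (ht : 0 < t) : powProfile τ v t = t ^ (-τ) * v (Real.log t) :=
  if_pos ht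

theorem powProfile_of_nonpos {t : ℝ} (ht : t ≤ 0) : powProfile τ v t = 0 := if_neg (not_lt.2 ht)

theorem powProfile_nonneg (hv : ∀ σ, 0 ≤ v σ) (t : ℝ) : 0 ≤ powProfile τ v t := by
  unfold powProfile
  split_ifs with h
  · exact mul_nonneg (Real.rpow_nonneg h.le _) (hv _)
  · exact le_rfl

theorem powProfile_eventuallyEq_zero (h : ∀ σ < α, v σ = 0) {t : ℝ} (ht : t < Real.exp α) :
    powProfile τ v =ᶠ[𝓝 t] fun _ => 0 := by
  filter_upwards [gt_mem_nhds ht] with s hs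
  unfold powProfile
  split_ifs with h0
  · rw [h _ ((Real.log_lt_iff_lt_exp h0).2 hs), mul_zero]
  · rfl

/-- Since `v` vanishes to the left of α, the profile is zero for t < exp α, which removes the
singularity at t = 0. -/
theorem contDiff_powProfile (hv : ContDiff ℝ ∞ v) (h : ∀ σ < α, v σ = 0) :
    ContDiff ℝ ∞ (powProfile τ v) := by
  rw [contDiff_iff_contDiffAt]
  intro t
  rcases lt_or_ge 0 t with ht | ht
  · have h1 : ContDiffAt ℝ ∞ (fun t : ℝ => t ^ (-τ) * v (Real.log t)) t :=
      (Real.contDiffAt_rpow_const_of_ne ht.ne').mul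
        (hv.contDiffAt.comp t (Real.contDiffAt_log.2 ht.ne'))
    refine h1.congr_of_eventuallyEq ?_
    filter_upwards [lt_mem_nhds ht] with s hs
    exact powProfile_of_pos hs
  · exact contDiffAt_const.congr_of_eventuallyEq
      (powProfile_eventuallyEq_zero h (ht.trans_lt (Real.exp_pos α)))

theorem isRadialProfile_powProfile {R : ℝ} (hv : ContDiff ℝ ∞ v) (h : ∀ σ < α, v σ = 0)
    (h' : ∀ σ, β < σ → v σ = 0) (hβ : Real.exp β < R ^ 2) :
    IsRadialProfile R (powProfile τ v) := by
  have h0 := Real.exp_pos β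
  refine ⟨contDiff_powProfile hv h, (Real.exp β + R ^ 2) / 2, by linarith, by linarith,
    fun t ht => ?_⟩
  have ht0 : 0 < t := by linarith
  rw [powProfile_of_pos ht0, h' _ ((Real.lt_log_iff_exp_lt ht0).2 (by linarith)), mul_zero]

/-- In the variable log t the Euler operator t d/dt is an ordinary derivative, and the factor t^(-τ)
shifts it by -τ. -/
theorem mul_deriv_powProfile (hv : ContDiff ℝ ∞ v) (h : ∀ σ < α, v σ = 0) (t : ℝ) :
    t * deriv (powProfile τ v) t = -τ * powProfile τ v t + powProfile τ (deriv v) t := by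
  rcases lt_or_ge 0 t with ht | ht
  · have h1 : HasDerivAt (fun t : ℝ => t ^ (-τ) * v (Real.log t))
        (-τ * t ^ (-τ - 1) * v (Real.log t) + t ^ (-τ) * (deriv v (Real.log t) * t⁻¹)) t :=
      (Real.hasDerivAt_rpow_const (Or.inl ht.ne')).mul
        ((hv.differentiable (by simp) (Real.log t)).hasDerivAt.comp t (Real.hasDerivAt_log ht.ne'))
    have h2 : powProfile τ v =ᶠ[𝓝 t] fun t : ℝ => t ^ (-τ) * v (Real.log t) := by
      filter_upwards [lt_mem_nhds ht] with s hs
      exact powProfile_of_pos hs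
    rw [h2.deriv_eq, h1.deriv, powProfile_of_pos ht, powProfile_of_pos ht, Real.rpow_sub_one ht.ne']
    field_simp
  · rw [(powProfile_eventuallyEq_zero h (ht.trans_lt (Real.exp_pos α))).deriv_eq, deriv_const,
      powProfile_of_nonpos ht, powProfile_of_nonpos ht]
    ring

theorem deriv_eq_zero_of_lt (h : ∀ σ < α, v σ = 0) : ∀ σ < α, deriv v σ = 0 := fun σ hσ => by
  have h1 : v =ᶠ[𝓝 σ] fun _ => 0 := by
    filter_upwards [gt_mem_nhds hσ] with s hs using h s hs
  rw [h1.deriv_eq, deriv_const]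

theorem deriv_eq_zero_of_gt (h : ∀ σ, β < σ → v σ = 0) : ∀ σ, β < σ → deriv v σ = 0 :=
  fun σ hσ => by
    have h1 : v =ᶠ[𝓝 σ] fun _ => 0 := by
      filter_upwards [lt_mem_nhds hσ] with s hs using h s hs
    rw [h1.deriv_eq, deriv_const]

variable {n Q m : ℕ} {Ω : Set (Eu n)} {f : Eu n → AQ Q m} {x₀ : Eu n} {R : ℝ}

theorem DirStationary.integral_powProfile_nonneg (hf : DirStationary Ω f) (hΩ : IsOpen Ω)
    (hb : Bornology.IsBounded Ω) (hR : 0 < R) (hsub : Metric.ball x₀ R ⊆ Ω)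
    (hv : ContDiff ℝ ∞ v) (h : ∀ σ < α, v σ = 0) (h' : ∀ σ, β < σ → v σ = 0)
    (hβ : Real.exp β < R ^ 2) (hv0 : ∀ σ, 0 ≤ v σ) (τ : ℝ) :
    0 ≤ ∫ y in Ω, normSq (f y) * powProfile τ (deriv (deriv v)) (‖y - x₀‖ ^ 2) := by
  have hv' := (contDiff_infty_iff_deriv.1 hv).2
  set W := powProfile τ v
  set W' := powProfile τ (deriv v)
  set W'' := powProfile τ (deriv (deriv v))
  have h1 : ∀ t, t * deriv W t = -τ * W t + W' t := mul_deriv_powProfile hv h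
  have h2 : ∀ t, t * deriv W' t = -τ * W' t + W'' t :=
    mul_deriv_powProfile hv' (deriv_eq_zero_of_lt h)
  have hWp : IsRadialProfile R W := isRadialProfile_powProfile hv h h' hβ
  have hWp' : IsRadialProfile R W' := isRadialProfile_powProfile hv' (deriv_eq_zero_of_lt h)
    (deriv_eq_zero_of_gt h') hβ
  set ξ : ℝ → ℝ := fun t => (n - 2 * τ) * W t + 2 * W' t with hξdef
  have hξ : ∀ t, ξ t = n * W t + 2 * (t * deriv W t) := fun t => by
    rw [h1, hξdef]; ring
  have hξd : ∀ t, t * deriv ξ t = (n - 2 * τ) * (t * deriv W t) + 2 * (t * deriv W' t) := by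
    intro t
    have h3 := (((hWp.smooth.differentiable (by simp) t).hasDerivAt.const_mul (n - 2 * τ)).add
      ((hWp'.smooth.differentiable (by simp) t).hasDerivAt.const_mul 2))
    have h4 : deriv ξ t = _ := h3.deriv
    rw [h4]
    ring
  -- Maps homogeneous of degree τ - n/2 have annulus integrals proportional to r^(2τ). With L = n +
  -- 2t d/dt the weight is (c + L/2)²W, L acts on v as n - 2τ + 2d/dσ, and this `c` leaves exactly
  -- v''.
  have key := hf.integral_normSq_radial_nonneg hΩ hb hR hsub hWp (powProfile_nonneg hv0) hξ
    (τ - n / 2)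
  refine key.trans (le_of_eq ?_)
  congr 1
  funext y
  congr 1
  rw [hξd, h1, h2, hξdef]
  ring

end PowerProfiles

/-! ### Convexity in log r and passage to annuli. -/

section Convexity

variable {n Q m : ℕ} {Ω : Set (Eu n)} {τ ℓ : ℝ} {q : ℝ → ℝ}

/-- The integral of `ρ` against the profile `q`, translated by `s` on the logarithmic scale. -/
noncomputable def logIntegral (Ω : Set (Eu n)) (ρ : Eu n → ℝ) (x₀ : Eu n) (τ : ℝ) (q : ℝ → ℝ)
    (s : ℝ) : ℝ :=
  ∫ y in Ω, ρ y * powProfile τ (fun σ => q (σ - s)) (‖y - x₀‖ ^ 2)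

theorem hasDerivAt_powProfile_translate (hq : ContDiff ℝ ∞ q) (t s : ℝ) :
    HasDerivAt (fun s => powProfile τ (fun σ => q (σ - s)) t)
      (-powProfile τ (fun σ => deriv q (σ - s)) t) s := by
  unfold powProfile
  split_ifs with ht
  · have h1 : HasDerivAt (fun s => q (Real.log t - s)) (deriv q (Real.log t - s) * (-1)) s :=
      ((hq.differentiable (by simp)) _).hasDerivAt.comp s ((hasDerivAt_id s).const_sub _)
    refine (h1.const_mul (t ^ (-τ))).congr_deriv ?_
    ring
  · rw [neg_zero]
    exact hasDerivAt_const s 0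

/-- Where the profile is nonzero, log t lies in [s, s + ℓ], so t^(-τ) is bounded uniformly for `s`
near `s₀`. This provides the majorant for differentiation under the integral. -/
theorem abs_powProfile_translate_le (h : ∀ σ < 0, q σ = 0) (h' : ∀ σ, ℓ < σ → q σ = 0) {C : ℝ}
    (hC : ∀ σ, |q σ| ≤ C) {s₀ s : ℝ} (hs : |s - s₀| ≤ 1) (t : ℝ) :
    |powProfile τ (fun σ => q (σ - s)) t| ≤ Real.exp (|τ| * (|s₀| + 1 + |ℓ|)) * C := by
  have hC0 : 0 ≤ C := (abs_nonneg _).trans (hC 0)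
  unfold powProfile
  split_ifs with ht
  · change |t ^ (-τ) * q (Real.log t - s)| ≤ _
    by_cases h1 : Real.log t - s < 0
    · rw [h _ h1, mul_zero, abs_zero]
      positivity
    by_cases h2 : ℓ < Real.log t - s
    · rw [h' _ h2, mul_zero, abs_zero]
      positivity
    rw [not_lt] at h1 h2
    rw [abs_mul, abs_of_pos (Real.rpow_pos_of_pos ht _), Real.rpow_def_of_pos ht]
    refine mul_le_mul (Real.exp_le_exp.2 ?_) (hC _) (abs_nonneg _) (Real.exp_pos _).le
    have h3 : |Real.log t| ≤ |s₀| + 1 + |ℓ| := by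
      have := abs_le.1 hs
      have := neg_abs_le s₀
      have := le_abs_self s₀
      have := le_abs_self ℓ
      have := abs_nonneg ℓ
      exact abs_le.2 ⟨by linarith, by linarith⟩
    calc Real.log t * -τ ≤ |Real.log t * -τ| := le_abs_self _
      _ = |τ| * |Real.log t| := by rw [abs_mul, abs_neg, mul_comm]
      _ ≤ _ := by gcongr
  · rw [abs_zero]
    positivity

theorem exists_bound_of_vanish (hq : Continuous q) (h : ∀ σ < 0, q σ = 0)
    (h' : ∀ σ, ℓ < σ → q σ = 0) : ∃ C, ∀ σ, |q σ| ≤ C :=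
  hq.bounded_above_of_compact_support (HasCompactSupport.of_support_subset_isCompact
    (isCompact_Icc (a := 0) (b := ℓ)) fun σ hσ => by
      refine ⟨not_lt.1 fun hc => hσ (h σ hc), not_lt.1 fun hc => hσ (h' σ hc)⟩)

theorem continuous_powProfile_translate (hq : ContDiff ℝ ∞ q) (h : ∀ σ < 0, q σ = 0) (s : ℝ)
    (x₀ : Eu n) :
    Continuous fun y : Eu n => powProfile τ (fun σ => q (σ - s)) (‖y - x₀‖ ^ 2) := by
  have h1 : ContDiff ℝ ∞ (powProfile τ fun σ => q (σ - s)) :=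
    contDiff_powProfile (α := s) (hq.comp (by fun_prop)) fun σ hσ => h _ (by linarith)
  exact h1.continuous.comp (by fun_prop)

theorem hasDerivAt_logIntegral {ρ : Eu n → ℝ} (hρ : IntegrableOn ρ Ω) (x₀ : Eu n)
    (hq : ContDiff ℝ ∞ q) (h : ∀ σ < 0, q σ = 0) (h' : ∀ σ, ℓ < σ → q σ = 0) (s : ℝ) :
    HasDerivAt (logIntegral Ω ρ x₀ τ q) (-logIntegral Ω ρ x₀ τ (deriv q) s) s := by
  have hq' := (contDiff_infty_iff_deriv.1 hq).2
  obtain ⟨C, hC⟩ := exists_bound_of_vanish hq.continuous h h'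
  obtain ⟨C', hC'⟩ := exists_bound_of_vanish hq'.continuous (deriv_eq_zero_of_lt h)
    (deriv_eq_zero_of_gt h')
  have hc := fun s => continuous_powProfile_translate (τ := τ) hq h s x₀
  have hc' := fun s => continuous_powProfile_translate (τ := τ) hq' (deriv_eq_zero_of_lt h) s x₀
  have key := (hasDerivAt_integral_of_dominated_loc_of_deriv_le (μ := volume.restrict Ω)
    (F := fun s y => ρ y * powProfile τ (fun σ => q (σ - s)) (‖y - x₀‖ ^ 2))
    (F' := fun s y => ρ y * -powProfile τ (fun σ => deriv q (σ - s)) (‖y - x₀‖ ^ 2))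
    (bound := fun y => |ρ y| * (Real.exp (|τ| * (|s| + 1 + |ℓ|)) * C'))
    (Metric.ball_mem_nhds s one_pos) ?_ ?_ ?_ ?_ ?_ ?_).2
  · refine key.congr_deriv ?_
    simp only [mul_neg, integral_neg]
    rfl
  · exact Eventually.of_forall fun s' => hρ.aestronglyMeasurable.mul (hc s').aestronglyMeasurable
  · exact integrableOn_mul_of_bounded hρ (hc s)
      fun y => abs_powProfile_translate_le h h' hC (by simp : |s - s| ≤ 1) _
  · exact hρ.aestronglyMeasurable.mul (hc' s).neg.aestronglyMeasurable
  · refine Eventually.of_forall fun y s' hs' => ?_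
    rw [norm_mul, norm_neg]
    refine mul_le_mul_of_nonneg_left ?_ (norm_nonneg _)
    rw [Metric.mem_ball, Real.dist_eq] at hs'
    exact abs_powProfile_translate_le (deriv_eq_zero_of_lt h) (deriv_eq_zero_of_gt h') hC'
      hs'.le _
  · exact hρ.abs.mul_const _
  · exact Eventually.of_forall fun y s' _ =>
      (hasDerivAt_powProfile_translate hq _ s').const_mul (ρ y)

variable {f : Eu n → AQ Q m} {x₀ : Eu n} {R : ℝ}

/-- Two derivatives in the translation parameter replace q by q'', and the resulting integral is
nonnegative as long as the translated support stays inside the ball of radius `R`. -/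
theorem DirStationary.convexOn_logIntegral (hf : DirStationary Ω f) (hΩ : IsOpen Ω)
    (hb : Bornology.IsBounded Ω) (hR : 0 < R) (hsub : Metric.ball x₀ R ⊆ Ω)
    (hq : ContDiff ℝ ∞ q) (h : ∀ σ < 0, q σ = 0) (h' : ∀ σ, ℓ < σ → q σ = 0)
    (hq0 : ∀ σ, 0 ≤ q σ) :
    ConvexOn ℝ {s | Real.exp (s + ℓ) < R ^ 2} (logIntegral Ω (fun y => normSq (f y)) x₀ τ q) := by
  obtain ⟨-, hρ, -⟩ := hf.memW12.exists_weakDeriv_normSq hΩ hb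
  have hq' := (contDiff_infty_iff_deriv.1 hq).2
  have hd := fun s => hasDerivAt_logIntegral (τ := τ) hρ x₀ hq h h' s
  have hd' := fun s => hasDerivAt_logIntegral (τ := τ) hρ x₀ hq' (deriv_eq_zero_of_lt h)
    (deriv_eq_zero_of_gt h') s
  refine convexOn_of_hasDerivWithinAt2_nonneg
    (f' := fun s => -logIntegral Ω (fun y => normSq (f y)) x₀ τ (deriv q) s)
    (f'' := fun s => logIntegral Ω (fun y => normSq (f y)) x₀ τ (deriv (deriv q)) s) ?_
    (fun s _ => (hd s).continuousAt.continuousWithinAt) (fun s _ => (hd s).hasDerivWithinAt)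
    (fun s _ => ((hd' s).neg.congr_deriv (neg_neg _)).hasDerivWithinAt) (fun s hs => ?_)
  · have h1 : {s | Real.exp (s + ℓ) < R ^ 2} = Set.Iio (Real.log (R ^ 2) - ℓ) := by
      ext s
      rw [Set.mem_ofPred_eq, Set.mem_Iio, lt_sub_iff_add_lt, Real.lt_log_iff_exp_lt (by positivity)]
    rw [h1]
    exact convex_Iio _
  · have h0 := interior_subset hs
    have h1 : Real.exp (s + ℓ) < R ^ 2 := h0
    have h2 := hf.integral_powProfile_nonneg hΩ hb hR hsub (v := fun σ => q (σ - s)) (α := s)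
      (β := s + ℓ) (hq.comp (by fun_prop)) (fun σ hσ => h _ (by linarith))
      (fun σ hσ => h' _ (by linarith)) h1 (fun σ => hq0 _) τ
    have h3 : deriv (deriv fun σ => q (σ - s)) = fun σ => deriv (deriv q) (σ - s) := by
      have h4 : deriv (fun σ => q (σ - s)) = fun σ => deriv q (σ - s) :=
        funext fun σ => deriv_comp_sub_const q s σ
      rw [h4]
      exact funext fun σ => deriv_comp_sub_const (deriv q) s σ
    rw [h3] at h2
    exact h2

/-- Smooth approximations of the indicator function of `(0, ℓ)`. -/
noncomputable def cutoff (ℓ : ℝ) (k : ℕ) (σ : ℝ) : ℝ :=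
  Real.smoothTransition (k * σ) * Real.smoothTransition (k * (ℓ - σ))

theorem contDiff_cutoff (ℓ : ℝ) (k : ℕ) : ContDiff ℝ ∞ (cutoff ℓ k) := by
  unfold cutoff
  exact (Real.smoothTransition.contDiff.comp (by fun_prop)).mul
    (Real.smoothTransition.contDiff.comp (by fun_prop))

theorem cutoff_nonneg (ℓ : ℝ) (k : ℕ) (σ : ℝ) : 0 ≤ cutoff ℓ k σ :=
  mul_nonneg (Real.smoothTransition.nonneg _) (Real.smoothTransition.nonneg _)

theorem cutoff_le_one (ℓ : ℝ) (k : ℕ) (σ : ℝ) : cutoff ℓ k σ ≤ 1 :=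
  mul_le_one₀ (Real.smoothTransition.le_one _) (Real.smoothTransition.nonneg _)
    (Real.smoothTransition.le_one _)

theorem cutoff_of_nonpos {ℓ : ℝ} (k : ℕ) {σ : ℝ} (h : σ ≤ 0) : cutoff ℓ k σ = 0 := by
  rw [cutoff, Real.smoothTransition.zero_of_nonpos (mul_nonpos_of_nonneg_of_nonpos
    (Nat.cast_nonneg k) h), zero_mul]

theorem cutoff_of_ge {ℓ : ℝ} (k : ℕ) {σ : ℝ} (h : ℓ ≤ σ) : cutoff ℓ k σ = 0 := by
  rw [cutoff, Real.smoothTransition.zero_of_nonpos (x := k * (ℓ - σ))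
    (mul_nonpos_of_nonneg_of_nonpos (Nat.cast_nonneg k) (by linarith)), mul_zero]

theorem tendsto_cutoff (ℓ σ : ℝ) :
    Tendsto (fun k => cutoff ℓ k σ) atTop (𝓝 ((Set.Ioo 0 ℓ).indicator 1 σ)) := by
  by_cases hσ : σ ∈ Set.Ioo 0 ℓ
  · rw [Set.indicator_of_mem hσ]
    refine tendsto_const_nhds.congr' ?_
    have h1 : ∀ c : ℝ, 0 < c → ∀ᶠ k : ℕ in atTop, 1 ≤ k * c := fun c hc =>
      (tendsto_natCast_atTop_atTop.atTop_mul_const hc).eventually_ge_atTop 1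
    filter_upwards [h1 σ hσ.1, h1 (ℓ - σ) (by linarith [hσ.2])] with k hk1 hk2
    rw [cutoff, Real.smoothTransition.one_of_one_le hk1, Real.smoothTransition.one_of_one_le hk2,
      mul_one]
    rfl
  · rw [Set.indicator_of_notMem hσ]
    refine tendsto_const_nhds.congr fun k => ?_
    rcases le_or_gt σ 0 with h | h
    · exact (cutoff_of_nonpos k h).symm
    · exact (cutoff_of_ge k (not_lt.1 fun hc => hσ ⟨h, hc⟩)).symm

theorem powProfile_exp_cutoff (τ ℓ s : ℝ) (k : ℕ) {t : ℝ} (ht : 0 < t) :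
    powProfile τ (fun σ => Real.exp (τ * (σ - s)) * cutoff ℓ k (σ - s)) t =
      Real.exp (-(τ * s)) * cutoff ℓ k (Real.log t - s) := by
  rw [powProfile_of_pos ht, Real.rpow_def_of_pos ht, ← mul_assoc, ← Real.exp_add]
  congr 2
  ring

/-- On the annulus t runs from r² to 4r², a logarithmic window of length log 4 starting at s = 2 log
r. The factor exp(τσ) of the profile cancels t^(-τ) and leaves the constant exp(-τs) = r^(-2τ). -/
theorem tendsto_logIntegral_annulus (hρ : IntegrableOn (fun y => normSq (f y)) Ω) (x₀ : Eu n)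
    {r : ℝ} (hr : 0 < r) (hsub : Metric.ball x₀ (2 * r) ⊆ Ω) (τ : ℝ) :
    Tendsto (fun k => logIntegral Ω (fun y => normSq (f y)) x₀ τ
      (fun σ => Real.exp (τ * σ) * cutoff (Real.log 4) k σ) (2 * Real.log r)) atTop
      (𝓝 (annulusL2Sq f x₀ r / r ^ (2 * τ))) := by
  set s := 2 * Real.log r with hs
  set A := Metric.ball x₀ (2 * r) \ Metric.ball x₀ r with hA
  have hAm : MeasurableSet A := measurableSet_ball.diff measurableSet_ball
  have hc : Real.exp (-(τ * s)) = (r ^ (2 * τ))⁻¹ := by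
    rw [Real.exp_neg, Real.rpow_def_of_pos hr]
    congr 2
    rw [hs]
    ring
  have hlim : Tendsto (fun k => logIntegral Ω (fun y => normSq (f y)) x₀ τ
      (fun σ => Real.exp (τ * σ) * cutoff (Real.log 4) k σ) s) atTop
      (𝓝 (∫ y in Ω, A.indicator (fun y => normSq (f y) * Real.exp (-(τ * s))) y)) := by
    have hb : ∀ (k : ℕ) (y : Eu n), |powProfile τ (fun σ => Real.exp (τ * (σ - s)) *
        cutoff (Real.log 4) k (σ - s)) (‖y - x₀‖ ^ 2)| ≤ Real.exp (-(τ * s)) := by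
      intro k y
      rcases lt_or_ge 0 (‖y - x₀‖ ^ 2) with ht | ht
      · rw [powProfile_exp_cutoff _ _ _ _ ht, abs_mul, Real.abs_exp,
          abs_of_nonneg (cutoff_nonneg _ _ _)]
        exact mul_le_of_le_one_right (Real.exp_pos _).le (cutoff_le_one _ _ _)
      · rw [powProfile_of_nonpos ht, abs_zero]
        positivity
    refine tendsto_integral_of_dominated_convergence
      (fun y => |normSq (f y)| * Real.exp (-(τ * s))) (fun k => ?_) (hρ.abs.mul_const _)
      (fun k => Eventually.of_forall fun y => ?_) ?_
    · refine hρ.aestronglyMeasurable.mul (Continuous.aestronglyMeasurable ?_)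
      exact continuous_powProfile_translate
        (q := fun σ => Real.exp (τ * σ) * cutoff (Real.log 4) k σ)
        ((Real.contDiff_exp.comp (by fun_prop)).mul (contDiff_cutoff _ k))
        (fun σ hσ => by rw [cutoff_of_nonpos k hσ.le, mul_zero]) s x₀
    · rw [norm_mul]
      exact mul_le_mul_of_nonneg_left (hb k y) (norm_nonneg _)
    -- The cutoffs converge to the indicator of an open interval while the annulus contains its
    -- inner sphere; the discrepancy is a null set.
    · have hsph : ∀ᵐ y ∂(volume.restrict Ω), y ∉ Metric.sphere x₀ r := ae_restrict_of_ae
        (measure_eq_zero_iff_ae_notMem.1 (Measure.addHaar_sphere_of_ne_zero _ _ hr.ne'))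
      filter_upwards [hsph] with y hy
      have hyr : ‖y - x₀‖ ≠ r := by simpa [dist_eq_norm] using hy
      rcases (norm_nonneg (y - x₀)).lt_or_eq with hpos | hzero
      · have ht : 0 < ‖y - x₀‖ ^ 2 := by positivity
        simp only [powProfile_exp_cutoff _ _ _ _ ht]
        have h1 := ((tendsto_cutoff (Real.log 4) (Real.log (‖y - x₀‖ ^ 2) - s)).const_mul
          (Real.exp (-(τ * s)))).const_mul (normSq (f y))
        refine h1.trans (le_of_eq (congrArg 𝓝 ?_))
        have hiff : Real.log (‖y - x₀‖ ^ 2) - s ∈ Set.Ioo 0 (Real.log 4) ↔ y ∈ A := by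
          have h4 : Real.log 4 = 2 * Real.log 2 := by
            rw [show (4 : ℝ) = 2 ^ 2 by norm_num, Real.log_pow]
            norm_num
          have h5 : Real.log (‖y - x₀‖ ^ 2) = 2 * Real.log ‖y - x₀‖ := by
            rw [Real.log_pow]
            norm_num
          have h6 : Real.log r < Real.log ‖y - x₀‖ ↔ r < ‖y - x₀‖ := Real.log_lt_log_iff hr hpos
          have h7 : Real.log ‖y - x₀‖ < Real.log 2 + Real.log r ↔ ‖y - x₀‖ < 2 * r := by
            rw [← Real.log_mul two_ne_zero hr.ne']
            exact Real.log_lt_log_iff hpos (by positivity)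
          rw [hA, Set.mem_sdiff, Metric.mem_ball, Metric.mem_ball, dist_eq_norm, not_lt, ← h7,
            Set.mem_Ioo, h5, h4, hs]
          constructor
          · rintro ⟨ha, hb⟩
            exact ⟨by linarith, (h6.1 (by linarith)).le⟩
          · rintro ⟨ha, hb⟩
            have := h6.2 (lt_of_le_of_ne hb (Ne.symm hyr))
            exact ⟨by linarith, by linarith⟩
        by_cases hyA : y ∈ A
        · rw [Set.indicator_of_mem hyA, Set.indicator_of_mem (hiff.2 hyA)]
          simp
        · rw [Set.indicator_of_notMem hyA, Set.indicator_of_notMem (fun h => hyA (hiff.1 h))]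
          simp
      -- At the centre the logarithm is meaningless, but the profile is 0 there by definition and
      -- the centre is not in the annulus.
      · have hyA : y ∉ A := fun h => h.2 (by
          rw [Metric.mem_ball, dist_eq_norm, ← hzero]
          exact hr)
        have ht : ‖y - x₀‖ ^ 2 ≤ 0 := by rw [← hzero]; norm_num
        simp only [powProfile_of_nonpos ht, Set.indicator_of_notMem hyA, mul_zero]
        exact tendsto_const_nhds
  rw [setIntegral_indicator hAm, Set.inter_eq_self_of_subset_right
    (Set.sdiff_subset.trans hsub), integral_mul_const, hc, ← div_eq_mul_inv] at hlim
  exact hlim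

/-- A convex function on an interval is at most the maximum of its values at the two ends. This
holds for every smooth cutoff and survives the limit. -/
theorem DirStationary.annulus_le_add (hf : DirStationary Ω f) (hΩ : IsOpen Ω)
    (hb : Bornology.IsBounded Ω) (hsub : Metric.ball x₀ R ⊆ Ω) (τ : ℝ) {r₁ r₂ r₃ : ℝ}
    (h1 : 0 < r₁) (h12 : r₁ ≤ r₂) (h23 : r₂ ≤ r₃) (h3 : 2 * r₃ < R) :
    annulusL2Sq f x₀ r₂ / r₂ ^ (2 * τ) ≤
      max (annulusL2Sq f x₀ r₁ / r₁ ^ (2 * τ)) (annulusL2Sq f x₀ r₃ / r₃ ^ (2 * τ)) := by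
  obtain ⟨-, hρ, -⟩ := hf.memW12.exists_weakDeriv_normSq hΩ hb
  have h2 : 0 < r₂ := h1.trans_le h12
  have h3' : 0 < r₃ := h2.trans_le h23
  have hR : 0 < R := by linarith
  have hball : ∀ r, r ≤ r₃ → Metric.ball x₀ (2 * r) ⊆ Ω := fun r hr =>
    (Metric.ball_subset_ball (by linarith)).trans hsub
  have hmem : ∀ r, 0 < r → r ≤ r₃ →
      2 * Real.log r ∈ {s | Real.exp (s + Real.log 4) < R ^ 2} := by
    intro r hr hr3
    -- The support condition of the convexity statement reads (2r)² < R²: the outer sphere of the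
    -- annulus stays inside the ball.
    have h4 : Real.exp (2 * Real.log r + Real.log 4) = (2 * r) ^ 2 := by
      rw [Real.exp_add, Real.exp_log (by norm_num), two_mul, Real.exp_add, Real.exp_log hr]
      ring
    rw [Set.mem_ofPred_eq, h4]
    exact pow_lt_pow_left₀ (by linarith) (by linarith) two_ne_zero
  refine le_of_tendsto_of_tendsto' (tendsto_logIntegral_annulus hρ x₀ h2 (hball _ h23) τ)
    ((tendsto_logIntegral_annulus hρ x₀ h1 (hball _ (h12.trans h23)) τ).max
      (tendsto_logIntegral_annulus hρ x₀ h3' (hball _ le_rfl) τ)) fun k => ?_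
  have hconv := hf.convexOn_logIntegral (τ := τ) (ℓ := Real.log 4) hΩ hb hR hsub
    (q := fun σ => Real.exp (τ * σ) * cutoff (Real.log 4) k σ)
    ((Real.contDiff_exp.comp (by fun_prop)).mul (contDiff_cutoff _ k))
    (fun σ hσ => by rw [cutoff_of_nonpos k hσ.le, mul_zero])
    (fun σ hσ => by rw [cutoff_of_ge k hσ.le, mul_zero])
    (fun σ => mul_nonneg (Real.exp_pos _).le (cutoff_nonneg _ _ _))
  refine hconv.le_max_of_mem_Icc (hmem r₁ h1 (h12.trans h23)) (hmem r₃ h3' le_rfl) ⟨?_, ?_⟩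
  · have := Real.log_le_log h1 h12
    linarith
  · have := Real.log_le_log h2 h23
    linarith

theorem annulusL2Sq_nonneg (f : Eu n → AQ Q m) (x : Eu n) (r : ℝ) : 0 ≤ annulusL2Sq f x r :=
  integral_nonneg fun _ => normSq_nonneg _

end Convexity

end QValued

/-! ### The three sphere inequality. -/

theorem corollary2p1 (n : ℕ) :
    ∃ C : ℝ, 0 < C ∧
      ∀ (Q m : ℕ) (τ : ℝ), 0 < τ →
      ∀ f : QValued.Eu n → QValued.AQ Q m,
        QValued.DirStationary (Metric.ball (0 : QValued.Eu n) 1) f →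
      ∀ x ∈ Metric.ball (0 : QValued.Eu n) 1,
      ∀ r₁ r₂ r₃ : ℝ, 0 < r₁ → r₁ < r₂ → r₂ < r₃ → r₃ < (1 - ‖x‖) / 2 →
        2 < min (r₃ / r₂) (r₂ / r₁) →
        (1 / (1 + Real.log (r₃ / r₂) ^ 2) + 1 / (1 + Real.log (r₂ / r₁) ^ 2)) *
            (QValued.annulusL2Sq f x r₂ / r₂ ^ (2 * τ)) ≤
          C * (QValued.annulusL2Sq f x r₁ / r₁ ^ (2 * τ)) +
            C * (QValued.annulusL2Sq f x r₃ / r₃ ^ (2 * τ)) := by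
  -- Each of the two fractions in the bracket is at most 1, whence the constant 2; the maximum of
  -- two nonnegative terms is at most their sum.
  refine ⟨2, two_pos, fun Q m τ _ f hf x _ r₁ r₂ r₃ h1 h12 h23 h3 _ => ?_⟩
  have hsub : Metric.ball x (1 - ‖x‖) ⊆ Metric.ball (0 : QValued.Eu n) 1 :=
    Metric.ball_subset_ball' (by rw [dist_zero_right]; linarith)
  have hmax := hf.annulus_le_add Metric.isOpen_ball Metric.isBounded_ball hsub τ h1 h12.le h23.le
    (by linarith)
  have h0 : ∀ r : ℝ, 0 < r → 0 ≤ QValued.annulusL2Sq f x r / r ^ (2 * τ) := fun r hr =>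
    div_nonneg (QValued.annulusL2Sq_nonneg f x r) (Real.rpow_nonneg hr.le _)
  have hle : ∀ s : ℝ, 1 / (1 + s ^ 2) ≤ 1 := fun s =>
    div_le_one_of_le₀ (by nlinarith [sq_nonneg s]) (by positivity)
  have g1 := h0 r₁ h1
  have g2 := h0 r₂ (h1.trans h12)
  have g3 := h0 r₃ ((h1.trans h12).trans h23)
  calc _ ≤ 2 * (QValued.annulusL2Sq f x r₂ / r₂ ^ (2 * τ)) := by
        refine mul_le_mul_of_nonneg_right ?_ g2
        linarith [hle (Real.log (r₃ / r₂)), hle (Real.log (r₂ / r₁))]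
    _ ≤ 2 * (QValued.annulusL2Sq f x r₁ / r₁ ^ (2 * τ) +
        QValued.annulusL2Sq f x r₃ / r₃ ^ (2 * τ)) := by
        refine mul_le_mul_of_nonneg_left (hmax.trans (max_le ?_ ?_)) two_pos.le <;> linarith
    _ = _ := by ring
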